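/- Let $d\ge 2$, $Q=[0,1]^d\subset\mathbb{R}^d$ with the Euclidean metric and Lebesgue measure $\mathcal L^d$. For a Lipschitz function $f$ on $Q$ write $\mathrm{Lip}(f)$ for its least Lipschitz constant and $\|f\|_L=\max\{\|f\|_\infty,\mathrm{Lip}(f)\}$; for $\pi=(\pi^1,\dots,\pi^d)$ Lipschitz on $Q$, $\det \mathrm D\pi\in L^\infty(Q)$ is its a.e. defined Jacobian. A metric $k$-current on a locally compact metric space $X$ is a functional $T(f,\pi^1,\dots,\pi^k)$ on $\mathrm{Lip}_c(X)\times \mathrm{Lip}(X)^k$, linear in each variable, such that (locality) $T(f,\pi)=0$ whenever some $\pi^j$ is constant on a neighbourhood of $\operatorname{spt} f$, and (joint continuity) $T(f_i,\pi_i)\to T(f,\pi)$ whenever $f_i\to f$ and $\pi_i^j\to\pi^j$ pointwise with uniformly bounded Lipschitz constants and the supports of $f$ and of all $f_i$ lie in one compact set. $T$ is supported in a closed set $F$ if $T(f,\pi)=0$ whenever $f=0$ on $F$. Let $\mathcal D_d(Q)$ denote the metric $d$-currents on $Q$. A formal Lipschitz sum $\sum_i(f_i,\pi_i)$ consists of Lipschitz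 functions $f_i$ on $Q$ and $d$-tuples $\pi_i$ of Lipschitz functions on $Q$ ($i\in\mathbb N$) with $s(\sum_i(f_i,\pi_i))=\sum_i\|f_i\|_L\prod_{j=1}^d\mathrm{Lip}(\pi_i^j)<\infty$. Two such sums are equivalent if $\sum_iT(f_i,\pi_i)=\sum_iT(g_i,\kappa_i)$ for all $T\in\mathcal D_d(Q)$. The space $\mathbb P^d$ of top-dimensional potential forms is the vector space of equivalence classes (addition is the union of families of terms, and scalars multiply the $f_i$) with the norm $\|\omega\|=\inf\{s(\sigma):\sigma\in\omega\}$. The operator $\mathrm{Em}\colon\mathbb P^d\to L^\infty(Q)$ is $\mathrm{Em}([\sum_i(f_i,\pi_i)])=\sum_i f_i\det\mathrm D\pi_i$, the series converging absolutely in $L^\infty(Q)$. Then the following hold. (1) $\mathrm{Em}$ is a well-defined bounded linear operator, and it is strongly non-surjective: identifying $L^\infty(Q)=L^1(Q)^*$, for every $n\ge1$ there are $\rho_n\in \mathrm{Em}(\mathbb P^d)$ with $\|\rho_n\|_\infty\le\frac1n$ and a weak$^*$ open neighbourhood $U_n$ of $\rho_n$ such that $\mathrm{Em}(\omega)\notin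 U_n$ for all $\omega\in\mathbb P^d$ with $\|\omega\|\le1$. (2) The prescribed Jacobian equation has strong Lipschitz non-regularity: there are $u_n\in L^1(Q)$ such that for every $n\ge1$, $\|u_n\|_{L^1(Q)}\ge1$ and $$\sup\Big\{\Big|\int_Q u_n f\det\mathrm D\pi\,\mathrm d\mathcal L^d\Big| : \|f\|_L\prod_{j=1}^d\mathrm{Lip}(\pi^j)\le1\Big\}\le\frac1n.$$ (3) There is a metric $d$-current $T$ on $\mathbb R^d$ supported in $Q$ for which there is no $u\in L^1(Q)$ with $T(\varphi,x^1,\dots,x^d)=\int_Q u\varphi\,\mathrm d\mathcal L^d$ for all $\varphi\in C_c^\infty(\mathbb R^d)$ (where $x^j$ are the coordinate functions), and which is not flat: the classical current $C_d(T)$, given by $C_d(T)(f\,\mathrm dg_1\wedge\dots\wedge\mathrm dg_d)=T(f,g_1,\dots,g_d)$ for $f\in C_c^\infty(\mathbb R^d)$ and $g_1,\dots,g_d$ smooth and Lipschitz, is, for no compact $K\subset\mathbb R^d$, in the closure of the set of normal $d$-currents (currents $N$ such that $N$ and $\partial N$ have finite mass) supported in $K$ with respect to the flat norm $\sup\{|S(\omega)|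 : \max(\sup_K\|\omega\|,\sup_K\|\mathrm d\omega\|)\le1\}$, where $\|\cdot\|$ is the comass norm. -/

import Mathlib

open MeasureTheory Set Filter Topology
open scoped NNReal ENNReal Distributions

noncomputable section

namespace MetricCurrents

/-! ### Lipschitz functions -/

section Lipschitz

/-- `Lip X`: the real-valued Lipschitz functions on `X`. -/
def Lip (X : Type*) [MetricSpace X] : Submodule ℝ (X → ℝ) where
  carrier := {f | ∃ K : ℝ≥0, LipschitzWith K f}
  add_mem' := by
    rintro f g ⟨K, hf⟩ ⟨L, hg⟩
    exact ⟨K + L, hf.add hg⟩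
  zero_mem' := ⟨0, LipschitzWith.const 0⟩
  smul_mem' := by
    rintro c f ⟨K, hf⟩
    exact ⟨‖c‖₊ * K, (lipschitzWith_smul c).comp hf⟩

/-- `Lip_c X`: the compactly supported real-valued Lipschitz functions on `X`. -/
def Lipc (X : Type*) [MetricSpace X] : Submodule ℝ (X → ℝ) where
  carrier := {f | f ∈ Lip X ∧ HasCompactSupport f}
  add_mem' := fun hf hg => ⟨add_mem hf.1 hg.1, hf.2.add hg.2⟩
  zero_mem' := ⟨zero_mem _, HasCompactSupport.zero⟩
  smul_mem' := fun c _ hf =>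
    ⟨Submodule.smul_mem _ c hf.1, hf.2.comp_left (g := fun y : ℝ => c • y) (smul_zero c)⟩

/-- On a compact space every Lipschitz function is bounded and compactly supported, so that
`Lip X = Lip_b X = Lip_c X`. -/
def Lip.toLipc {X : Type*} [MetricSpace X] [CompactSpace X] : Lip X →ₗ[ℝ] Lipc X where
  toFun f := ⟨f, f.2, HasCompactSupport.of_compactSpace _⟩
  map_add' _ _ := rfl
  map_smul' _ _ := rfl

/-- The least Lipschitz constant of a Lipschitz function. -/
def lipConst {X : Type*} [MetricSpace X] (f : Lip X) : ℝ :=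
  ((sInf {K : ℝ≥0 | LipschitzWith K (f : X → ℝ)} : ℝ≥0) : ℝ)

/-- `‖f‖_L = max {‖f‖_∞, Lip f}` (used on compact spaces only, where the supremum is finite). -/
def lipNorm {X : Type*} [MetricSpace X] (f : Lip X) : ℝ :=
  max (⨆ x, |(f : X → ℝ) x|) (lipConst f)

variable {X : Type*} [MetricSpace X]

theorem lipschitzWith_lipConst (f : Lip X) :
    LipschitzWith (sInf {K : ℝ≥0 | LipschitzWith K (f : X → ℝ)}) (f : X → ℝ) := by
  refine LipschitzWith.of_dist_le_mul fun x y => ?_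
  have hne : {K : ℝ≥0 | LipschitzWith K (f : X → ℝ)}.Nonempty := f.2
  rcases eq_or_lt_of_le (dist_nonneg (x := x) (y := y)) with h | h
  · have : x = y := dist_eq_zero.1 h.symm
    simp [this]
  · rw [← div_le_iff₀ h]
    have h0 : (0 : ℝ) ≤ dist ((f : X → ℝ) x) ((f : X → ℝ) y) / dist x y := by positivity
    obtain ⟨r, hr⟩ : ∃ r : ℝ≥0, (r : ℝ)
        = dist ((f : X → ℝ) x) ((f : X → ℝ) y) / dist x y := ⟨⟨_, h0⟩, rfl⟩
    rw [← hr, NNReal.coe_le_coe]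
    refine le_csInf hne fun K hK => ?_
    rw [← NNReal.coe_le_coe, hr]
    exact (div_le_iff₀ h).2 (hK.dist_le_mul x y)

theorem dist_le_lipConst (f : Lip X) (x y : X) :
    |(f : X → ℝ) x - (f : X → ℝ) y| ≤ lipConst f * dist x y :=
  (lipschitzWith_lipConst f).dist_le_mul x y

theorem lipConst_nonneg (f : Lip X) : 0 ≤ lipConst f := NNReal.coe_nonneg _

theorem lipConst_le {f : Lip X} {K : ℝ≥0} (h : LipschitzWith K (f : X → ℝ)) :
    lipConst f ≤ K := by
  have : sInf {K : ℝ≥0 | LipschitzWith K (f : X → ℝ)} ≤ K := csInf_le (OrderBot.bddBelow _) h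
  exact_mod_cast this

theorem lipConst_smul_le (c : ℝ) (f : Lip X) : lipConst (c • f) ≤ |c| * lipConst f := by
  have h := (lipschitzWith_smul c).comp (lipschitzWith_lipConst f)
  exact lipConst_le (f := c • f) h

theorem lipConst_smul (c : ℝ) (f : Lip X) : lipConst (c • f) = |c| * lipConst f := by
  refine le_antisymm (lipConst_smul_le c f) ?_
  rcases eq_or_ne c 0 with rfl | hc
  · simpa using lipConst_nonneg (X := X) _
  · have h := lipConst_smul_le c⁻¹ (c • f)
    rw [smul_smul, inv_mul_cancel₀ hc, one_smul, abs_inv] at h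
    rwa [← le_inv_mul_iff₀ (abs_pos.2 hc)]

theorem lipNorm_nonneg (f : Lip X) : 0 ≤ lipNorm f := (lipConst_nonneg f).trans (le_max_right _ _)

theorem lipNorm_smul (c : ℝ) (f : Lip X) : lipNorm (c • f) = |c| * lipNorm f := by
  have h : (⨆ x, |((c • f : Lip X) : X → ℝ) x|) = |c| * ⨆ x, |(f : X → ℝ) x| := by
    rw [Real.mul_iSup_of_nonneg (abs_nonneg c)]
    congr 1
    funext x
    exact abs_mul c _
  unfold lipNorm
  rw [h, lipConst_smul, mul_max_of_nonneg _ _ (abs_nonneg c)]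

theorem abs_le_lipNorm [CompactSpace X] (f : Lip X) (x : X) : |(f : X → ℝ) x| ≤ lipNorm f := by
  refine le_trans ?_ (le_max_left _ _)
  refine le_ciSup (f := fun x => |(f : X → ℝ) x|) ?_ x
  have hc : Continuous (f : X → ℝ) := (lipschitzWith_lipConst f).continuous
  exact (isCompact_range hc.abs).bddAbove

/-- The constant function `c`. -/
def Lip.const (c : ℝ) : Lip X := ⟨fun _ => c, 0, LipschitzWith.const c⟩

theorem lipConst_sub_const (f : Lip X) (c : ℝ) : lipConst (f - Lip.const c) ≤ lipConst f := by
  refine lipConst_le (K := sInf {K : ℝ≥0 | LipschitzWith K (f : X → ℝ)}) ?_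
  refine LipschitzWith.of_dist_le_mul fun x y => ?_
  have := (lipschitzWith_lipConst f).dist_le_mul x y
  simpa [Lip.const, Real.dist_eq] using this

end Lipschitz

/-! ### Metric currents -/

section Currents

/-- `D_k(X)`: the metric `k`-currents on the (locally compact) metric space `X`, that is, the
functionals `T(f, π¹, …, πᵏ)` on `Lip_c X × (Lip X)ᵏ` which are linear in each variable, local and
jointly continuous. -/
structure MetricCurrent (X : Type*) [MetricSpace X] (k : ℕ) where
  toMap : Lipc X →ₗ[ℝ] MultilinearMap ℝ (fun _ : Fin k => Lip X) ℝ
  locality : ∀ (f : Lipc X) (π : Fin k → Lip X) (j : Fin k),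
    (∃ c : ℝ, ∃ U ∈ 𝓝ˢ (tsupport (f : X → ℝ)), ∀ x ∈ U, (π j : X → ℝ) x = c) → toMap f π = 0
  continuity : ∀ (F : ℕ → Lipc X) (f : Lipc X) (P : ℕ → Fin k → Lip X) (π : Fin k → Lip X),
    (∀ x, Tendsto (fun i => (F i : X → ℝ) x) atTop (𝓝 ((f : X → ℝ) x))) →
    (∀ j x, Tendsto (fun i => (P i j : X → ℝ) x) atTop (𝓝 ((π j : X → ℝ) x))) →
    (∃ L : ℝ≥0, ∀ i, LipschitzWith L (F i : X → ℝ) ∧ ∀ j, LipschitzWith L (P i j : X → ℝ)) →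
    (∃ K : Set X, IsCompact K ∧ tsupport (f : X → ℝ) ⊆ K ∧ ∀ i, tsupport (F i : X → ℝ) ⊆ K) →
    Tendsto (fun i => toMap (F i) (P i)) atTop (𝓝 (toMap f π))

/-- The support of `T` is contained in the closed set `F`. -/
def MetricCurrent.SupportedIn {X : Type*} [MetricSpace X] {k : ℕ} (T : MetricCurrent X k)
    (F : Set X) : Prop :=
  ∀ (f : Lipc X) (π : Fin k → Lip X), (∀ x ∈ F, (f : X → ℝ) x = 0) → T.toMap f π = 0

variable {X : Type*} [MetricSpace X] {k : ℕ}

theorem MetricCurrent.sub_const (T : MetricCurrent X k) (f : Lipc X) (π : Fin k → Lip X)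
    (c : Fin k → ℝ) : T.toMap f (fun j => π j - Lip.const (c j)) = T.toMap f π := by
  classical
  have h := (T.toMap f).map_add_univ (fun j => π j - Lip.const (c j)) (fun j => Lip.const (c j))
  have h2 : (fun j => π j - Lip.const (c j)) + (fun j => Lip.const (c j)) = π := by
    funext j; simp
  rw [h2, Finset.sum_eq_single Finset.univ] at h
  · rw [Finset.piecewise_univ] at h
    exact h.symm
  · intro s _ hs
    obtain ⟨j, hj⟩ : ∃ j, j ∉ s := by
      by_contra hcon
      push Not at hcon
      exact hs (Finset.eq_univ_of_forall hcon)
    refine T.locality f _ j ⟨c j, univ, univ_mem, fun x _ => ?_⟩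
    rw [Finset.piecewise_eq_of_notMem _ _ _ hj]
    rfl
  · simp

theorem MetricCurrent.exists_bound_unit [CompactSpace X] [Nonempty X] (T : MetricCurrent X k) :
    ∃ C : ℝ, ∀ (f : Lip X) (π : Fin k → Lip X), lipNorm f ≤ 1 → (∀ j, lipConst (π j) ≤ 1) →
      |T.toMap (Lip.toLipc f) π| ≤ C := by
  by_contra hcon
  push Not at hcon
  choose F P hF hP hT using fun n : ℕ => hcon (((n : ℝ) + 1) ^ (k + 1))
  obtain ⟨x₀⟩ := ‹Nonempty X›
  set P' : ℕ → Fin k → Lip X := fun n j => P n j - Lip.const ((P n j : X → ℝ) x₀) with hP'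
  have hpos : ∀ n : ℕ, (0 : ℝ) < (n : ℝ) + 1 := fun n => by positivity
  have key := T.continuity (fun n => ((n : ℝ) + 1)⁻¹ • Lip.toLipc (F n)) 0
    (fun n j => ((n : ℝ) + 1)⁻¹ • P' n j) 0 ?_ ?_ ?_ ?_
  · rw [map_zero T.toMap, zero_apply] at key
    have h1 : ∀ n : ℕ, 1 ≤ |T.toMap (((n : ℝ) + 1)⁻¹ • Lip.toLipc (F n))
        (fun j => ((n : ℝ) + 1)⁻¹ • P' n j)| := by
      intro n
      have e : T.toMap (((n : ℝ) + 1)⁻¹ • Lip.toLipc (F n)) (fun j => ((n : ℝ) + 1)⁻¹ • P' n j)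
          = (((n : ℝ) + 1) ^ (k + 1))⁻¹ * T.toMap (Lip.toLipc (F n)) (P n) := by
        rw [map_smul, smul_apply, MultilinearMap.map_smul_univ,
          T.sub_const (Lip.toLipc (F n)) (P n) (fun j => (P n j : X → ℝ) x₀)]
        simp [pow_succ]
        ring
      have hp : (0 : ℝ) < ((n : ℝ) + 1) ^ (k + 1) := pow_pos (hpos n) _
      rw [e, abs_mul, abs_inv, abs_of_pos hp, ← div_eq_inv_mul, le_div_iff₀ hp, one_mul]
      exact (hT n).le
    have h2 := key.abs
    rw [abs_zero] at h2
    exact absurd (ge_of_tendsto' h2 h1) (by norm_num)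
  · intro x
    have : Tendsto (fun n : ℕ => 1 / ((n : ℝ) + 1)) atTop (𝓝 0) :=
      tendsto_one_div_add_atTop_nhds_zero_nat
    refine squeeze_zero_norm (fun n => ?_) this
    have hb := (abs_le_lipNorm (F n) x).trans (hF n)
    have : ‖((n : ℝ) + 1)⁻¹ * (F n : X → ℝ) x‖ ≤ 1 / ((n : ℝ) + 1) := by
      rw [norm_mul, norm_inv, Real.norm_eq_abs, Real.norm_eq_abs, abs_of_pos (hpos n),
        ← div_eq_inv_mul]
      exact div_le_div_of_nonneg_right hb (hpos n).le
    exact this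
  · intro j x
    have h0 : Tendsto (fun n : ℕ => 1 / ((n : ℝ) + 1) * dist x x₀) atTop (𝓝 (0 * dist x x₀)) :=
      tendsto_one_div_add_atTop_nhds_zero_nat.mul_const _
    rw [zero_mul] at h0
    refine squeeze_zero_norm (fun n => ?_) h0
    have hb : |(P n j : X → ℝ) x - (P n j : X → ℝ) x₀| ≤ dist x x₀ :=
      (dist_le_lipConst (P n j) x x₀).trans (by nlinarith [hP n j, dist_nonneg (x := x) (y := x₀)])
    have : ‖((n : ℝ) + 1)⁻¹ * ((P n j : X → ℝ) x - (P n j : X → ℝ) x₀)‖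
        ≤ 1 / ((n : ℝ) + 1) * dist x x₀ := by
      rw [norm_mul, norm_inv, Real.norm_eq_abs, Real.norm_eq_abs, abs_of_pos (hpos n), one_div]
      exact mul_le_mul_of_nonneg_left hb (inv_nonneg.2 (hpos n).le)
    exact this
  · refine ⟨1, fun n => ⟨?_, fun j => ?_⟩⟩
    · have h : lipConst (((n : ℝ) + 1)⁻¹ • F n) ≤ 1 := by
        rw [lipConst_smul, abs_inv, abs_of_pos (hpos n)]
        have h1 : lipConst (F n) ≤ 1 := (le_max_right _ _).trans (hF n)
        have h2 : ((n : ℝ) + 1)⁻¹ ≤ 1 := inv_le_one_of_one_le₀ (by simp)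
        exact mul_le_one₀ h2 (lipConst_nonneg _) h1
      exact (lipschitzWith_lipConst (((n : ℝ) + 1)⁻¹ • F n)).weaken (by exact_mod_cast h)
    · have h : lipConst (((n : ℝ) + 1)⁻¹ • P' n j) ≤ 1 := by
        rw [lipConst_smul, abs_inv, abs_of_pos (hpos n)]
        have h1 : lipConst (P' n j) ≤ 1 := (lipConst_sub_const _ _).trans (hP n j)
        have h2 : ((n : ℝ) + 1)⁻¹ ≤ 1 := inv_le_one_of_one_le₀ (by simp)
        exact mul_le_one₀ h2 (lipConst_nonneg _) h1
      exact (lipschitzWith_lipConst (((n : ℝ) + 1)⁻¹ • P' n j)).weaken (by exact_mod_cast h)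
  · exact ⟨univ, isCompact_univ, subset_univ _, fun _ => subset_univ _⟩

/-- On a compact space, `|T(f, π)| ≤ C ‖f‖_L ∏ⱼ Lip πʲ`. -/
theorem MetricCurrent.exists_bound [CompactSpace X] [Nonempty X] (T : MetricCurrent X k) :
    ∃ C : ℝ, ∀ (f : Lip X) (π : Fin k → Lip X),
      |T.toMap (Lip.toLipc f) π| ≤ C * (lipNorm f * ∏ j, lipConst (π j)) := by
  obtain ⟨C, hC⟩ := T.exists_bound_unit
  refine ⟨C, fun f π => ?_⟩
  by_cases hj : ∃ j, lipConst (π j) = 0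
  · obtain ⟨j, hj⟩ := hj
    obtain ⟨x₀⟩ := ‹Nonempty X›
    have h0 : T.toMap (Lip.toLipc f) π = 0 := by
      refine T.locality _ π j ⟨(π j : X → ℝ) x₀, univ, univ_mem, fun x _ => ?_⟩
      have := dist_le_lipConst (π j) x x₀
      rw [hj, zero_mul] at this
      exact sub_eq_zero.1 (abs_nonpos_iff.1 this)
    rw [h0, Finset.prod_eq_zero (Finset.mem_univ j) hj]
    simp
  push Not at hj
  by_cases hf : lipNorm f = 0
  · have h0 : f = 0 := by
      ext x
      have := abs_le_lipNorm f x
      rw [hf] at this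
      exact abs_nonpos_iff.1 this
    have h1 : T.toMap (Lip.toLipc f) π = 0 := by
      rw [h0, map_zero, map_zero, zero_apply]
    rw [h1, hf]
    simp
  have hfp : 0 < lipNorm f := lt_of_le_of_ne (lipNorm_nonneg f) (Ne.symm hf)
  have hjp : ∀ j, 0 < lipConst (π j) := fun j =>
    lt_of_le_of_ne (lipConst_nonneg _) (Ne.symm (hj j))
  have h := hC ((lipNorm f)⁻¹ • f) (fun j => (lipConst (π j))⁻¹ • π j)
    (by rw [lipNorm_smul, abs_inv, abs_of_pos hfp, inv_mul_cancel₀ hf])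
    (fun j => by rw [lipConst_smul, abs_inv, abs_of_pos (hjp j), inv_mul_cancel₀ (hj j)])
  rw [map_smul, map_smul, smul_apply, MultilinearMap.map_smul_univ, smul_eq_mul,
    smul_eq_mul, abs_mul, abs_mul, abs_inv, abs_of_pos hfp, Finset.prod_inv_distrib, abs_inv,
    abs_of_pos (Finset.prod_pos fun j _ => hjp j)] at h
  have hp : 0 < ∏ j, lipConst (π j) := Finset.prod_pos fun j _ => hjp j
  rw [← div_le_iff₀ (mul_pos hfp hp)]
  refine le_trans (le_of_eq ?_) h
  field_simp

end Currents

/-! ### The unit cube, potential forms -/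

section PotentialForms

/-- `Q = [0,1]^d`. -/
def cube (d : ℕ) : Set (EuclideanSpace ℝ (Fin d)) := {x | ∀ i, x i ∈ Icc (0 : ℝ) 1}

theorem isClosed_cube (d : ℕ) : IsClosed (cube d) := by
  have : cube d = ⋂ i, {x : EuclideanSpace ℝ (Fin d) | x i ∈ Icc (0 : ℝ) 1} := by
    ext x; simp [cube]
  rw [this]
  exact isClosed_iInter fun i => isClosed_Icc.preimage (by fun_prop)

theorem isCompact_cube (d : ℕ) : IsCompact (cube d) := by
  refine Metric.isCompact_of_isClosed_isBounded (isClosed_cube d) ?_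
  refine (Metric.isBounded_closedBall (x := (0 : EuclideanSpace ℝ (Fin d)))
    (r := Real.sqrt d)).subset fun x hx => ?_
  rw [mem_closedBall_zero_iff, EuclideanSpace.norm_eq]
  refine Real.sqrt_le_sqrt ?_
  calc ∑ i, ‖x i‖ ^ 2 ≤ ∑ _i : Fin d, (1 : ℝ) := Finset.sum_le_sum fun i _ => by
        have h := hx i
        rw [Real.norm_eq_abs, abs_of_nonneg h.1]
        exact pow_le_one₀ h.1 h.2
    _ = d := by simp

instance (d : ℕ) : CompactSpace (cube d) := isCompact_iff_compactSpace.1 (isCompact_cube d)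

instance (d : ℕ) : Nonempty (cube d) := ⟨⟨0, fun i => by simp⟩⟩

variable {d : ℕ}

/-- A formal Lipschitz sum `∑ᵢ (fᵢ, πᵢ)` on `Q = [0,1]^d`: sequences of Lipschitz functions `fᵢ`
and of `d`-tuples `πᵢ` of Lipschitz functions with `∑ᵢ ‖fᵢ‖_L ∏ⱼ Lip πᵢʲ < ∞`. -/
structure FormalSum (d : ℕ) where
  f : ℕ → Lip (cube d)
  π : ℕ → Fin d → Lip (cube d)
  summable : Summable fun i => lipNorm (f i) * ∏ j, lipConst (π i j)

namespace FormalSum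

/-- `s(∑ᵢ (fᵢ, πᵢ)) = ∑ᵢ ‖fᵢ‖_L ∏ⱼ Lip πᵢʲ`. -/
def size (σ : FormalSum d) : ℝ := ∑' i, lipNorm (σ.f i) * ∏ j, lipConst (σ.π i j)

/-- `∑ᵢ T(fᵢ, πᵢ)`; the series converges absolutely by `FormalSum.summable_eval`. -/
def eval (T : MetricCurrent (cube d) d) (σ : FormalSum d) : ℝ :=
  ∑' i, T.toMap (Lip.toLipc (σ.f i)) (σ.π i)

theorem term_nonneg (f : Lip (cube d)) (π : Fin d → Lip (cube d)) :
    0 ≤ lipNorm f * ∏ j, lipConst (π j) :=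
  mul_nonneg (lipNorm_nonneg _) (Finset.prod_nonneg fun _ _ => lipConst_nonneg _)

theorem size_nonneg (σ : FormalSum d) : 0 ≤ σ.size := tsum_nonneg fun _ => term_nonneg _ _

theorem summable_abs_eval (T : MetricCurrent (cube d) d) (σ : FormalSum d) :
    Summable fun i => |T.toMap (Lip.toLipc (σ.f i)) (σ.π i)| := by
  obtain ⟨C, hC⟩ := T.exists_bound
  exact Summable.of_nonneg_of_le (fun _ => abs_nonneg _) (fun i => hC (σ.f i) (σ.π i))
    (σ.summable.mul_left C)

theorem summable_eval (T : MetricCurrent (cube d) d) (σ : FormalSum d) :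
    Summable fun i => T.toMap (Lip.toLipc (σ.f i)) (σ.π i) := (summable_abs_eval T σ).of_abs

theorem exists_abs_eval_le (T : MetricCurrent (cube d) d) :
    ∃ C : ℝ, ∀ σ : FormalSum d, |σ.eval T| ≤ C * σ.size := by
  obtain ⟨C, hC⟩ := T.exists_bound
  refine ⟨C, fun σ => ?_⟩
  have h1 := norm_tsum_le_tsum_norm (f := fun i => T.toMap (Lip.toLipc (σ.f i)) (σ.π i))
    (summable_abs_eval T σ)
  have h2 := (summable_abs_eval T σ).tsum_le_tsum (fun i => hC (σ.f i) (σ.π i))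
    (σ.summable.mul_left C)
  rw [tsum_mul_left] at h2
  exact h1.trans h2

/-- Two formal Lipschitz sums are equivalent if no metric `d`-current on `Q` separates them. -/
instance setoid (d : ℕ) : Setoid (FormalSum d) where
  r σ τ := ∀ T : MetricCurrent (cube d) d, σ.eval T = τ.eval T
  iseqv := ⟨fun _ _ => rfl, fun h T => (h T).symm, fun h h' T => (h T).trans (h' T)⟩

instance : Zero (FormalSum d) := ⟨⟨fun _ => 0, fun _ _ => 0, by
  have h : lipNorm (0 : Lip (cube d)) = 0 := by simpa using lipNorm_smul 0 (0 : Lip (cube d))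
  simp [h]⟩⟩

theorem summable_sumElim (σ τ : FormalSum d) :
    Summable fun a : ℕ ⊕ ℕ => lipNorm (Sum.elim σ.f τ.f a)
      * ∏ j, lipConst (Sum.elim σ.π τ.π a j) :=
  (HasSum.sum (f := fun a : ℕ ⊕ ℕ => lipNorm (Sum.elim σ.f τ.f a)
      * ∏ j, lipConst (Sum.elim σ.π τ.π a j)) σ.summable.hasSum τ.summable.hasSum).summable

/-- The family consisting of the terms of both sums. -/
instance : Add (FormalSum d) := ⟨fun σ τ =>
  ⟨fun i => Sum.elim σ.f τ.f (Equiv.natSumNatEquivNat.symm i),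
   fun i => Sum.elim σ.π τ.π (Equiv.natSumNatEquivNat.symm i),
   (Equiv.natSumNatEquivNat.symm.summable_iff
    (f := fun a : ℕ ⊕ ℕ => lipNorm (Sum.elim σ.f τ.f a)
      * ∏ j, lipConst (Sum.elim σ.π τ.π a j))).2 (summable_sumElim σ τ)⟩⟩

instance : SMul ℝ (FormalSum d) := ⟨fun c σ => ⟨fun i => c • σ.f i, σ.π, by
  simpa only [lipNorm_smul, mul_assoc] using σ.summable.mul_left |c|⟩⟩

theorem size_zero : (0 : FormalSum d).size = 0 := by
  have h : lipNorm (0 : Lip (cube d)) = 0 := by simpa using lipNorm_smul 0 (0 : Lip (cube d))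
  change (∑' _ : ℕ, lipNorm (0 : Lip (cube d)) * ∏ _j : Fin d, lipConst (0 : Lip (cube d))) = 0
  simp [h]

theorem size_add (σ τ : FormalSum d) : (σ + τ).size = σ.size + τ.size :=
  (Equiv.natSumNatEquivNat.symm.tsum_eq
    (fun a : ℕ ⊕ ℕ => lipNorm (Sum.elim σ.f τ.f a) * ∏ j, lipConst (Sum.elim σ.π τ.π a j))).trans
    (HasSum.sum (f := fun a : ℕ ⊕ ℕ => lipNorm (Sum.elim σ.f τ.f a)
      * ∏ j, lipConst (Sum.elim σ.π τ.π a j)) σ.summable.hasSum τ.summable.hasSum).tsum_eq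

theorem size_smul (c : ℝ) (σ : FormalSum d) : (c • σ).size = |c| * σ.size := by
  change (∑' i, lipNorm (c • σ.f i) * ∏ j, lipConst (σ.π i j)) = _
  simp only [lipNorm_smul, mul_assoc, tsum_mul_left, size]

theorem eval_zero (T : MetricCurrent (cube d) d) : (0 : FormalSum d).eval T = 0 := by
  change (∑' _ : ℕ, T.toMap (Lip.toLipc 0) (fun _ => 0)) = 0
  rw [map_zero, map_zero T.toMap]
  simp

theorem eval_add (T : MetricCurrent (cube d) d) (σ τ : FormalSum d) :
    (σ + τ).eval T = σ.eval T + τ.eval T :=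
  (Equiv.natSumNatEquivNat.symm.tsum_eq
    (fun a : ℕ ⊕ ℕ => T.toMap (Lip.toLipc (Sum.elim σ.f τ.f a)) (Sum.elim σ.π τ.π a))).trans
    (HasSum.sum (f := fun a : ℕ ⊕ ℕ => T.toMap (Lip.toLipc (Sum.elim σ.f τ.f a))
      (Sum.elim σ.π τ.π a)) (summable_eval T σ).hasSum (summable_eval T τ).hasSum).tsum_eq

theorem eval_smul (T : MetricCurrent (cube d) d) (c : ℝ) (σ : FormalSum d) :
    (c • σ).eval T = c * σ.eval T := by
  change (∑' i, T.toMap (Lip.toLipc (c • σ.f i)) (σ.π i)) = _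
  simp only [map_smul, smul_apply, smul_eq_mul, tsum_mul_left, eval]

end FormalSum

/-- The space `ℙᵈ(Q)` of top-dimensional potential forms on `Q = [0,1]^d`. -/
def PotentialForm (d : ℕ) : Type := Quotient (FormalSum.setoid d)

namespace PotentialForm

/-- The class of a formal Lipschitz sum. -/
def mk (σ : FormalSum d) : PotentialForm d := Quotient.mk _ σ

/-- The pairing `⟨ω, T⟩` of a potential form and a metric current. -/
def pairing (ω : PotentialForm d) (T : MetricCurrent (cube d) d) : ℝ :=
  Quotient.liftOn ω (FormalSum.eval T) fun _ _ h => h T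

theorem pairing_injective : Function.Injective (pairing (d := d)) := by
  rintro ⟨σ⟩ ⟨τ⟩ h
  exact Quotient.sound fun T => congrFun h T

instance : Zero (PotentialForm d) := ⟨mk 0⟩

instance : Add (PotentialForm d) := ⟨Quotient.map₂ (· + ·) fun _ _ h _ _ h' T => by
  rw [FormalSum.eval_add, FormalSum.eval_add, h T, h' T]⟩

instance : SMul ℝ (PotentialForm d) := ⟨fun c => Quotient.map (c • ·) fun _ _ h T => by
  rw [FormalSum.eval_smul, FormalSum.eval_smul, h T]⟩

theorem mk_add (σ τ : FormalSum d) : mk (σ + τ) = mk σ + mk τ := rfl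

theorem mk_smul (c : ℝ) (σ : FormalSum d) : mk (c • σ) = c • mk σ := rfl

theorem pairing_zero : pairing (0 : PotentialForm d) = 0 := funext fun T => FormalSum.eval_zero T

theorem pairing_add (ω η : PotentialForm d) : pairing (ω + η) = pairing ω + pairing η := by
  induction ω using Quotient.inductionOn with | _ σ
  induction η using Quotient.inductionOn with | _ τ
  exact funext fun T => FormalSum.eval_add T σ τ

theorem pairing_smul (c : ℝ) (ω : PotentialForm d) : pairing (c • ω) = c • pairing ω := by
  induction ω using Quotient.inductionOn with | _ σ
  exact funext fun T => FormalSum.eval_smul T c σ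

instance : Neg (PotentialForm d) := ⟨fun ω => (-1 : ℝ) • ω⟩
instance : Sub (PotentialForm d) := ⟨fun ω η => ω + (-1 : ℝ) • η⟩
instance : SMul ℕ (PotentialForm d) := ⟨fun n ω => (n : ℝ) • ω⟩
instance : SMul ℤ (PotentialForm d) := ⟨fun n ω => (n : ℝ) • ω⟩

instance : AddCommGroup (PotentialForm d) :=
  pairing_injective.addCommGroup pairing pairing_zero pairing_add
    (fun ω => (pairing_smul (-1) ω).trans (by simp))
    (fun ω η => by
      change pairing (ω + (-1 : ℝ) • η) = _
      rw [pairing_add, pairing_smul]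
      simp [sub_eq_add_neg])
    (fun ω n => (pairing_smul (n : ℝ) ω).trans (Nat.cast_smul_eq_nsmul ℝ n _))
    (fun ω n => (pairing_smul (n : ℝ) ω).trans (Int.cast_smul_eq_zsmul ℝ n _))

/-- `ω ↦ ⟨ω, ·⟩` as an additive map. -/
def pairingHom (d : ℕ) : PotentialForm d →+ (MetricCurrent (cube d) d → ℝ) where
  toFun := pairing
  map_zero' := pairing_zero
  map_add' := pairing_add

instance : Module ℝ (PotentialForm d) :=
  Function.Injective.module ℝ (pairingHom d) pairing_injective pairing_smul

/-- The potential norm `‖ω‖ = inf {s(σ) : σ ∈ ω}`. -/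
instance : Norm (PotentialForm d) := ⟨fun ω => sInf (FormalSum.size '' {σ | mk σ = ω})⟩

theorem norm_def (ω : PotentialForm d) : ‖ω‖ = sInf (FormalSum.size '' {σ | mk σ = ω}) := rfl

theorem norm_mk_le (σ : FormalSum d) : ‖mk σ‖ ≤ σ.size :=
  csInf_le ⟨0, by rintro _ ⟨τ, _, rfl⟩; exact τ.size_nonneg⟩ ⟨σ, rfl, rfl⟩

theorem le_norm (ω : PotentialForm d) {a : ℝ} (h : ∀ σ, mk σ = ω → a ≤ FormalSum.size σ) :
    a ≤ ‖ω‖ := by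
  refine le_csInf ?_ ?_
  · obtain ⟨σ, rfl⟩ := Quotient.exists_rep ω
    exact ⟨_, σ, rfl, rfl⟩
  · rintro _ ⟨σ, hσ, rfl⟩
    exact h σ hσ

theorem pot_norm_nonneg (ω : PotentialForm d) : 0 ≤ ‖ω‖ := le_norm ω fun σ _ => σ.size_nonneg

theorem pot_norm_smul_le (c : ℝ) (ω : PotentialForm d) : ‖c • ω‖ ≤ |c| * ‖ω‖ := by
  rcases eq_or_ne c 0 with rfl | hc
  · have h0 : (0 : ℝ) • ω = mk 0 := zero_smul ℝ ω
    rw [h0, abs_zero, zero_mul]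
    exact (norm_mk_le 0).trans FormalSum.size_zero.le
  · rw [← div_le_iff₀' (abs_pos.2 hc)]
    refine le_norm ω fun σ hσ => ?_
    rw [div_le_iff₀' (abs_pos.2 hc), ← FormalSum.size_smul, ← hσ, ← mk_smul]
    exact norm_mk_le _

theorem core (d : ℕ) : NormedSpace.Core ℝ (PotentialForm d) where
  norm_nonneg := pot_norm_nonneg
  norm_smul c ω := by
    refine le_antisymm (pot_norm_smul_le c ω) ?_
    rcases eq_or_ne c 0 with rfl | hc
    · simpa using pot_norm_nonneg _
    · have h := pot_norm_smul_le c⁻¹ (c • ω)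
      rw [smul_smul, inv_mul_cancel₀ hc, one_smul, abs_inv] at h
      rwa [Real.norm_eq_abs, ← le_inv_mul_iff₀ (abs_pos.2 hc)]
  norm_triangle ω η := by
    rw [← sub_le_iff_le_add]
    refine le_norm ω fun σ hσ => ?_
    rw [sub_le_iff_le_add, ← sub_le_iff_le_add']
    refine le_norm η fun τ hτ => ?_
    rw [sub_le_iff_le_add', ← FormalSum.size_add, ← hσ, ← hτ, ← mk_add]
    exact norm_mk_le _
  norm_eq_zero_iff ω := by
    constructor
    · intro h
      refine pairing_injective (funext fun T => ?_)
      rw [pairing_zero, Pi.zero_apply]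
      obtain ⟨C, hC⟩ := FormalSum.exists_abs_eval_le T
      have h1 : ∀ ε > 0, |pairing ω T| ≤ |C| * ε := by
        intro ε hε
        by_contra hcon
        push Not at hcon
        have : ε ≤ ‖ω‖ := le_norm ω fun σ hσ => by
          by_contra hlt
          push Not at hlt
          subst hσ
          have h3 : |σ.eval T| ≤ |C| * ε := (hC σ).trans
            ((mul_le_mul_of_nonneg_right (le_abs_self C) σ.size_nonneg).trans
              (mul_le_mul_of_nonneg_left hlt.le (abs_nonneg C)))
          exact absurd h3 (not_le.2 hcon)
        linarith
      have h2 : Tendsto (fun ε : ℝ => |C| * ε) (𝓝[>] 0) (𝓝 (|C| * 0)) :=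
        (tendsto_id.const_mul |C|).mono_left nhdsWithin_le_nhds
      have h3 := ge_of_tendsto h2 (eventually_nhdsWithin_of_forall h1)
      rw [mul_zero] at h3
      exact abs_nonpos_iff.1 h3
    · rintro rfl
      exact le_antisymm ((norm_mk_le 0).trans FormalSum.size_zero.le) (pot_norm_nonneg _)

instance : NormedAddCommGroup (PotentialForm d) := NormedAddCommGroup.ofCore (core d)

instance : NormedSpace ℝ (PotentialForm d) := NormedSpace.ofCore (core d)

end PotentialForm

end PotentialForms

/-! ### Jacobians and the prescribed Jacobian equation -/

section Jacobian

/-- Lebesgue measure on `Q = [0,1]^d`. -/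
abbrev cubeMeasure (d : ℕ) : Measure (EuclideanSpace ℝ (Fin d)) := volume.restrict (cube d)

instance (d : ℕ) : IsFiniteMeasure (cubeMeasure d) :=
  isFiniteMeasure_restrict.2 (isCompact_cube d).measure_lt_top.ne

variable {d : ℕ}

/-- A function on `Q`, extended by zero to `ℝ^d`. -/
def zeroExt (f : cube d → ℝ) : EuclideanSpace ℝ (Fin d) → ℝ := Function.extend Subtype.val f 0

/-- `det Dπ` on `Q`, where `Dπ` is the matrix of the partial derivatives `∂πʲ/∂eᵢ`
(only the values on `Q` matter). -/
def jac (π : Fin d → Lip (cube d)) (x : EuclideanSpace ℝ (Fin d)) : ℝ :=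
  Matrix.det (Matrix.of fun i j : Fin d =>
    fderivWithin ℝ (zeroExt (π j : cube d → ℝ)) (cube d) x (EuclideanSpace.single i 1))

theorem zeroExt_apply (f : cube d → ℝ) (x : cube d) : zeroExt f x = f x :=
  Subtype.val_injective.extend_apply _ _ _

theorem exists_extension (f : Lip (cube d)) :
    ∃ (F : EuclideanSpace ℝ (Fin d) → ℝ) (K : ℝ≥0), LipschitzWith K F ∧
      ∀ x ∈ cube d, zeroExt (f : cube d → ℝ) x = F x := by
  obtain ⟨K, hK⟩ := f.2
  have hl : LipschitzOnWith K (zeroExt (f : cube d → ℝ)) (cube d) := by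
    intro x hx y hy
    have := hK ⟨x, hx⟩ ⟨y, hy⟩
    rwa [← zeroExt_apply (f : cube d → ℝ) ⟨x, hx⟩, ← zeroExt_apply (f : cube d → ℝ) ⟨y, hy⟩] at this
  obtain ⟨F, hF, hE⟩ := hl.extend_real
  exact ⟨F, K, hF, fun x hx => hE hx⟩

theorem convex_cube (d : ℕ) : Convex ℝ (cube d) := by
  intro x hx y hy a b ha hb hab i
  exact convex_Icc (0 : ℝ) 1 (hx i) (hy i) ha hb hab

theorem ae_mem_interior_cube (d : ℕ) : ∀ᵐ x ∂cubeMeasure d, x ∈ interior (cube d) := by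
  have h1 : ∀ᵐ x ∂cubeMeasure d, x ∈ cube d := ae_restrict_mem (isClosed_cube d).measurableSet
  have h2 : ∀ᵐ x ∂cubeMeasure d, x ∉ frontier (cube d) :=
    ae_restrict_of_ae (measure_eq_zero_iff_ae_notMem.1 ((convex_cube d).addHaar_frontier volume))
  filter_upwards [h1, h2] with x hx hx'
  rw [← self_sdiff_frontier]
  exact ⟨hx, hx'⟩

/-- `f det Dπ` lies in `L^∞(Q)`. -/
theorem memLp_jac (f : Lip (cube d)) (π : Fin d → Lip (cube d)) :
    MemLp (fun x => zeroExt (f : cube d → ℝ) x * jac π x) ∞ (cubeMeasure d) := by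
  obtain ⟨F, K, hF, hFe⟩ := exists_extension f
  choose P L hP hPe using fun j => exists_extension (π j)
  have hae : (fun x => zeroExt (f : cube d → ℝ) x * jac π x) =ᵐ[cubeMeasure d]
      fun x => F x * Matrix.det (Matrix.of fun i j : Fin d =>
        fderiv ℝ (P j) x (EuclideanSpace.single i 1)) := by
    filter_upwards [ae_mem_interior_cube d] with x hx
    have hxQ := interior_subset hx
    rw [hFe x hxQ]
    refine congrArg (fun A : Matrix (Fin d) (Fin d) ℝ => F x * A.det) (Matrix.ext fun i j => ?_)
    simp only [Matrix.of_apply]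
    rw [fderivWithin_congr (fun y hy => hPe j y hy) (hPe j x hxQ),
      fderivWithin_of_mem_nhds (mem_interior_iff_mem_nhds.1 hx)]
  refine (memLp_congr_ae hae).2 ?_
  obtain ⟨M, hM⟩ : ∃ M, ∀ x ∈ cube d, ‖F x‖ ≤ M :=
    (isCompact_cube d).exists_bound_of_continuousOn hF.continuous.continuousOn
  have hB : ∀ x, |Matrix.det (Matrix.of fun i j : Fin d =>
      fderiv ℝ (P j) x (EuclideanSpace.single i 1))|
      ≤ Nat.factorial (Fintype.card (Fin d)) • ((∑ j, L j : ℝ≥0) : ℝ) ^ Fintype.card (Fin d) := by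
    intro x
    refine Matrix.det_le (abv := AbsoluteValue.abs) fun i j => ?_
    have h1 : ‖fderiv ℝ (P j) x (EuclideanSpace.single i 1)‖
        ≤ ‖fderiv ℝ (P j) x‖ * ‖EuclideanSpace.single i (1 : ℝ)‖ := ContinuousLinearMap.le_opNorm _ _
    have h2 : ‖fderiv ℝ (P j) x‖ ≤ L j := norm_fderiv_le_of_lipschitz ℝ (hP j)
    have h3 : (L j : ℝ) ≤ ((∑ j, L j : ℝ≥0) : ℝ) := by
      exact_mod_cast Finset.single_le_sum (f := L) (fun _ _ => zero_le) (Finset.mem_univ j)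
    rw [PiLp.norm_single, norm_one, mul_one] at h1
    exact h1.trans (h2.trans h3)
  refine memLp_top_of_bound ?_ (M * (Nat.factorial (Fintype.card (Fin d)) •
    ((∑ j, L j : ℝ≥0) : ℝ) ^ Fintype.card (Fin d))) ?_
  · refine (hF.continuous.measurable.mul ?_).aestronglyMeasurable
    simp only [Matrix.det_apply, Matrix.of_apply]
    refine Finset.measurable_sum _ fun s _ => Measurable.const_smul ?_ _
    exact Finset.measurable_prod _ fun i _ => measurable_fderiv_apply_const ℝ _ _
  · filter_upwards [ae_restrict_mem (isClosed_cube d).measurableSet] with x hx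
    rw [norm_mul]
    exact mul_le_mul (hM x hx) (hB x) (norm_nonneg _) ((norm_nonneg _).trans (hM x hx))

/-- `f det Dπ` as an element of `L^∞(Q)`. -/
def jacTerm (f : Lip (cube d)) (π : Fin d → Lip (cube d)) : Lp ℝ ∞ (cubeMeasure d) :=
  (memLp_jac f π).toLp _

/-- `Em` is the canonical embedding of potential forms into `L^∞(Q)`:
`Em [∑ᵢ (fᵢ, πᵢ)] = ∑ᵢ fᵢ det Dπᵢ` for every formal Lipschitz sum, with absolute convergence in
`L^∞(Q)`. This determines `Em`, as every potential form is the class of a formal Lipschitz sum. -/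
def IsCanonicalEmbedding (Em : PotentialForm d →L[ℝ] Lp ℝ ∞ (cubeMeasure d)) : Prop :=
  ∀ σ : FormalSum d, (Summable fun i => ‖jacTerm (σ.f i) (σ.π i)‖) ∧
    Em (PotentialForm.mk σ) = ∑' i, jacTerm (σ.f i) (σ.π i)

/-- The canonical identification `L^∞(Q) = L^1(Q)^*`, `ρ ↦ (u ↦ ∫_Q ρ u)`. -/
def linftyToDual (d : ℕ) :
    Lp ℝ ∞ (cubeMeasure d) →L[ℝ] StrongDual ℝ (Lp ℝ 1 (cubeMeasure d)) :=
  (ContinuousLinearMap.mul ℝ ℝ).lpPairing (cubeMeasure d) ∞ 1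

/-- A bounded operator `T : X → Y^*` is strongly non-surjective if for every `n ≥ 1` there are
`ρ ∈ (1/n) B_{Y^*} ∩ T(X)` and a weak-`*` open neighbourhood `U` of `ρ` disjoint from `T(B_X)`. -/
def StronglyNonSurjective {X Y : Type*} [NormedAddCommGroup X] [NormedSpace ℝ X]
    [NormedAddCommGroup Y] [NormedSpace ℝ Y] (T : X →L[ℝ] StrongDual ℝ Y) : Prop :=
  ∀ n : ℕ, 1 ≤ n → ∃ ρ : StrongDual ℝ Y, ‖ρ‖ ≤ 1 / (n : ℝ) ∧ ρ ∈ Set.range T ∧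
    ∃ U : Set (WeakDual ℝ Y), IsOpen U ∧ StrongDual.toWeakDual ρ ∈ U ∧
      ∀ x : X, ‖x‖ ≤ 1 → StrongDual.toWeakDual (T x) ∉ U

/-- Strong Lipschitz non-regularity of the prescribed Jacobian equation on `[0,1]^d`. -/
def StrongLipschitzNonRegularity (d : ℕ) : Prop :=
  ∃ u : ℕ → Lp ℝ 1 (cubeMeasure d), ∀ n : ℕ, 1 ≤ n → 1 ≤ ‖u n‖ ∧
    ∀ (f : Lip (cube d)) (π : Fin d → Lip (cube d)),
      lipNorm f * ∏ j, lipConst (π j) ≤ 1 →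
        |∫ x in cube d, u n x * (zeroExt (f : cube d → ℝ) x * jac π x)| ≤ 1 / (n : ℝ)

end Jacobian

/-! ### Classical currents and flat chains -/

section ClassicalCurrents

/-- `ℝ^d` with the Euclidean norm. -/
abbrev Rd (d : ℕ) := EuclideanSpace ℝ (Fin d)

/-- Alternating `k`-covectors of `ℝ^d`; the norm is the comass norm. -/
abbrev Covector (d k : ℕ) := Rd d [⋀^Fin k]→L[ℝ] ℝ

/-- Smooth compactly supported differential `k`-forms on `ℝ^d`. -/
abbrev TestForm (d k : ℕ) := 𝓓((⊤ : TopologicalSpace.Opens (Rd d)), Covector d k)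

/-- Classical `k`-currents in `ℝ^d`: the linear functionals on test forms that are continuous in
the sense of distributions. -/
abbrev ClassicalCurrent (d k : ℕ) := TestForm d k →L[ℝ] ℝ

/-- The exterior derivative on test forms. -/
def TestForm.extD (d k : ℕ) : TestForm d k →L[ℝ] TestForm d (k + 1) :=
  (TestFunction.postcompCLM
    (ContinuousAlternatingMap.alternatizeUncurryFinCLM ℝ (Rd d) ℝ (n := k))).comp
    (TestFunction.fderivCLM ℝ ⊤ ⊤)

theorem TestForm.extD_apply {d k : ℕ} (ω : TestForm d k) (x : Rd d) :
    TestForm.extD d k ω x = extDeriv (ω : Rd d → Covector d k) x := by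
  have h : TestFunction.fderivCLM ℝ ⊤ ⊤ ω x = fderiv ℝ (ω : Rd d → Covector d k) x := by
    rw [TestFunction.fderivCLM_apply_of_le ω (by simp)]
  exact congrArg ContinuousAlternatingMap.alternatizeUncurryFin h

namespace ClassicalCurrent

variable {d k : ℕ}

/-- The boundary, `∂T(ω) = T(dω)`. -/
def boundary (T : ClassicalCurrent d (k + 1)) : ClassicalCurrent d k := T.comp (TestForm.extD d k)

/-- `T` is given by integration against a finite `k`-vector-valued measure `τ μ`
(`k`-vectors are the dual space of the `k`-covectors). -/
def FiniteMass (T : ClassicalCurrent d k) : Prop :=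
  ∃ (μ : Measure (Rd d)) (τ : Rd d → StrongDual ℝ (Covector d k)), IsFiniteMeasure μ ∧
    (∀ η : Covector d k, Integrable (fun x => τ x η) μ) ∧ ∀ ω : TestForm d k, T ω = ∫ x, τ x (ω x) ∂μ

/-- `T` and `∂T` (if `k ≥ 1`) have finite mass. -/
def Normal : {k : ℕ} → ClassicalCurrent d k → Prop
  | 0, T => T.FiniteMass
  | _ + 1, T => T.FiniteMass ∧ T.boundary.FiniteMass

/-- The flat seminorm of a form, `max {sup_K ‖ω‖, sup_K ‖dω‖}`. -/
def formFlatNorm (K : Set (Rd d)) (ω : TestForm d k) : ℝ≥0∞ :=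
  max (⨆ x ∈ K, ‖ω x‖ₑ) (⨆ x ∈ K, ‖extDeriv (ω : Rd d → Covector d k) x‖ₑ)

/-- The flat norm of a current, `sup {|T(ω)| : ‖ω‖ ≤ 1}`. -/
def flatNorm (K : Set (Rd d)) (T : ClassicalCurrent d k) : ℝ≥0∞ :=
  ⨆ (ω : TestForm d k) (_ : formFlatNorm K ω ≤ 1), ‖T ω‖ₑ

/-- The flat `k`-chains in `K`: the closure, in the flat norm, of the normal currents supported
in `K`. -/
def flatChains (k : ℕ) (K : Set (Rd d)) : Set (ClassicalCurrent d k) :=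
  {T | ∀ ε : ℝ≥0∞, 0 < ε → ∃ N : ClassicalCurrent d k, N.Normal ∧
    Distribution.IsVanishingOn N Kᶜ ∧ flatNorm K (T - N) < ε}

end ClassicalCurrent

/-- `S = C_k(T)` for the comparison map `C_k` from metric to classical currents:
`S(f dg₁ ∧ … ∧ dg_k) = T(f, g₁, …, g_k)` for `f` smooth with compact support and `gᵢ` smooth and
Lipschitz. -/
def IsComparison {d k : ℕ} (T : MetricCurrent (Rd d) k) (S : ClassicalCurrent d k) : Prop :=
  ∀ (f : Lipc (Rd d)) (g : Fin k → Lip (Rd d)),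
    ContDiff ℝ ((⊤ : ℕ∞) : WithTop ℕ∞) (f : Rd d → ℝ) →
    (∀ j, ContDiff ℝ ((⊤ : ℕ∞) : WithTop ℕ∞) (g j : Rd d → ℝ)) →
    ∀ ω : TestForm d k,
      (∀ (x : Rd d) (v : Fin k → Rd d), ω x v = (f : Rd d → ℝ) x *
        Matrix.det (Matrix.of fun i j : Fin k => fderiv ℝ (g i : Rd d → ℝ) x (v j))) →
      S ω = T.toMap f g

/-- A metric current in `ℝ^d` is flat if the corresponding classical current is a flat chain in
some compact set. -/
def MetricCurrent.IsFlat {d k : ℕ} (T : MetricCurrent (Rd d) k) : Prop :=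
  ∃ S : ClassicalCurrent d k, IsComparison T S ∧
    ∃ K : Set (Rd d), IsCompact K ∧ S ∈ ClassicalCurrent.flatChains k K

/-- The coordinate functions `x¹, …, xᵈ` on `ℝ^d`. -/
def coord (d : ℕ) (j : Fin d) : Lip (Rd d) :=
  ⟨fun x => x j, 1, LipschitzWith.of_dist_le_mul fun x y => by
    rw [NNReal.coe_one, one_mul, dist_eq_norm, dist_eq_norm]
    exact PiLp.norm_apply_le (x - y) j⟩

/-- The metric `d`-current `T` is given by some `u ∈ L^1(Q)`, `Q = [0,1]^d`:
`T(φ, x¹, …, xᵈ) = ∫_Q u φ` for all smooth compactly supported `φ` (such `φ` are Lipschitz). -/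
def MetricCurrent.IsGivenByL1 {d : ℕ} (T : MetricCurrent (Rd d) d) : Prop :=
  ∃ u : Lp ℝ 1 (cubeMeasure d), ∀ φ : Lipc (Rd d),
    ContDiff ℝ ((⊤ : ℕ∞) : WithTop ℕ∞) (φ : Rd d → ℝ) →
      T.toMap φ (coord d) = ∫ x in cube d, u x * (φ : Rd d → ℝ) x

end ClassicalCurrents

end MetricCurrents

end

open MetricCurrents

/-! Everything rests on one fact, `exists_abs_integral_mul_jacobian_le`: for `d = m + 1 ≥ 2` there
are Lipschitz densities `u` in the unit cube with `∫ |u| ≥ 1` whose pairing `∫ u det DP` is as small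
as desired, uniformly over all `P` with `1`-Lipschitz components.

Such a `u` is built by induction on a number `K` of scales (`IsMultiscale`): its mass grows like
`K`, while its pairings are at most a dimensional constant times `K τ + 1 / τ`. Taking `τ` small,
then `K` large, and normalising the mass gives the fact. The gain comes from an energy argument. The
squared slope of a `1`-Lipschitz function between `0` and the first basis vector `e` is at most `1`,
and on passing to the mean square slope over a fine grid (`gridEnergy`) it can increase only up to
`1`; so at most scales the function is nearly affine along the lines parallel to `e`.

One scale is added (`IsMultiscale.step`) in the thin tube `[0,1] × [0,1/N]^m` around the first axis.
It carries `N` bumps of size `1/N` with alternating signs. Two neighbouring bumps together see the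
difference of `det DP` and `det DP(· + e/N)`. Jacobian determinants are null Lagrangians
(`integral_jacobian_eq_zero`), so integration by parts bounds this by the `L¹` distance of `P(· +
e/N) - P` from any chosen constant (`abs_integral_mul_jacobian_sub_le`). With the mean increment as
the constant, that distance is controlled by a variance, which is the gain of energy from the coarse
to the fine grid; by `|a| ≤ τ + a² / τ` the cost of the scale is about `τ + gain / τ`
(`abs_integral_checkerboard_le`). The cells of the fine grid in the tube carry rescaled copies of
the previous density, to which the inductive bound applies with the energy still available there
(`abs_integral_fineCopies_le`). The gains telescope. The bumps and the copies hardly overlap because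
the support of the previous density has small volume, so each scale contributes mass. This volume
stays small because the tube is thin, which needs `m ≥ 1`.

A factor `f` is included by shrinking `u` into a tiny box where `f` is nearly constant
(`exists_localized_abs_integral_le`); this also lets the densities be placed in prescribed disjoint
boxes (`exists_irregular_density`). Part (2) is then immediate. For part (1), a clamped multiple of
`u` serves as a Lipschitz substitute for its sign: divided by `n` it is a potential form (take `π`
to be the coordinates) which pairs with `u` to at least `1/(2n)`, whereas forms of norm at most one
pair to at most `1/(4n)`. That `Em` is well defined follows since every `L¹` density gives a metric
current (`cubeCurrent`), by weak-`*` continuity of Jacobian determinants, and `L¹` separates `L^∞`.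
For part (3), densities of mass at least one in disjoint boxes, with norms `2^(-k)` as currents, add
up to a current which is unbounded on test functions bounded by one. An `L¹` density would give a
bound, and so would flatness: in top degree `dω = 0`, so the flat norm is a supremum norm. -/

noncomputable section

namespace MetricCurrents

/-! ### Algebra and scaling of Jacobian determinants -/

section JacobianDeterminant

variable {d : ℕ}

/-- The `i`-th partial derivative of `p`. -/
def partialDeriv (p : Rd d → ℝ) (i : Fin d) (x : Rd d) : ℝ :=
  fderiv ℝ p x (EuclideanSpace.single i 1)

/-- The Jacobian determinant of a tuple of functions on `ℝ^d`. -/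
def jacobian (P : Fin d → Rd d → ℝ) (x : Rd d) : ℝ :=
  Matrix.det (Matrix.of fun i j : Fin d => partialDeriv (P j) i x)

theorem measurable_partialDeriv (p : Rd d → ℝ) (i : Fin d) : Measurable (partialDeriv p i) :=
  measurable_fderiv_apply_const ℝ _ _

theorem measurable_jacobian (P : Fin d → Rd d → ℝ) : Measurable (jacobian P) := by
  unfold jacobian
  simp only [Matrix.det_apply, Matrix.of_apply]
  refine Finset.measurable_sum _ fun s _ => Measurable.const_smul ?_ _
  exact Finset.measurable_prod _ fun i _ => measurable_partialDeriv _ _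

theorem abs_partialDeriv_le {p : Rd d → ℝ} {K : ℝ≥0} (h : LipschitzWith K p) (i : Fin d)
    (x : Rd d) : |partialDeriv p i x| ≤ K := by
  have h1 := ContinuousLinearMap.le_opNorm (fderiv ℝ p x) (EuclideanSpace.single i (1 : ℝ))
  rw [PiLp.norm_single, norm_one, mul_one] at h1
  exact h1.trans (norm_fderiv_le_of_lipschitz ℝ h)

theorem partialDeriv_eq_zero_of_notMem {p : Rd d → ℝ} {S : Set (Rd d)} (hS : IsClosed S)
    (h : ∀ x, x ∉ S → p x = 0) (i : Fin d) {x : Rd d} (hx : x ∉ S) : partialDeriv p i x = 0 := by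
  have : p =ᶠ[𝓝 x] fun _ => 0 := by
    filter_upwards [hS.isOpen_compl.mem_nhds hx] with y hy using h y hy
  rw [partialDeriv, this.fderiv_eq]
  simp

/-- The Leibniz expansion has `d!` terms with one factor from each column. Keeping a separate
constant for every column matters later, when a cutoff with a large Lipschitz constant occupies a
single slot. -/
theorem abs_jacobian_le_of {P : Fin d → Rd d → ℝ} {L : Fin d → ℝ} {x : Rd d}
    (h : ∀ j i, |partialDeriv (P j) i x| ≤ L j) :
    |jacobian P x| ≤ d.factorial * ∏ j, L j := by
  rw [jacobian, Matrix.det_apply]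
  refine (Finset.abs_sum_le_sum_abs _ _).trans ?_
  have h1 : ∀ σ ∈ (Finset.univ : Finset (Equiv.Perm (Fin d))),
      |Equiv.Perm.sign σ • ∏ i, (Matrix.of fun i j : Fin d => partialDeriv (P j) i x) (σ i) i|
        ≤ ∏ j, L j := by
    intro σ _
    have : |Equiv.Perm.sign σ • ∏ i, (Matrix.of fun i j : Fin d => partialDeriv (P j) i x) (σ i) i|
        = ∏ i, |partialDeriv (P i) (σ i) x| := by
      rcases Int.units_eq_one_or (Equiv.Perm.sign σ) with h | h <;>
        simp [h, Finset.abs_prod]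
    rw [this]
    exact Finset.prod_le_prod (fun _ _ => abs_nonneg _) fun i _ => h i (σ i)
  refine (Finset.sum_le_card_nsmul _ _ _ h1).trans ?_
  rw [Finset.card_univ, Fintype.card_perm, Fintype.card_fin, nsmul_eq_mul]

theorem abs_jacobian_le {P : Fin d → Rd d → ℝ} {L : Fin d → ℝ≥0}
    (h : ∀ j, LipschitzWith (L j) (P j)) (x : Rd d) :
    |jacobian P x| ≤ d.factorial * ∏ j, (L j : ℝ) :=
  abs_jacobian_le_of fun j i => abs_partialDeriv_le (h j) i x

theorem jacobian_eq_zero_of_notMem {P : Fin d → Rd d → ℝ} {S : Set (Rd d)} (hS : IsClosed S)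
    (l : Fin d) (h : ∀ x, x ∉ S → P l x = 0) {x : Rd d} (hx : x ∉ S) : jacobian P x = 0 :=
  Matrix.det_eq_zero_of_column_eq_zero l fun i => partialDeriv_eq_zero_of_notMem hS h i hx

theorem jacobian_congr {P P' : Fin d → Rd d → ℝ} {x : Rd d}
    (h : ∀ j i, partialDeriv (P j) i x = partialDeriv (P' j) i x) :
    jacobian P x = jacobian P' x := by
  unfold jacobian
  simp only [h]

theorem jacobian_update (P : Fin d → Rd d → ℝ) (l : Fin d) (q : Rd d → ℝ) (x : Rd d) :
    jacobian (Function.update P l q) x =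
      ((Matrix.of fun i j : Fin d => partialDeriv (P j) i x).updateCol l
        fun i => partialDeriv q i x).det := by
  unfold jacobian
  congr 1
  ext i j
  rw [Matrix.updateCol_apply]
  by_cases hj : j = l
  · subst hj; simp
  · simp [hj]

theorem partialDeriv_add {p q : Rd d → ℝ} {x : Rd d} (hp : DifferentiableAt ℝ p x)
    (hq : DifferentiableAt ℝ q x) (i : Fin d) :
    partialDeriv (p + q) i x = partialDeriv p i x + partialDeriv q i x := by
  simp [partialDeriv, fderiv_add hp hq]

theorem partialDeriv_sub_const (p : Rd d → ℝ) (c : ℝ) (i : Fin d) (x : Rd d) :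
    partialDeriv (fun y => p y - c) i x = partialDeriv p i x := by
  simp [partialDeriv, fderiv_sub_const]

theorem partialDeriv_mul {p q : Rd d → ℝ} {x : Rd d} (hp : DifferentiableAt ℝ p x)
    (hq : DifferentiableAt ℝ q x) (i : Fin d) :
    partialDeriv (fun y => p y * q y) i x
      = p x * partialDeriv q i x + q x * partialDeriv p i x := by
  simp [partialDeriv, fderiv_fun_mul hp hq]

theorem partialDeriv_smul (c : ℝ) (p : Rd d → ℝ) (i : Fin d) (x : Rd d) :
    partialDeriv (c • p) i x = c * partialDeriv p i x := by
  simp [partialDeriv, fderiv_const_smul_field]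

theorem jacobian_update_add (P : Fin d → Rd d → ℝ) (l : Fin d) {p q : Rd d → ℝ} {x : Rd d}
    (hp : DifferentiableAt ℝ p x) (hq : DifferentiableAt ℝ q x) :
    jacobian (Function.update P l (p + q)) x
      = jacobian (Function.update P l p) x + jacobian (Function.update P l q) x := by
  simp only [jacobian_update]
  rw [← Matrix.det_updateCol_add]
  congr 2
  funext i
  exact partialDeriv_add hp hq i

theorem jacobian_update_smul (P : Fin d → Rd d → ℝ) (l : Fin d) (c : ℝ) (p : Rd d → ℝ)
    (x : Rd d) :
    jacobian (Function.update P l (c • p)) x = c * jacobian (Function.update P l p) x := by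
  simp only [jacobian_update]
  rw [← Matrix.det_updateCol_smul]
  congr 2
  funext i
  exact partialDeriv_smul c p i x

/-- The product rule in one column, combined with multilinearity of the determinant; this is the
pointwise form of integration by parts. -/
theorem jacobian_update_mul (P : Fin d → Rd d → ℝ) (l : Fin d) {p q : Rd d → ℝ} {x : Rd d}
    (hp : DifferentiableAt ℝ p x) (hq : DifferentiableAt ℝ q x) :
    jacobian (Function.update P l (fun y => p y * q y)) x
      = p x * jacobian (Function.update P l q) x + q x * jacobian (Function.update P l p) x := by
  simp only [jacobian_update]
  rw [← Matrix.det_updateCol_smul, ← Matrix.det_updateCol_smul, ← Matrix.det_updateCol_add]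
  congr 2
  funext i
  exact partialDeriv_mul hp hq i

/-- The rescaled function `y ↦ c p((y + w) / c)`. -/
def rescale (c : ℝ) (w : Rd d) (p : Rd d → ℝ) (y : Rd d) : ℝ := c * p (c⁻¹ • (y + w))

theorem partialDeriv_comp_add (p : Rd d → ℝ) (w : Rd d) (i : Fin d) (x : Rd d) :
    partialDeriv (fun y => p (y + w)) i x = partialDeriv p i (x + w) := by
  rw [partialDeriv, fderiv_comp_add_right]
  rfl

/-- The outer factor `c` cancels the inner `c⁻¹`, so gradients, and with them Jacobians and
Lipschitz constants, are scale invariant. Hence one estimate for `1`-Lipschitz maps applies on every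
subcube. -/
theorem partialDeriv_rescale {c : ℝ} (hc : c ≠ 0) (w : Rd d) (p : Rd d → ℝ) (i : Fin d)
    (y : Rd d) : partialDeriv (rescale c w p) i y = partialDeriv p i (c⁻¹ • (y + w)) := by
  have h1 : rescale c w p = c • fun y => (fun z => p (c⁻¹ • z)) (y + w) := by
    funext y; simp [rescale]
  rw [h1, partialDeriv_smul, partialDeriv_comp_add (fun z => p (c⁻¹ • z)) w, partialDeriv,
    fderiv_comp_smul]
  simp [partialDeriv, hc]

theorem jacobian_rescale {c : ℝ} (hc : c ≠ 0) (w : Rd d) (P : Fin d → Rd d → ℝ) (y : Rd d) :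
    jacobian (fun j => rescale c w (P j)) y = jacobian P (c⁻¹ • (y + w)) := by
  unfold jacobian
  simp only [partialDeriv_rescale hc]

theorem lipschitzWith_rescale {c : ℝ} (hc : c ≠ 0) (w : Rd d) {p : Rd d → ℝ} {K : ℝ≥0}
    (h : LipschitzWith K p) : LipschitzWith K (rescale c w p) := by
  refine LipschitzWith.of_dist_le_mul fun x y => ?_
  have h1 := h.dist_le_mul (c⁻¹ • (x + w)) (c⁻¹ • (y + w))
  have h2 : dist (rescale c w p x) (rescale c w p y)
      = |c| * dist (p (c⁻¹ • (x + w))) (p (c⁻¹ • (y + w))) := by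
    simp only [rescale, Real.dist_eq, ← mul_sub, abs_mul]
  rw [dist_smul₀, dist_add_right, norm_inv, Real.norm_eq_abs] at h1
  rw [h2]
  calc |c| * _ ≤ |c| * (K * (|c|⁻¹ * dist x y)) := by gcongr
    _ = K * dist x y := by
      have := abs_pos.2 hc
      field_simp

theorem integral_comp_smul_sub {c : ℝ} (hc : 0 < c) (w : Rd d) (F : Rd d → ℝ) :
    ∫ x, F (c • x - w) = (c ^ d)⁻¹ * ∫ y, F y := by
  have h := Measure.integral_comp_smul (volume : Measure (Rd d)) (fun y => F (y - w)) c
  rw [h, integral_sub_right_eq_self, smul_eq_mul]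
  simp [abs_of_pos hc]

theorem integral_comp_smul_sub_mul {c : ℝ} (hc : 0 < c) (w : Rd d) (F G : Rd d → ℝ) :
    ∫ x, F (c • x - w) * G x = (c ^ d)⁻¹ * ∫ y, F y * G (c⁻¹ • (y + w)) := by
  rw [← integral_comp_smul_sub hc w]
  simp [smul_smul, hc.ne']

end JacobianDeterminant

end MetricCurrents

end

noncomputable section

namespace MetricCurrents

/-! ### Jacobian determinants are null Lagrangians: the smooth case -/

section NullLagrangian

variable {d : ℕ}

theorem contDiff_partialDeriv {p : Rd d → ℝ} {n m : ℕ∞} (hp : ContDiff ℝ n p) (hm : m + 1 ≤ n)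
    (i : Fin d) : ContDiff ℝ m (partialDeriv p i) :=
  (hp.fderiv_right (m := m) (by exact_mod_cast hm)).clm_apply contDiff_const

theorem partialDeriv_comm {p : Rd d → ℝ} (hp : ContDiff ℝ 2 p) (a b : Fin d) (x : Rd d) :
    partialDeriv (partialDeriv p a) b x = partialDeriv (partialDeriv p b) a x := by
  have hd : DifferentiableAt ℝ (fderiv ℝ p) x :=
    ((hp.fderiv_right (m := 1) (by norm_num)).differentiable (by norm_num)) x
  have key : ∀ a b : Fin d, partialDeriv (partialDeriv p a) b x
      = fderiv ℝ (fderiv ℝ p) x (EuclideanSpace.single b 1) (EuclideanSpace.single a 1) := by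
    intro a b
    have : partialDeriv p a = fun y => fderiv ℝ p y (EuclideanSpace.single a 1) := rfl
    rw [this, partialDeriv, fderiv_clm_apply hd (by fun_prop)]
    simp
  rw [key, key]
  exact (hp.contDiffAt.isSymmSndFDerivAt (by simp)) _ _

theorem partialDeriv_prod {ι : Type*} [DecidableEq ι] (s : Finset ι) {q : ι → Rd d → ℝ}
    (hq : ∀ j ∈ s, Differentiable ℝ (q j)) (i : Fin d) (x : Rd d) :
    partialDeriv (fun y => ∏ j ∈ s, q j y) i x
      = ∑ j ∈ s, (∏ k ∈ s.erase j, q k x) * partialDeriv (q j) i x := by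
  rw [partialDeriv, fderiv_finsetProd fun j hj => hq j hj x]
  simp [partialDeriv]

/-- Composing `σ` with the transposition of `l` and `j` changes the sign and exchanges the two
indices of a symmetric Hessian, so the sum equals its own negative. Summed over `j`, this is Piola's
identity: the cofactors of a column form a divergence-free field. -/
theorem sum_perm_second_derivative_eq_zero {P : Fin d → Rd d → ℝ}
    (hP : ∀ j, ContDiff ℝ 2 (P j)) {l j : Fin d} (hj : j ≠ l) (x : Rd d) :
    ∑ σ : Equiv.Perm (Fin d), ((Equiv.Perm.sign σ : ℤ) : ℝ) *
      ((∏ k ∈ (Finset.univ.erase l).erase j, partialDeriv (P k) (σ k) x) *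
        partialDeriv (partialDeriv (P j) (σ j)) (σ l) x) = 0 := by
  set f : Equiv.Perm (Fin d) → ℝ := fun σ => ((Equiv.Perm.sign σ : ℤ) : ℝ) *
      ((∏ k ∈ (Finset.univ.erase l).erase j, partialDeriv (P k) (σ k) x) *
        partialDeriv (partialDeriv (P j) (σ j)) (σ l) x) with hf
  have h : ∀ σ, f (Equiv.mulRight (Equiv.swap l j) σ) = -f σ := by
    intro σ
    have h1 : ∏ k ∈ (Finset.univ.erase l).erase j,
          partialDeriv (P k) (σ (Equiv.swap l j k)) x
        = ∏ k ∈ (Finset.univ.erase l).erase j, partialDeriv (P k) (σ k) x := by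
      refine Finset.prod_congr rfl fun k hk => ?_
      simp only [Finset.mem_erase, Finset.mem_univ, and_true] at hk
      rw [Equiv.swap_apply_of_ne_of_ne hk.2 hk.1]
    simp only [hf, Equiv.coe_mulRight, Equiv.Perm.sign_mul, Equiv.Perm.sign_swap hj.symm,
      Equiv.Perm.mul_apply, Equiv.swap_apply_left, Equiv.swap_apply_right]
    rw [h1, partialDeriv_comm (hP j) (σ l) (σ j)]
    push_cast
    ring
  have h2 := Equiv.sum_comp (Equiv.mulRight (Equiv.swap l j)) f
  simp only [h, Finset.sum_neg_distrib] at h2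
  linarith

/-- The integral of a Jacobian determinant vanishes if one of the functions has compact support
(smooth case). -/
theorem integral_jacobian_update_eq_zero_of_contDiff {P : Fin d → Rd d → ℝ}
    (hP : ∀ j, ContDiff ℝ 2 (P j)) (l : Fin d) {G : Rd d → ℝ} (hG : ContDiff ℝ 1 G)
    (hc : HasCompactSupport G) : ∫ x, jacobian (Function.update P l G) x = 0 := by
  have hP1 : ∀ k i, ContDiff ℝ 1 (partialDeriv (P k) i) := fun k i =>
    contDiff_partialDeriv (n := 2) (m := 1) (hP k) (by norm_num) i
  -- The Leibniz term of `σ` with the factor from column `l` left out.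
  set R : Equiv.Perm (Fin d) → Rd d → ℝ :=
    fun σ x => ∏ k ∈ Finset.univ.erase l, partialDeriv (P k) (σ k) x with hR
  have hRc : ∀ σ, ContDiff ℝ 1 (R σ) := fun σ => contDiff_prod fun k _ => hP1 k (σ k)
  have hGc : ∀ i, HasCompactSupport (partialDeriv G i) := fun i =>
    hc.fderiv_apply ℝ _
  have hGcont : ∀ i, Continuous (partialDeriv G i) := fun i =>
    (contDiff_partialDeriv (n := 1) (m := 0) hG (by norm_num) i).continuous
  have hRcont : ∀ σ i, Continuous (partialDeriv (R σ) i) := fun σ i =>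
    (contDiff_partialDeriv (n := 1) (m := 0) (hRc σ) (by norm_num) i).continuous
  have hint1 : ∀ σ i, Integrable (fun x => partialDeriv G i x * R σ x) := fun σ i =>
    ((hGcont i).mul (hRc σ).continuous).integrable_of_hasCompactSupport (hGc i).mul_right
  have hint2 : ∀ σ i, Integrable (fun x => G x * partialDeriv (R σ) i x) := fun σ i =>
    (hG.continuous.mul (hRcont σ i)).integrable_of_hasCompactSupport hc.mul_right
  have hint3 : ∀ σ, Integrable (fun x => G x * R σ x) := fun σ =>
    (hG.continuous.mul (hRc σ).continuous).integrable_of_hasCompactSupport hc.mul_right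
  have hexp : ∀ x, jacobian (Function.update P l G) x
      = ∑ σ : Equiv.Perm (Fin d), ((Equiv.Perm.sign σ : ℤ) : ℝ) *
        (partialDeriv G (σ l) x * R σ x) := by
    intro x
    rw [jacobian, Matrix.det_apply']
    refine Finset.sum_congr rfl fun σ _ => ?_
    congr 1
    rw [← Finset.mul_prod_erase _ _ (Finset.mem_univ l)]
    congr 1
    · simp
    · refine Finset.prod_congr rfl fun k hk => ?_
      simp [(Finset.mem_erase.1 hk).1]
  have hparts : ∀ σ : Equiv.Perm (Fin d), ∫ x, partialDeriv G (σ l) x * R σ x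
      = -∫ x, G x * partialDeriv (R σ) (σ l) x := by
    intro σ
    have := integral_mul_fderiv_eq_neg_fderiv_mul_of_integrable (μ := (volume : Measure (Rd d)))
      (hint1 σ (σ l)) (hint2 σ (σ l)) (hint3 σ)
      (fun x _ => hG.differentiable (by norm_num) x)
      (fun x _ => (hRc σ).differentiable (by norm_num) x)
    change ∫ x, G x * partialDeriv (R σ) (σ l) x = -∫ x, partialDeriv G (σ l) x * R σ x at this
    rw [this, neg_neg]
  -- Piola's identity, which annihilates what remains after the derivative has been moved off `G`.
  have hzero : ∀ x, ∑ σ : Equiv.Perm (Fin d), ((Equiv.Perm.sign σ : ℤ) : ℝ) *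
      partialDeriv (R σ) (σ l) x = 0 := by
    intro x
    have h1 : ∀ σ : Equiv.Perm (Fin d), partialDeriv (R σ) (σ l) x
        = ∑ j ∈ Finset.univ.erase l, (∏ k ∈ (Finset.univ.erase l).erase j,
          partialDeriv (P k) (σ k) x) * partialDeriv (partialDeriv (P j) (σ j)) (σ l) x := fun σ =>
      partialDeriv_prod _ (fun j _ => (hP1 j (σ j)).differentiable (by norm_num)) _ _
    simp only [h1, Finset.mul_sum]
    rw [Finset.sum_comm]
    exact Finset.sum_eq_zero fun j hj =>
      sum_perm_second_derivative_eq_zero hP (Finset.mem_erase.1 hj).1 x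
  simp only [hexp]
  rw [integral_finsetSum _ fun σ _ => (hint1 σ (σ l)).const_mul _]
  simp only [integral_const_mul, hparts, mul_neg, Finset.sum_neg_distrib]
  simp only [← integral_const_mul]
  rw [← integral_finsetSum _ fun σ _ => (hint2 σ (σ l)).const_mul _]
  have : ∀ x, ∑ σ : Equiv.Perm (Fin d), ((Equiv.Perm.sign σ : ℤ) : ℝ) *
      (G x * partialDeriv (R σ) (σ l) x) = 0 := by
    intro x
    have := congrArg (fun r => G x * r) (hzero x)
    simp only [Finset.mul_sum, mul_zero] at this
    rw [← this]
    exact Finset.sum_congr rfl fun σ _ => by ring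
  simp [this]

end NullLagrangian

/-! ### Mollification and convergence of gradients -/

section Mollification

variable {d : ℕ}

/-- A sequence of bump functions shrinking to the origin. -/
def mollifier (d k : ℕ) : ContDiffBump (0 : Rd d) :=
  ⟨1 / ((k : ℝ) + 1), 2 * (1 / ((k : ℝ) + 1)), by positivity, by
    have : (0 : ℝ) < 1 / ((k : ℝ) + 1) := by positivity
    linarith⟩

open scoped Convolution in
/-- Mollification of `p` at scale `1 / (k + 1)`. -/
def mollify (k : ℕ) (p : Rd d → ℝ) : Rd d → ℝ :=
  (mollifier d k).normed volume ⋆[ContinuousLinearMap.lsmul ℝ ℝ, volume] p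

theorem mollify_apply (k : ℕ) (p : Rd d → ℝ) (x : Rd d) :
    mollify k p x = ∫ t, (mollifier d k).normed volume t * p (x - t) := rfl

theorem integrable_mollifier_mul (k : ℕ) {p : Rd d → ℝ} (hp : Continuous p) :
    Integrable fun t => (mollifier d k).normed volume t * p t :=
  ((mollifier d k).continuous_normed.mul hp).integrable_of_hasCompactSupport
    (mollifier d k).hasCompactSupport_normed.mul_right

theorem abs_integral_mollifier_mul_le (k : ℕ) {q : Rd d → ℝ} {C : ℝ}
    (h : ∀ t, |q t| ≤ C) : |∫ t, (mollifier d k).normed volume t * q t| ≤ C := by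
  have h1 : ∫ t : Rd d, (mollifier d k).normed volume t * C = C := by
    rw [integral_mul_const, (mollifier d k).integral_normed, one_mul]
  rw [← h1, ← Real.norm_eq_abs]
  refine norm_integral_le_of_norm_le
    (((mollifier d k).integrable_normed (μ := (volume : Measure (Rd d)))).mul_const C)
    (Eventually.of_forall fun t => ?_)
  rw [norm_mul, Real.norm_of_nonneg ((mollifier d k).nonneg_normed t)]
  exact mul_le_mul_of_nonneg_left (h t) ((mollifier d k).nonneg_normed t)

theorem abs_mollify_le (k : ℕ) {p : Rd d → ℝ} {C : ℝ} (h : ∀ x, |p x| ≤ C) (x : Rd d) :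
    |mollify k p x| ≤ C := abs_integral_mollifier_mul_le k fun t => h (x - t)

theorem contDiff_mollify (k : ℕ) {p : Rd d → ℝ} (hp : Continuous p) {n : ℕ∞} :
    ContDiff ℝ n (mollify k p) :=
  (mollifier d k).hasCompactSupport_normed.contDiff_convolution_left _
    (mollifier d k).contDiff_normed hp.locallyIntegrable

theorem lipschitzWith_mollify (k : ℕ) {p : Rd d → ℝ} {K : ℝ≥0} (hp : LipschitzWith K p) :
    LipschitzWith K (mollify k p) := by
  refine LipschitzWith.of_dist_le_mul fun x y => ?_
  have hi : ∀ z, Integrable fun t => (mollifier d k).normed volume t * p (z - t) := fun z =>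
    integrable_mollifier_mul k (hp.continuous.comp (continuous_const.sub continuous_id))
  rw [Real.dist_eq, mollify_apply, mollify_apply, ← integral_sub (hi x) (hi y)]
  simp only [← mul_sub]
  refine abs_integral_mollifier_mul_le k fun t => ?_
  have := hp.dist_le_mul (x - t) (y - t)
  rwa [dist_sub_right] at this

/-- The margin `2` bounds the outer radius of every mollifier, so the supports stay in one ball
independent of `k`. -/
theorem mollify_eq_zero (k : ℕ) {p : Rd d → ℝ} {R : ℝ}
    (h : ∀ x, R < ‖x‖ → p x = 0) {x : Rd d} (hx : R + 2 < ‖x‖) : mollify k p x = 0 := by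
  rw [mollify_apply]
  refine integral_eq_zero_of_ae (Eventually.of_forall fun t => ?_)
  by_cases ht : t ∈ Metric.ball (0 : Rd d) (mollifier d k).rOut
  · have h1 : ‖t‖ < 2 := by
      have h2 : (mollifier d k).rOut ≤ 2 := by
        change 2 * (1 / ((k : ℝ) + 1)) ≤ 2
        have : 1 / ((k : ℝ) + 1) ≤ 1 := by
          rw [div_le_one (by positivity)]
          simp
        linarith
      rw [mem_ball_zero_iff] at ht
      linarith
    have h2 := norm_sub_norm_le x t
    simp [h (x - t) (by linarith)]
  · have : (mollifier d k).normed volume t = 0 := by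
      rw [← Function.notMem_support, (mollifier d k).support_normed_eq]
      exact ht
    simp [this]

theorem tendsto_mollifier_rOut (d : ℕ) :
    Tendsto (fun k => (mollifier d k).rOut) atTop (𝓝 0) := by
  have := (tendsto_one_div_add_atTop_nhds_zero_nat (𝕜 := ℝ)).const_mul 2
  rwa [mul_zero] at this

theorem tendsto_mollify {p : Rd d → ℝ} (hp : Continuous p) (x : Rd d) :
    Tendsto (fun k => mollify k p x) atTop (𝓝 (p x)) :=
  ContDiffBump.convolution_tendsto_right_of_continuous (tendsto_mollifier_rOut d) hp x

/-- The derivative is placed on `p` rather than on the bump: directional difference quotients of `p`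
are bounded by `K` and converge almost everywhere, so one may differentiate under the integral. The
result is a mollified bounded function, to which Lebesgue's differentiation theorem applies. -/
theorem partialDeriv_mollify (k : ℕ) {p : Rd d → ℝ} {K : ℝ≥0} (hp : LipschitzWith K p)
    (i : Fin d) (x : Rd d) : partialDeriv (mollify k p) i x
      = mollify k (fun y => lineDeriv ℝ p y (EuclideanSpace.single i 1)) x := by
  set v : Rd d := EuclideanSpace.single i 1 with hv
  have hv1 : ‖v‖ = 1 := by simp [hv]
  have hdiff : HasDerivAt (fun s : ℝ => mollify k p (x + s • v)) (partialDeriv (mollify k p) i x) 0 := by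
    have h1 : DifferentiableAt ℝ (mollify k p) (x + (0 : ℝ) • v) :=
      (contDiff_mollify k hp.continuous (n := 1)).differentiable (by norm_num) _
    have h2 : HasDerivAt (fun s : ℝ => x + s • v) v 0 := by
      simpa using ((hasDerivAt_id (0 : ℝ)).smul_const v).const_add x
    have h3 := h1.hasFDerivAt.comp_hasDerivAt (0 : ℝ) h2
    rw [zero_smul, add_zero] at h3
    exact h3
  refine hdiff.unique ?_
  have hmeas : AEStronglyMeasurable
      (fun t => (mollifier d k).normed volume t * lineDeriv ℝ p (x - t) v) volume := by
    refine ((mollifier d k).continuous_normed.measurable.mul ?_).aestronglyMeasurable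
    exact (measurable_lineDeriv hp.continuous).comp (measurable_const.sub measurable_id)
  have key := hasDerivAt_integral_of_dominated_loc_of_lip (𝕜 := ℝ) (x₀ := (0 : ℝ))
    (μ := (volume : Measure (Rd d))) (s := univ)
    (F := fun s t => (mollifier d k).normed volume t * p (x + s • v - t))
    (F' := fun t => (mollifier d k).normed volume t * lineDeriv ℝ p (x - t) v)
    (bound := fun t => (mollifier d k).normed volume t * K) univ_mem
    (Eventually.of_forall fun s => ?_) ?_ hmeas (Eventually.of_forall fun t => ?_)
    (((mollifier d k).integrable_normed (μ := (volume : Measure (Rd d)))).mul_const _) ?_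
  · exact key.2
  · exact (integrable_mollifier_mul k (hp.continuous.comp
      (continuous_const.sub continuous_id))).aestronglyMeasurable
  · exact integrable_mollifier_mul k (hp.continuous.comp (continuous_const.sub continuous_id))
  · refine LipschitzOnWith.of_dist_le_mul fun a _ b _ => ?_
    have h0 := (mollifier d k).nonneg_normed (μ := volume) t
    rw [Real.coe_nnabs, abs_of_nonneg (mul_nonneg h0 (NNReal.coe_nonneg K)), Real.dist_eq, ← mul_sub, abs_mul,
      abs_of_nonneg h0, mul_assoc]
    refine mul_le_mul_of_nonneg_left ?_ h0
    have := hp.dist_le_mul (x + a • v - t) (x + b • v - t)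
    rwa [dist_sub_right, dist_add_left, dist_eq_norm (a • v), ← sub_smul, norm_smul, hv1, mul_one]
      at this
  · have h1 := hp.ae_lineDifferentiableAt (μ := (volume : Measure (Rd d))) v
    have h2 := (quasiMeasurePreserving_sub_left (volume : Measure (Rd d)) x).ae h1
    filter_upwards [h2] with t ht
    have h3 := ht.hasLineDerivAt
    have h4 : HasDerivAt (fun s : ℝ => p (x - t + s • v)) (lineDeriv ℝ p (x - t) v) 0 := h3
    have h5 : (fun s : ℝ => p (x + s • v - t)) = fun s : ℝ => p (x - t + s • v) := by
      funext s; congr 1; abel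
    have h6 : HasDerivAt (fun s : ℝ => p (x + s • v - t)) (lineDeriv ℝ p (x - t) v) 0 := by
      rwa [h5]
    exact h6.const_mul _

theorem ae_tendsto_partialDeriv_mollify {p : Rd d → ℝ} {K : ℝ≥0} (hp : LipschitzWith K p) :
    ∀ᵐ x, ∀ i : Fin d,
      Tendsto (fun k => partialDeriv (mollify k p) i x) atTop (𝓝 (partialDeriv p i x)) := by
  rw [ae_all_iff]
  intro i
  -- The outer radius is exactly twice the inner one; a bounded ratio is what makes the convolutions
  -- converge at Lebesgue points.
  have h := ContDiffBump.ae_convolution_tendsto_right_of_locallyIntegrable (φ := mollifier d)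
    (K := 2) (tendsto_mollifier_rOut d) (Eventually.of_forall fun k => le_rfl)
    (hp.locallyIntegrable_lineDeriv (μ := (volume : Measure (Rd d))) (EuclideanSpace.single i 1))
  filter_upwards [h, hp.ae_differentiableAt (μ := (volume : Measure (Rd d)))] with x hx hd
  simp only [partialDeriv_mollify _ hp]
  rw [partialDeriv, ← hd.lineDeriv_eq_fderiv]
  exact hx

end Mollification

end MetricCurrents

end

noncomputable section

namespace MetricCurrents

/-! ### Integration by parts for Lipschitz Jacobians -/

section IntegrationByParts

variable {d : ℕ}

/-- The integral of the Jacobian determinant of Lipschitz functions vanishes if one of them has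
compact support. -/
theorem integral_jacobian_eq_zero {P : Fin d → Rd d → ℝ} {L : Fin d → ℝ≥0}
    (hP : ∀ j, LipschitzWith (L j) (P j)) (l : Fin d) (hc : HasCompactSupport (P l)) :
    ∫ x, jacobian P x = 0 := by
  obtain ⟨R, hR⟩ := hc.isCompact.isBounded.subset_closedBall (0 : Rd d)
  have hPR : ∀ x, R < ‖x‖ → P l x = 0 := fun x hx => by
    refine image_eq_zero_of_notMem_tsupport fun hmem => ?_
    have := hR hmem
    rw [mem_closedBall_zero_iff] at this
    linarith
  have hzero : ∀ k : ℕ, ∀ x, x ∉ Metric.closedBall (0 : Rd d) (R + 2) →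
      mollify k (P l) x = 0 := fun k x hx => by
    refine mollify_eq_zero k hPR ?_
    rwa [mem_closedBall_zero_iff, not_le] at hx
  have hint : ∀ k, ∫ x, jacobian (fun j => mollify k (P j)) x = 0 := by
    intro k
    have h := integral_jacobian_update_eq_zero_of_contDiff (P := fun j => mollify k (P j))
      (fun j => contDiff_mollify k (hP j).continuous (n := 2)) l
      (G := mollify k (P l)) (contDiff_mollify k (hP l).continuous (n := 1))
      (HasCompactSupport.intro (isCompact_closedBall 0 (R + 2)) (hzero k))
    rwa [Function.update_eq_self l (fun j => mollify k (P j))] at h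
  -- Mollification does not increase Lipschitz constants, so the determinants are uniformly bounded;
  -- they vanish off one ball and converge almost everywhere.
  have hlim : Tendsto (fun k => ∫ x, jacobian (fun j => mollify k (P j)) x) atTop
      (𝓝 (∫ x, jacobian P x)) := by
    refine tendsto_integral_of_dominated_convergence
      ((Metric.closedBall (0 : Rd d) (R + 2)).indicator fun _ => d.factorial * ∏ j, (L j : ℝ))
      (fun k => (measurable_jacobian _).aestronglyMeasurable) ?_ (fun k => ?_) ?_
    · exact (integrable_indicator_iff Metric.isClosed_closedBall.measurableSet).2
        (integrableOn_const (isCompact_closedBall _ _).measure_lt_top.ne)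
    · refine Eventually.of_forall fun x => ?_
      by_cases hx : x ∈ Metric.closedBall (0 : Rd d) (R + 2)
      · rw [indicator_of_mem hx]
        exact abs_jacobian_le (fun j => lipschitzWith_mollify k (hP j)) x
      · rw [indicator_of_notMem hx,
          jacobian_eq_zero_of_notMem Metric.isClosed_closedBall l (hzero k) hx, norm_zero]
    · have h := ae_all_iff.2 fun j => ae_tendsto_partialDeriv_mollify (hP j)
      filter_upwards [h] with x hx
      have hM : Tendsto (fun k => Matrix.of fun i j : Fin d =>
          partialDeriv (mollify k (P j)) i x) atTop
          (𝓝 (Matrix.of fun i j : Fin d => partialDeriv (P j) i x)) :=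
        tendsto_pi_nhds.2 fun i => tendsto_pi_nhds.2 fun j => hx j i
      exact (((continuous_id (X := Matrix (Fin d) (Fin d) ℝ)).matrix_det).tendsto _).comp hM
  simp only [hint] at hlim
  exact tendsto_nhds_unique hlim tendsto_const_nhds

theorem integrable_of_bounded_of_eq_zero {F : Rd d → ℝ} (hF : AEStronglyMeasurable F volume)
    {S : Set (Rd d)} (hS : IsCompact S) {C : ℝ} (hC : ∀ x ∈ S, |F x| ≤ C)
    (h0 : ∀ x, x ∉ S → F x = 0) : Integrable F := by
  have hsupp : Function.support F ⊆ S := fun x hx => by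
    by_contra h
    exact hx (h0 x h)
  rw [← integrableOn_iff_integrable_of_support_subset hsupp]
  exact Measure.integrableOn_of_bounded hS.measure_lt_top.ne hF
    ((ae_restrict_iff' hS.measurableSet).2 (Eventually.of_forall hC))

theorem exists_lipschitzWith_mul {g e : Rd d → ℝ} {C E : ℝ≥0} (hg : LipschitzWith C g)
    (he : LipschitzWith E e) {S : Set (Rd d)} (hS : IsCompact S) (h0 : ∀ x, x ∉ S → g x = 0) :
    ∃ K, LipschitzWith K fun x => g x * e x := by
  obtain ⟨A, hA⟩ := hS.exists_bound_of_continuousOn he.continuous.continuousOn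
  obtain ⟨B, hB⟩ := hS.exists_bound_of_continuousOn hg.continuous.continuousOn
  have hB' : ∀ x, |g x| ≤ |B| := fun x => by
    by_cases hx : x ∈ S
    · exact (hB x hx).trans (le_abs_self B)
    · rw [h0 x hx, abs_zero]; exact abs_nonneg _
  -- The function `e` may be unbounded. The difference is split so that `e` is evaluated only at a
  -- point of `S`, while the bound on `g` is global.
  have key : ∀ x ∈ S, ∀ y, |g x * e x - g y * e y| ≤ (|A| * C + |B| * E) * dist x y := by
    intro x hx y
    have h1 : g x * e x - g y * e y = e x * (g x - g y) + g y * (e x - e y) := by ring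
    have h2 := hg.dist_le_mul x y
    have h3 := he.dist_le_mul x y
    rw [Real.dist_eq] at h2 h3
    have h4 : |e x| ≤ |A| := (hA x hx).trans (le_abs_self A)
    calc _ ≤ |e x| * |g x - g y| + |g y| * |e x - e y| := by
          rw [h1, ← abs_mul, ← abs_mul]; exact abs_add_le _ _
      _ ≤ |A| * (C * dist x y) + |B| * (E * dist x y) := by
          exact add_le_add (mul_le_mul h4 h2 (abs_nonneg _) (abs_nonneg _))
            (mul_le_mul (hB' y) h3 (abs_nonneg _) (abs_nonneg _))
      _ = _ := by ring
  refine ⟨⟨|A| * C + |B| * E, by positivity⟩, LipschitzWith.of_dist_le_mul fun x y => ?_⟩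
  rw [Real.dist_eq]
  by_cases hx : x ∈ S
  · exact key x hx y
  by_cases hy : y ∈ S
  · rw [abs_sub_comm, dist_comm]
    exact key y hy x
  · rw [h0 x hx, h0 y hy]
    simp only [zero_mul, sub_self, abs_zero]
    exact mul_nonneg (NNReal.coe_nonneg _) dist_nonneg

theorem prod_update_const (l : Fin d) (C K : ℝ≥0) :
    ∏ j, ((Function.update (fun _ => K) l C j : ℝ≥0) : ℝ) = C * K ^ (d - 1) := by
  rw [← NNReal.coe_prod, Finset.prod_update_of_mem (Finset.mem_univ l), Finset.prod_const]
  have : (Finset.univ \ {l} : Finset (Fin d)).card = d - 1 := by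
    rw [Finset.card_sdiff_of_subset (Finset.subset_univ _)]
    simp
  rw [this]
  push_cast
  rfl

theorem lipschitzWith_update {P : Fin d → Rd d → ℝ} {C K : ℝ≥0} (hP : ∀ j, LipschitzWith K (P j))
    (l : Fin d) {g : Rd d → ℝ} (hg : LipschitzWith C g) (j : Fin d) :
    LipschitzWith (Function.update (fun _ => K) l C j) (Function.update P l g j) := by
  by_cases hj : j = l
  · subst hj; simpa using hg
  · simpa [hj] using hP j

theorem abs_jacobian_update_le {P : Fin d → Rd d → ℝ} {C K : ℝ≥0}
    (hP : ∀ j, LipschitzWith K (P j)) (l : Fin d) {g : Rd d → ℝ} (hg : LipschitzWith C g)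
    (x : Rd d) : |jacobian (Function.update P l g) x| ≤ d.factorial * (C * K ^ (d - 1)) := by
  rw [← prod_update_const l C K]
  exact abs_jacobian_le (lipschitzWith_update hP l hg) x

theorem abs_jacobian_le_pow {P : Fin d → Rd d → ℝ} {K : ℝ≥0}
    (hP : ∀ j, LipschitzWith K (P j)) (x : Rd d) : |jacobian P x| ≤ d.factorial * (K : ℝ) ^ d := by
  have := abs_jacobian_le hP x
  simpa using this

/-- With the compactly supported product `g e` in slot `l` the Jacobian integrates to zero, and the
product rule splits it into the two sides. -/
theorem integral_mul_jacobian_update {g e : Rd d → ℝ} {C E K : ℝ≥0} (hg : LipschitzWith C g)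
    (he : LipschitzWith E e) {S : Set (Rd d)} (hS : IsCompact S) (h0 : ∀ x, x ∉ S → g x = 0)
    {P : Fin d → Rd d → ℝ} (hP : ∀ j, LipschitzWith K (P j)) (l : Fin d) :
    ∫ x, g x * jacobian (Function.update P l e) x
      = -∫ x, e x * jacobian (Function.update P l g) x := by
  obtain ⟨D, hD⟩ := exists_lipschitzWith_mul hg he hS h0
  have hc : HasCompactSupport fun x => g x * e x :=
    HasCompactSupport.intro hS fun x hx => by rw [h0 x hx, zero_mul]
  have hz := integral_jacobian_eq_zero (lipschitzWith_update hP l hD) l (by simpa using hc)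
  have hae : (fun x => jacobian (Function.update P l fun x => g x * e x) x) =ᵐ[volume]
      fun x => g x * jacobian (Function.update P l e) x
        + e x * jacobian (Function.update P l g) x := by
    filter_upwards [hg.ae_differentiableAt (μ := (volume : Measure (Rd d))),
      he.ae_differentiableAt (μ := (volume : Measure (Rd d)))] with x h1 h2
    exact jacobian_update_mul P l h1 h2
  obtain ⟨A, hA⟩ := hS.exists_bound_of_continuousOn he.continuous.continuousOn
  obtain ⟨B, hB⟩ := hS.exists_bound_of_continuousOn hg.continuous.continuousOn
  rw [integral_congr_ae hae, integral_add] at hz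
  · linarith
  · refine integrable_of_bounded_of_eq_zero
      (hg.continuous.measurable.mul (measurable_jacobian _)).aestronglyMeasurable hS
      (C := B * (d.factorial * (E * K ^ (d - 1)))) (fun x hx => ?_) fun x hx => ?_
    · rw [abs_mul]
      exact mul_le_mul (hB x hx) (abs_jacobian_update_le hP l he x) (abs_nonneg _)
        ((norm_nonneg _).trans (hB x hx))
    · rw [h0 x hx, zero_mul]
  · refine integrable_of_bounded_of_eq_zero
      (he.continuous.measurable.mul (measurable_jacobian _)).aestronglyMeasurable hS
      (C := A * (d.factorial * (C * K ^ (d - 1)))) (fun x hx => ?_) fun x hx => ?_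
    · rw [abs_mul]
      exact mul_le_mul (hA x hx) (abs_jacobian_update_le hP l hg x) (abs_nonneg _)
        ((norm_nonneg _).trans (hA x hx))
    · rw [jacobian_eq_zero_of_notMem hS.isClosed l (by simpa using h0) hx, mul_zero]

theorem integrable_mul_jacobian {g : Rd d → ℝ} (hg : Continuous g) {S : Set (Rd d)}
    (hS : IsCompact S) (h0 : ∀ x, x ∉ S → g x = 0) {P : Fin d → Rd d → ℝ} {K : ℝ≥0}
    (hP : ∀ j, LipschitzWith K (P j)) : Integrable fun x => g x * jacobian P x := by
  obtain ⟨B, hB⟩ := hS.exists_bound_of_continuousOn hg.continuousOn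
  refine integrable_of_bounded_of_eq_zero
      (hg.measurable.mul (measurable_jacobian _)).aestronglyMeasurable hS
      (C := B * (d.factorial * (K : ℝ) ^ d)) (fun x hx => ?_) fun x hx => ?_
  · rw [abs_mul]
    exact mul_le_mul (hB x hx) (abs_jacobian_le_pow hP x) (abs_nonneg _)
      ((norm_nonneg _).trans (hB x hx))
  · rw [h0 x hx, zero_mul]

/-- The change is a Jacobian with `q - P l - c` in slot `l`. Moving the derivative onto `g` leaves
only an `L¹` norm of this difference. The constant `c` is free because Jacobians do not see it; the
estimate is useful when `q - P l` is close to a constant but not to zero. -/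
theorem abs_integral_mul_jacobian_update_sub_le {g q : Rd d → ℝ} {C K : ℝ≥0}
    (hg : LipschitzWith C g) {S : Set (Rd d)} (hS : IsCompact S) (h0 : ∀ x, x ∉ S → g x = 0)
    {P : Fin d → Rd d → ℝ} (hP : ∀ j, LipschitzWith K (P j)) (l : Fin d)
    (hq : LipschitzWith K q) (c : ℝ) :
    |∫ x, g x * (jacobian (Function.update P l q) x - jacobian P x)|
      ≤ d.factorial * (C * K ^ (d - 1)) * ∫ x in S, |q x - P l x - c| := by
  set e : Rd d → ℝ := fun x => q x - P l x - c with he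
  have heL : LipschitzWith (K + K + 0) e := (hq.sub (hP l)).sub (LipschitzWith.const c)
  have hae : (fun x => g x * (jacobian (Function.update P l q) x - jacobian P x)) =ᵐ[volume]
      fun x => g x * jacobian (Function.update P l e) x := by
    filter_upwards [hq.ae_differentiableAt (μ := (volume : Measure (Rd d))),
      (hP l).ae_differentiableAt (μ := (volume : Measure (Rd d))),
      heL.ae_differentiableAt (μ := (volume : Measure (Rd d)))] with x h1 h2 h3
    have h5 : q - (fun _ => c) = P l + e := by funext y; simp [he]; ring
    have h6 : jacobian (Function.update P l q) x
        = jacobian (Function.update P l (P l + e)) x := by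
      refine jacobian_congr fun j i => ?_
      by_cases hj : j = l
      · subst hj
        rw [Function.update_self, Function.update_self, ← h5]
        exact (partialDeriv_sub_const q c i x).symm
      · simp [hj]
    rw [h6, jacobian_update_add P l h2 h3, Function.update_eq_self, add_sub_cancel_left]
  rw [integral_congr_ae hae, integral_mul_jacobian_update hg heL hS h0 hP l, abs_neg]
  have hz : ∀ x, x ∉ S → e x * jacobian (Function.update P l g) x = 0 := fun x hx => by
    rw [jacobian_eq_zero_of_notMem hS.isClosed l (by simpa using h0) hx, mul_zero]
  rw [← setIntegral_eq_integral_of_forall_compl_eq_zero hz, ← integral_const_mul,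
    ← Real.norm_eq_abs]
  refine norm_integral_le_of_norm_le
    ((heL.continuous.abs.continuousOn.integrableOn_compact hS).const_mul _)
    (Eventually.of_forall fun x => ?_)
  rw [norm_mul, mul_comm]
  exact mul_le_mul_of_nonneg_right (abs_jacobian_update_le hP l hg x) (abs_nonneg _)

/-- Jacobian determinants depend continuously, in a weak sense, on the functions. -/
theorem abs_integral_mul_jacobian_sub_le {g : Rd d → ℝ} {C K : ℝ≥0}
    (hg : LipschitzWith C g) {S : Set (Rd d)} (hS : IsCompact S) (h0 : ∀ x, x ∉ S → g x = 0)
    {P P' : Fin d → Rd d → ℝ} (hP : ∀ j, LipschitzWith K (P j))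
    (hP' : ∀ j, LipschitzWith K (P' j)) (c : Fin d → ℝ) :
    |∫ x, g x * (jacobian P' x - jacobian P x)|
      ≤ d.factorial * (C * K ^ (d - 1)) * ∑ l, ∫ x in S, |P' l x - P l x - c l| := by
  classical
  -- The components are exchanged one at a time; all hybrid tuples obey the same Lipschitz bound.
  have key : ∀ s : Finset (Fin d), |∫ x, g x * (jacobian (s.piecewise P' P) x - jacobian P x)|
      ≤ d.factorial * (C * K ^ (d - 1)) * ∑ l ∈ s, ∫ x in S, |P' l x - P l x - c l| := by
    intro s
    induction s using Finset.induction_on with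
    | empty => simp
    | insert l s hl ih =>
      have hQ : ∀ s : Finset (Fin d), ∀ j, LipschitzWith K (s.piecewise P' P j) := fun s j => by
        by_cases hj : j ∈ s
        · rw [Finset.piecewise_eq_of_mem _ _ _ hj]; exact hP' j
        · rw [Finset.piecewise_eq_of_notMem _ _ _ hj]; exact hP j
      have h1 := abs_integral_mul_jacobian_update_sub_le hg hS h0 (hQ s) l (hP' l) (c l)
      rw [← Finset.piecewise_insert, Finset.piecewise_eq_of_notMem _ _ _ hl] at h1
      have h2 : ∫ x, g x * (jacobian ((insert l s).piecewise P' P) x - jacobian P x)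
          = (∫ x, g x * (jacobian ((insert l s).piecewise P' P) x
              - jacobian (s.piecewise P' P) x))
            + ∫ x, g x * (jacobian (s.piecewise P' P) x - jacobian P x) := by
        have hi : ∀ s : Finset (Fin d), Integrable fun x => g x * jacobian (s.piecewise P' P) x :=
          fun s => integrable_mul_jacobian hg.continuous hS h0 (hQ s)
        have hi0 := integrable_mul_jacobian hg.continuous hS h0 hP
        rw [← integral_add]
        · congr 1; funext x; ring
        · simp only [mul_sub]
          exact (hi (insert l s)).sub (hi s)
        · simp only [mul_sub]
          exact (hi s).sub hi0
      rw [h2, Finset.sum_insert hl, mul_add]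
      exact (abs_add_le _ _).trans (add_le_add h1 ih)
  simpa using key Finset.univ

end IntegrationByParts

end MetricCurrents

end

noncomputable section

namespace MetricCurrents

/-! ### From functions on the cube to Lipschitz functions on `ℝ^d` -/

section CubeExtension

variable {d : ℕ}

/-- The least Lipschitz constant as a nonnegative real. -/
def lipConstNN {X : Type*} [MetricSpace X] (f : Lip X) : ℝ≥0 := ⟨lipConst f, lipConst_nonneg f⟩

theorem exists_lipExt (f : Lip (cube d)) : ∃ F : Rd d → ℝ, LipschitzWith (lipConstNN f) F ∧
    ∀ x ∈ cube d, zeroExt (f : cube d → ℝ) x = F x := by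
  have hl : LipschitzOnWith (lipConstNN f) (zeroExt (f : cube d → ℝ)) (cube d) := by
    refine LipschitzOnWith.of_dist_le_mul fun x hx y hy => ?_
    have := dist_le_lipConst f ⟨x, hx⟩ ⟨y, hy⟩
    rwa [← zeroExt_apply (f : cube d → ℝ) ⟨x, hx⟩,
      ← zeroExt_apply (f : cube d → ℝ) ⟨y, hy⟩] at this
  obtain ⟨F, hF, hE⟩ := hl.extend_real
  exact ⟨F, hF, fun x hx => hE hx⟩

/-- A Lipschitz extension to `ℝ^d` with the same Lipschitz constant. -/
def lipExt (f : Lip (cube d)) : Rd d → ℝ := Classical.choose (exists_lipExt f)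

theorem lipschitzWith_lipExt (f : Lip (cube d)) : LipschitzWith (lipConstNN f) (lipExt f) :=
  (Classical.choose_spec (exists_lipExt f)).1

theorem zeroExt_eq_lipExt (f : Lip (cube d)) {x : Rd d} (hx : x ∈ cube d) :
    zeroExt (f : cube d → ℝ) x = lipExt f x := (Classical.choose_spec (exists_lipExt f)).2 x hx

theorem zeroExt_of_mem (f : cube d → ℝ) {x : Rd d} (hx : x ∈ cube d) : zeroExt f x = f ⟨x, hx⟩ :=
  zeroExt_apply f ⟨x, hx⟩

theorem zeroExt_eventuallyEq_lipExt (f : Lip (cube d)) {x : Rd d} (hx : x ∈ interior (cube d)) :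
    zeroExt (f : cube d → ℝ) =ᶠ[𝓝 x] lipExt f := by
  filter_upwards [mem_interior_iff_mem_nhds.1 hx] with y hy using zeroExt_eq_lipExt f hy

theorem jac_eq_jacobian (π : Fin d → Lip (cube d)) {x : Rd d} (hx : x ∈ interior (cube d)) :
    jac π x = jacobian (fun j => zeroExt (π j : cube d → ℝ)) x := by
  refine congrArg Matrix.det (Matrix.ext fun i j => ?_)
  simp only [Matrix.of_apply]
  rw [fderivWithin_of_mem_nhds (mem_interior_iff_mem_nhds.1 hx), partialDeriv]

theorem jac_eq_jacobian_of_eqOn (π : Fin d → Lip (cube d)) {P : Fin d → Rd d → ℝ}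
    (hP : ∀ j, ∀ x ∈ cube d, zeroExt (π j : cube d → ℝ) x = P j x)
    {x : Rd d} (hx : x ∈ interior (cube d)) : jac π x = jacobian P x := by
  rw [jac_eq_jacobian π hx]
  refine jacobian_congr fun j i => ?_
  have : zeroExt (π j : cube d → ℝ) =ᶠ[𝓝 x] P j := by
    filter_upwards [mem_interior_iff_mem_nhds.1 hx] with y hy using hP j y hy
  rw [partialDeriv, this.fderiv_eq, partialDeriv]

theorem jac_eq_jacobian_lipExt (π : Fin d → Lip (cube d)) {x : Rd d}
    (hx : x ∈ interior (cube d)) : jac π x = jacobian (fun j => lipExt (π j)) x :=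
  jac_eq_jacobian_of_eqOn π (fun j _ hx => zeroExt_eq_lipExt (π j) hx) hx

theorem ae_differentiableAt_zeroExt (f : Lip (cube d)) :
    ∀ᵐ x ∂cubeMeasure d, DifferentiableAt ℝ (zeroExt (f : cube d → ℝ)) x := by
  filter_upwards [ae_mem_interior_cube d, ae_restrict_of_ae
    ((lipschitzWith_lipExt f).ae_differentiableAt (μ := (volume : Measure (Rd d))))] with x hx hd
  exact (zeroExt_eventuallyEq_lipExt f hx).differentiableAt_iff.2 hd

theorem abs_jac_le (π : Fin d → Lip (cube d)) {x : Rd d} (hx : x ∈ interior (cube d)) :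
    |jac π x| ≤ d.factorial * ∏ j, lipConst (π j) := by
  rw [jac_eq_jacobian_lipExt π hx]
  exact abs_jacobian_le (fun j => lipschitzWith_lipExt (π j)) x

theorem abs_zeroExt_le (f : Lip (cube d)) (x : Rd d) :
    |zeroExt (f : cube d → ℝ) x| ≤ lipNorm f := by
  by_cases hx : x ∈ cube d
  · rw [zeroExt_of_mem _ hx]; exact abs_le_lipNorm f _
  · have : zeroExt (f : cube d → ℝ) x = 0 :=
      Function.extend_apply' _ _ _ (by rintro ⟨⟨a, ha⟩, rfl⟩; exact hx ha)
    rw [this, abs_zero]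
    exact lipNorm_nonneg f

theorem zeroExt_add (f g : cube d → ℝ) : zeroExt (f + g) = zeroExt f + zeroExt g := by
  funext x
  by_cases hx : x ∈ cube d
  · simp [zeroExt_of_mem _ hx]
  · have : ¬∃ a : cube d, (a : Rd d) = x := by rintro ⟨⟨a, ha⟩, rfl⟩; exact hx ha
    simp [zeroExt, Function.extend_apply' _ _ _ this]

theorem zeroExt_smul (c : ℝ) (f : cube d → ℝ) : zeroExt (c • f) = c • zeroExt f := by
  funext x
  by_cases hx : x ∈ cube d
  · simp [zeroExt_of_mem _ hx]
  · have : ¬∃ a : cube d, (a : Rd d) = x := by rintro ⟨⟨a, ha⟩, rfl⟩; exact hx ha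
    simp [zeroExt, Function.extend_apply' _ _ _ this]

theorem zeroExt_update (π : Fin d → Lip (cube d)) (l : Fin d) (q : Lip (cube d)) :
    (fun j => zeroExt (Function.update π l q j : cube d → ℝ))
      = Function.update (fun j => zeroExt (π j : cube d → ℝ)) l (zeroExt (q : cube d → ℝ)) := by
  funext j
  by_cases hj : j = l
  · subst hj; simp
  · simp [hj]

theorem ae_jac_update_add (π : Fin d → Lip (cube d)) (l : Fin d) (p q : Lip (cube d)) :
    jac (Function.update π l (p + q)) =ᵐ[cubeMeasure d]
      jac (Function.update π l p) + jac (Function.update π l q) := by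
  filter_upwards [ae_mem_interior_cube d, ae_differentiableAt_zeroExt p,
    ae_differentiableAt_zeroExt q] with x hx hp hq
  rw [Pi.add_apply, jac_eq_jacobian _ hx, jac_eq_jacobian _ hx, jac_eq_jacobian _ hx,
    zeroExt_update, zeroExt_update, zeroExt_update, ← jacobian_update_add _ _ hp hq,
    ← zeroExt_add]
  rfl

theorem ae_jac_update_smul (π : Fin d → Lip (cube d)) (l : Fin d) (c : ℝ) (p : Lip (cube d)) :
    jac (Function.update π l (c • p)) =ᵐ[cubeMeasure d]
      c • jac (Function.update π l p) := by
  filter_upwards [ae_mem_interior_cube d] with x hx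
  rw [Pi.smul_apply, jac_eq_jacobian _ hx, jac_eq_jacobian _ hx, zeroExt_update, zeroExt_update,
    smul_eq_mul, ← jacobian_update_smul, ← zeroExt_smul]
  rfl

theorem jac_eq_zero_of_eventuallyEq_const (π : Fin d → Lip (cube d)) (l : Fin d) {c : ℝ}
    {x : Rd d} (hx : x ∈ interior (cube d))
    (h : ∀ᶠ y : cube d in 𝓝 ⟨x, interior_subset hx⟩, (π l : cube d → ℝ) y = c) :
    jac π x = 0 := by
  rw [jac_eq_jacobian π hx]
  refine Matrix.det_eq_zero_of_column_eq_zero l fun i => ?_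
  have h1 : zeroExt (π l : cube d → ℝ) =ᶠ[𝓝 x] fun _ => c := by
    have h2 : ∀ᶠ y in 𝓝[cube d] x, zeroExt (π l : cube d → ℝ) y = c := by
      rw [nhdsWithin_eq_map_subtype_coe (interior_subset hx), eventually_map]
      filter_upwards [h] with y hy
      rw [zeroExt_apply, hy]
    rwa [nhdsWithin_eq_nhds.2 (mem_interior_iff_mem_nhds.1 hx)] at h2
  rw [Matrix.of_apply, partialDeriv, h1.fderiv_eq]
  simp

end CubeExtension

/-! ### Weak-`*` continuity of Jacobian determinants on the cube -/

section WeakContinuity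

variable {d : ℕ}

theorem interior_cube_compl_nonempty (hd : 0 < d) : (interior (cube d))ᶜ.Nonempty := by
  refine ⟨EuclideanSpace.single ⟨0, hd⟩ 2, fun h => ?_⟩
  have := (interior_subset h ⟨0, hd⟩).2
  norm_num at this

/-- Lipschitz functions vanishing off the cube are dense in `L¹`. -/
theorem exists_lipschitz_integral_sub_le (hd : 0 < d) {w : Rd d → ℝ}
    (hw : Integrable w (cubeMeasure d)) {ε : ℝ} (hε : 0 < ε) :
    ∃ (g : Rd d → ℝ) (C : ℝ≥0), LipschitzWith C g ∧ (∀ x, x ∉ cube d → g x = 0) ∧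
      ∫ x in cube d, |w x - g x| ≤ ε := by
  obtain ⟨h, hc, hs, hle⟩ := (memLp_one_iff_integrable.2 hw).exist_eLpNorm_sub_le
    ENNReal.one_ne_top le_rfl (half_pos hε)
  obtain ⟨D, hD⟩ := hs.lipschitzWith_of_hasCompactSupport hc (by simp)
  have hhi : Integrable h (cubeMeasure d) :=
    hs.continuous.continuousOn.integrableOn_compact (isCompact_cube d)
  have h1 : ∫ x in cube d, |w x - h x| ≤ ε / 2 := by
    have h2 : ∫ x in cube d, ‖(w - h) x‖ = (eLpNorm (w - h) 1 (cubeMeasure d)).toReal := by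
      rw [eLpNorm_one_eq_lintegral_enorm, integral_norm_eq_lintegral_enorm
        (hw.sub hhi).aestronglyMeasurable]
    change ∫ x in cube d, ‖(w - h) x‖ ≤ ε / 2
    rw [h2]
    exact ENNReal.toReal_le_of_le_ofReal (half_pos hε).le hle
  set O := interior (cube d) with hO
  have hne : Oᶜ.Nonempty := interior_cube_compl_nonempty hd
  -- Lipschitz cutoffs that vanish off the interior and equal one as soon as the distance to its
  -- complement is at least `1 / k`.
  set θ : ℕ → Rd d → ℝ := fun k x => min 1 (k * Metric.infDist x Oᶜ) with hθ
  have hθL : ∀ k : ℕ, LipschitzWith (k : ℝ≥0) (θ k) := fun k => by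
    refine LipschitzWith.const_min (LipschitzWith.of_dist_le_mul fun x y => ?_) 1
    have := (Metric.lipschitz_infDist_pt Oᶜ).dist_le_mul x y
    rw [NNReal.coe_one, one_mul] at this
    rw [Real.dist_eq, ← mul_sub, abs_mul, Nat.abs_cast]
    exact mul_le_mul_of_nonneg_left this (Nat.cast_nonneg k)
  have hθ0 : ∀ k x, 0 ≤ θ k x := fun k x =>
    le_min zero_le_one (mul_nonneg (Nat.cast_nonneg _) Metric.infDist_nonneg)
  have hθ1 : ∀ k x, θ k x ≤ 1 := fun k x => min_le_left _ _
  have hlim : Tendsto (fun k => ∫ x in cube d, |h x - h x * θ k x|) atTop (𝓝 0) := by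
    rw [← integral_zero (Rd d) ℝ (μ := cubeMeasure d)]
    refine tendsto_integral_of_dominated_convergence (fun x => |h x|)
      (fun k => (hs.continuous.sub (hs.continuous.mul (hθL k).continuous)).abs.aestronglyMeasurable)
      hhi.abs (fun k => Eventually.of_forall fun x => ?_) ?_
    · rw [Real.norm_eq_abs, abs_abs]
      have : h x - h x * θ k x = h x * (1 - θ k x) := by ring
      rw [this, abs_mul]
      refine mul_le_of_le_one_right (abs_nonneg _) ?_
      rw [abs_le]
      constructor <;> linarith [hθ0 k x, hθ1 k x]
    · filter_upwards [ae_mem_interior_cube d] with x hx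
      have hpos : 0 < Metric.infDist x Oᶜ :=
        (isOpen_interior.isClosed_compl.notMem_iff_infDist_pos hne).1 (by simpa using hx)
      have hev : ∀ᶠ k : ℕ in atTop, θ k x = 1 := by
        filter_upwards [tendsto_natCast_atTop_atTop.eventually_ge_atTop
          (Metric.infDist x Oᶜ)⁻¹] with k hk
        refine min_eq_left ?_
        rwa [← inv_le_iff_one_le_mul₀ hpos]
      refine tendsto_const_nhds.congr' ?_
      filter_upwards [hev] with k hk
      simp [hk]
  obtain ⟨k, hk⟩ := (hlim.eventually (gt_mem_nhds (half_pos hε))).exists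
  obtain ⟨C, hC⟩ := exists_lipschitzWith_mul hD (hθL k) hc.isCompact
    fun x hx => image_eq_zero_of_notMem_tsupport hx
  refine ⟨fun x => h x * θ k x, C, hC, fun x hx => ?_, ?_⟩
  · have : x ∈ Oᶜ := fun hx' => hx (interior_subset hx')
    simp [hθ, Metric.infDist_zero_of_mem this]
  · have hgi : Integrable (fun x => h x * θ k x) (cubeMeasure d) :=
      hC.continuous.continuousOn.integrableOn_compact (isCompact_cube d)
    calc ∫ x in cube d, |w x - h x * θ k x|
        ≤ ∫ x in cube d, (|w x - h x| + |h x - h x * θ k x|) :=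
          integral_mono (hw.sub hgi).abs ((hw.sub hhi).abs.add (hhi.sub hgi).abs)
            fun x => abs_sub_le _ _ _
      _ = (∫ x in cube d, |w x - h x|) + ∫ x in cube d, |h x - h x * θ k x| :=
          integral_add (hw.sub hhi).abs (hhi.sub hgi).abs
      _ ≤ ε := by linarith

/-- A bound at one point, where the sequence converges, spreads over the cube by the common
Lipschitz constant. -/
theorem exists_bound_of_tendsto {K : ℝ≥0} {e : ℕ → Rd d → ℝ} (he : ∀ i, LipschitzWith K (e i))
    {l : Rd d → ℝ} (hlim : ∀ x ∈ cube d, Tendsto (fun i => e i x) atTop (𝓝 (l x))) :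
    ∃ A, ∀ i, ∀ x ∈ cube d, |e i x| ≤ A := by
  obtain ⟨x₀, hx₀⟩ : (cube d).Nonempty := Set.nonempty_coe_sort.1 inferInstance
  obtain ⟨A, hA⟩ := (hlim x₀ hx₀).abs.bddAbove_range
  refine ⟨A + K * Metric.diam (cube d), fun i x hx => ?_⟩
  have h1 : |e i x₀| ≤ A := hA ⟨i, rfl⟩
  have h2 := (he i).dist_le_mul x x₀
  have h3 := Metric.dist_le_diam_of_mem (isCompact_cube d).isBounded hx hx₀
  have h4 : |e i x| ≤ |e i x₀| + |e i x - e i x₀| := by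
    have := abs_add_le (e i x₀) (e i x - e i x₀)
    rwa [add_sub_cancel] at this
  rw [Real.dist_eq] at h2
  have h5 := mul_le_mul_of_nonneg_left h3 (NNReal.coe_nonneg K)
  linarith

/-- Weak-`*` continuity of Jacobian determinants on the cube. -/
theorem tendsto_integral_mul_jacobian (hd : 0 < d) {w : Rd d → ℝ}
    (hw : Integrable w (cubeMeasure d)) {K : ℝ≥0} {P : ℕ → Fin d → Rd d → ℝ}
    {P' : Fin d → Rd d → ℝ} (hP : ∀ i j, LipschitzWith K (P i j))
    (hP' : ∀ j, LipschitzWith K (P' j))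
    (hlim : ∀ j, ∀ x ∈ cube d, Tendsto (fun i => P i j x) atTop (𝓝 (P' j x))) :
    Tendsto (fun i => ∫ x in cube d, w x * jacobian (P i) x) atTop
      (𝓝 (∫ x in cube d, w x * jacobian P' x)) := by
  set B : ℝ := d.factorial * (K : ℝ) ^ d with hB
  have hB0 : 0 ≤ B := by positivity
  have hint : ∀ {w : Rd d → ℝ}, Integrable w (cubeMeasure d) → ∀ {Q : Fin d → Rd d → ℝ},
      (∀ j, LipschitzWith K (Q j)) → Integrable (fun x => w x * jacobian Q x) (cubeMeasure d) :=
    fun hw Q hQ => hw.mul_bdd (c := B) (measurable_jacobian Q).aestronglyMeasurable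
      (Eventually.of_forall fun x => abs_jacobian_le_pow hQ x)
  rw [Metric.tendsto_atTop]
  intro ε hε
  -- Replacing `w` by a Lipschitz `g` at `L¹` distance `δ` costs at most `δ B ≤ ε / 4`, once for
  -- each of the two Jacobians.
  set δ : ℝ := ε / (4 * (B + 1)) with hδ
  have hδ0 : 0 < δ := by positivity
  obtain ⟨g, C, hgL, hg0, hgw⟩ := exists_lipschitz_integral_sub_le hd hw hδ0
  have hgi : Integrable g (cubeMeasure d) :=
    hgL.continuous.continuousOn.integrableOn_compact (isCompact_cube d)
  have happ : ∀ {Q : Fin d → Rd d → ℝ}, (∀ j, LipschitzWith K (Q j)) →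
      |(∫ x in cube d, w x * jacobian Q x) - ∫ x in cube d, g x * jacobian Q x| ≤ ε / 4 := by
    intro Q hQ
    rw [← integral_sub (hint hw hQ) (hint hgi hQ), ← Real.norm_eq_abs]
    have h1 : ‖∫ x in cube d, (w x * jacobian Q x - g x * jacobian Q x)‖
        ≤ ∫ x in cube d, |w x - g x| * B := by
      refine norm_integral_le_of_norm_le ((hw.sub hgi).abs.mul_const B)
        (Eventually.of_forall fun x => ?_)
      rw [← sub_mul, norm_mul]
      exact mul_le_mul_of_nonneg_left (abs_jacobian_le_pow hQ x) (norm_nonneg _)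
    rw [integral_mul_const] at h1
    calc _ ≤ _ := h1
      _ ≤ δ * B := mul_le_mul_of_nonneg_right hgw hB0
      _ ≤ ε / 4 := by
        rw [hδ, div_mul_eq_mul_div, div_le_div_iff₀ (by positivity) (by norm_num)]
        nlinarith
  -- For a fixed Lipschitz weight vanishing off the cube, `L¹` convergence of the components
  -- suffices, here with the constants `c` equal to zero.
  have hlim0 : Tendsto (fun i => d.factorial * (C * (K : ℝ) ^ (d - 1)) *
      ∑ l, ∫ x in cube d, |P i l x - P' l x - (0 : ℝ)|) atTop (𝓝 0) := by
    rw [← mul_zero ((d.factorial : ℝ) * (C * (K : ℝ) ^ (d - 1)))]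
    refine Tendsto.const_mul _ ?_
    rw [← Finset.sum_const_zero (s := (Finset.univ : Finset (Fin d)))]
    refine tendsto_finsetSum _ fun l _ => ?_
    have heL : ∀ i, LipschitzWith (K + K) fun x => P i l x - P' l x := fun i =>
      (hP i l).sub (hP' l)
    have he0 : ∀ x ∈ cube d, Tendsto (fun i => P i l x - P' l x) atTop (𝓝 ((fun _ => 0) x)) := fun x hx => by
      simpa using (hlim l x hx).sub_const (P' l x)
    obtain ⟨A, hA⟩ := exists_bound_of_tendsto heL he0
    rw [← integral_zero (Rd d) ℝ (μ := cubeMeasure d)]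
    refine tendsto_integral_of_dominated_convergence (fun _ => A)
      (fun i => ?_) (integrable_const _) (fun i => ?_) ?_
    · simpa using (heL i).continuous.abs.aestronglyMeasurable
    · filter_upwards [ae_restrict_mem (isClosed_cube d).measurableSet] with x hx
      simpa using hA i x hx
    · filter_upwards [ae_restrict_mem (isClosed_cube d).measurableSet] with x hx
      simpa using (he0 x hx).abs
  obtain ⟨N, hN⟩ := eventually_atTop.1 (hlim0.eventually (gt_mem_nhds (half_pos hε)))
  refine ⟨N, fun i hi => ?_⟩
  have h1 := abs_integral_mul_jacobian_sub_le hgL (isCompact_cube d) hg0 hP' (hP i) fun _ => 0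
  have h2 : ∫ x, g x * (jacobian (P i) x - jacobian P' x)
      = (∫ x in cube d, g x * jacobian (P i) x) - ∫ x in cube d, g x * jacobian P' x := by
    rw [← integral_sub (hint hgi (hP i)) (hint hgi hP'),
      ← setIntegral_eq_integral_of_forall_compl_eq_zero (s := cube d)
        fun x hx => by rw [hg0 x hx, zero_mul]]
    simp only [mul_sub]
  rw [h2] at h1
  have h3 := hN i hi
  have h4 := happ (hP i)
  have h5 := happ hP'
  rw [Real.dist_eq]
  rw [abs_le] at h1 h4 h5
  rw [abs_lt]
  constructor <;> linarith [h1.1, h1.2, h4.1, h4.2, h5.1, h5.2]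

end WeakContinuity

end MetricCurrents

end

noncomputable section

namespace MetricCurrents

/-! ### Metric currents on the cube given by `L¹` densities -/

section CubeCurrents

variable {d : ℕ}

theorem integrable_mul_jac {w : Rd d → ℝ} (hw : Integrable w (cubeMeasure d)) (f : Lip (cube d))
    (π : Fin d → Lip (cube d)) :
    Integrable (fun x => w x * (zeroExt (f : cube d → ℝ) x * jac π x)) (cubeMeasure d) :=
  (memLp_one_iff_integrable.2 hw).integrable_mul (memLp_jac f π)

theorem integrable_mul_zeroExt {w : Rd d → ℝ} (hw : Integrable w (cubeMeasure d))
    (f : Lip (cube d)) :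
    Integrable (fun x => w x * zeroExt (f : cube d → ℝ) x) (cubeMeasure d) := by
  have h : (fun x => w x * lipExt f x) =ᵐ[cubeMeasure d]
      fun x => w x * zeroExt (f : cube d → ℝ) x := by
    filter_upwards [ae_restrict_mem (isClosed_cube d).measurableSet] with x hx
    rw [zeroExt_eq_lipExt f hx]
  refine (hw.mul_bdd (c := lipNorm f)
    (lipschitzWith_lipExt f).continuous.aestronglyMeasurable ?_).congr h
  filter_upwards [ae_restrict_mem (isClosed_cube d).measurableSet] with x hx
  rw [← zeroExt_eq_lipExt f hx]
  exact abs_zeroExt_le f x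

theorem lipConstNN_le {X : Type*} [MetricSpace X] {f : Lip X} {K : ℝ≥0}
    (h : LipschitzWith K (f : X → ℝ)) : lipConstNN f ≤ K := lipConst_le h

theorem tendsto_lipExt {F : ℕ → Lip (cube d)} {f : Lip (cube d)}
    (h : ∀ x, Tendsto (fun i => (F i : cube d → ℝ) x) atTop (𝓝 ((f : cube d → ℝ) x))) :
    ∀ x ∈ cube d, Tendsto (fun i => lipExt (F i) x) atTop (𝓝 (lipExt f x)) := by
  intro x hx
  simpa only [← zeroExt_eq_lipExt _ hx, zeroExt_of_mem _ hx] using h ⟨x, hx⟩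

/-- Joint continuity of `(f, π) ↦ ∫_Q w f det Dπ`. -/
theorem tendsto_integral_mul_jac (hd : 0 < d) {w : Rd d → ℝ} (hw : Integrable w (cubeMeasure d))
    {F : ℕ → Lip (cube d)} {f : Lip (cube d)} {P : ℕ → Fin d → Lip (cube d)}
    {π : Fin d → Lip (cube d)}
    (hF : ∀ x, Tendsto (fun i => (F i : cube d → ℝ) x) atTop (𝓝 ((f : cube d → ℝ) x)))
    (hP : ∀ j x, Tendsto (fun i => (P i j : cube d → ℝ) x) atTop (𝓝 ((π j : cube d → ℝ) x)))
    (hL : ∃ L : ℝ≥0, ∀ i, LipschitzWith L (F i : cube d → ℝ) ∧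
      ∀ j, LipschitzWith L (P i j : cube d → ℝ)) :
    Tendsto (fun i => ∫ x in cube d, w x * (zeroExt (F i : cube d → ℝ) x * jac (P i) x)) atTop
      (𝓝 (∫ x in cube d, w x * (zeroExt (f : cube d → ℝ) x * jac π x))) := by
  obtain ⟨L, hL⟩ := hL
  set K : ℝ≥0 := L + ∑ j, lipConstNN (π j) + lipConstNN f with hK
  have hFL : ∀ i, LipschitzWith K (lipExt (F i)) := fun i =>
    (lipschitzWith_lipExt (F i)).weaken ((lipConstNN_le (hL i).1).trans (by
      rw [hK, add_assoc]; exact le_self_add))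
  have hfL : LipschitzWith K (lipExt f) := (lipschitzWith_lipExt f).weaken le_add_self
  have hPL : ∀ i j, LipschitzWith K (lipExt (P i j)) := fun i j =>
    (lipschitzWith_lipExt (P i j)).weaken ((lipConstNN_le ((hL i).2 j)).trans (by
      rw [hK, add_assoc]; exact le_self_add))
  have hπL : ∀ j, LipschitzWith K (lipExt (π j)) := fun j =>
    (lipschitzWith_lipExt (π j)).weaken (by
      have := Finset.single_le_sum (f := fun j => lipConstNN (π j)) (fun _ _ => zero_le)
        (Finset.mem_univ j)
      exact this.trans (le_add_self.trans le_self_add))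
  have hwf := integrable_mul_zeroExt hw f
  have hE : ∀ (g : Lip (cube d)) (ρ : Fin d → Lip (cube d)),
      ∫ x in cube d, w x * (zeroExt (g : cube d → ℝ) x * jac ρ x)
        = ∫ x in cube d, w x * (lipExt g x * jacobian (fun j => lipExt (ρ j)) x) := by
    intro g ρ
    refine integral_congr_ae ?_
    filter_upwards [ae_mem_interior_cube d] with x hx
    rw [zeroExt_eq_lipExt g (interior_subset hx), jac_eq_jacobian_lipExt ρ hx]
  have hEi : ∀ (g : Lip (cube d)) (ρ : Fin d → Lip (cube d)), Integrable
      (fun x => w x * (lipExt g x * jacobian (fun j => lipExt (ρ j)) x)) (cubeMeasure d) := by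
    intro g ρ
    refine (integrable_mul_jac hw g ρ).congr ?_
    filter_upwards [ae_mem_interior_cube d] with x hx
    rw [zeroExt_eq_lipExt g (interior_subset hx), jac_eq_jacobian_lipExt ρ hx]
  simp only [hE]
  -- Split `F i = f + (F i - f)`. The first part is weak-`*` convergence of Jacobians against the
  -- fixed density `w f`; the second tends to zero by dominated convergence, the Jacobians being
  -- uniformly bounded.
  have hconv := tendsto_integral_mul_jacobian hd (w := fun x => w x * lipExt f x)
    (hwf.congr (by
      filter_upwards [ae_mem_interior_cube d] with x hx
      rw [zeroExt_eq_lipExt f (interior_subset hx)])) hPL hπL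
    fun j => tendsto_lipExt (hP j)
  have he0 : ∀ x ∈ cube d, Tendsto (fun i => lipExt (F i) x - lipExt f x) atTop
      (𝓝 ((fun _ => 0) x)) := fun x hx => by
    simpa using (tendsto_lipExt hF x hx).sub_const (lipExt f x)
  obtain ⟨A, hA⟩ := exists_bound_of_tendsto (fun i => (hFL i).sub hfL) he0
  have herr : Tendsto (fun i => ∫ x in cube d,
      w x * ((lipExt (F i) x - lipExt f x) * jacobian (fun j => lipExt (P i j)) x)) atTop
      (𝓝 0) := by
    rw [← integral_zero (Rd d) ℝ (μ := cubeMeasure d)]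
    refine tendsto_integral_of_dominated_convergence
      (fun x => |w x| * (A * (d.factorial * (K : ℝ) ^ d)))
      (fun i => hw.aestronglyMeasurable.mul
        ((((hFL i).sub hfL).continuous.measurable.mul
          (measurable_jacobian _)).aestronglyMeasurable))
      (hw.abs.mul_const _) (fun i => ?_) ?_
    · filter_upwards [ae_restrict_mem (isClosed_cube d).measurableSet] with x hx
      rw [norm_mul, norm_mul]
      exact mul_le_mul_of_nonneg_left (mul_le_mul (hA i x hx) (abs_jacobian_le_pow (hPL i) x)
        (abs_nonneg _) ((abs_nonneg _).trans (hA i x hx))) (norm_nonneg _)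
    · filter_upwards [ae_restrict_mem (isClosed_cube d).measurableSet] with x hx
      rw [← mul_zero (w x)]
      refine Tendsto.const_mul _ ?_
      refine squeeze_zero_norm (a := fun i => |lipExt (F i) x - lipExt f x| *
        (d.factorial * (K : ℝ) ^ d)) (fun i => ?_) ?_
      · rw [norm_mul]
        exact mul_le_mul_of_nonneg_left (abs_jacobian_le_pow (hPL i) x) (norm_nonneg _)
      · simpa using (he0 x hx).abs.mul_const ((d.factorial : ℝ) * (K : ℝ) ^ d)
  have hsum := herr.add hconv
  rw [zero_add] at hsum
  have hgoal : ∀ i, (∫ x in cube d,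
      w x * ((lipExt (F i) x - lipExt f x) * jacobian (fun j => lipExt (P i j)) x))
      + ∫ x in cube d, w x * lipExt f x * jacobian (fun j => lipExt (P i j)) x
      = ∫ x in cube d, w x * (lipExt (F i) x * jacobian (fun j => lipExt (P i j)) x) := by
    intro i
    rw [← integral_add]
    · congr 1; funext x; ring
    · have := (hEi (F i) (P i)).sub (hEi f (P i))
      refine this.congr (Eventually.of_forall fun x => ?_)
      simp only [Pi.sub_apply]
      ring
    · refine (hEi f (P i)).congr (Eventually.of_forall fun x => ?_)
      simp only
      ring
  simp only [hgoal] at hsum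
  simpa only [mul_assoc] using hsum

/-- The metric current `(f, π) ↦ ∫_Q w f det Dπ` defined by an integrable function `w`. -/
def cubeCurrent (hd : 0 < d) (w : Rd d → ℝ) (hw : Integrable w (cubeMeasure d)) :
    MetricCurrent (cube d) d where
  toMap :=
    { toFun := fun f =>
        { toFun := fun π => ∫ x in cube d, w x * (zeroExt (f : cube d → ℝ) x * jac π x)
          map_update_add' := by
            intro inst π l p q
            obtain rfl := Subsingleton.elim inst (instDecidableEqFin d)
            rw [← integral_add (integrable_mul_jac hw ⟨f, f.2.1⟩ _)
              (integrable_mul_jac hw ⟨f, f.2.1⟩ _)]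
            refine integral_congr_ae ?_
            filter_upwards [ae_jac_update_add π l p q] with x hx
            rw [hx, Pi.add_apply]
            ring
          map_update_smul' := by
            intro inst π l c p
            obtain rfl := Subsingleton.elim inst (instDecidableEqFin d)
            rw [smul_eq_mul, ← integral_const_mul]
            refine integral_congr_ae ?_
            filter_upwards [ae_jac_update_smul π l c p] with x hx
            rw [hx, Pi.smul_apply, smul_eq_mul]
            ring }
      map_add' := fun f g => by
        ext π
        change ∫ x in cube d, w x * (zeroExt ((f : cube d → ℝ) + (g : cube d → ℝ)) x * jac π x) =
          (∫ x in cube d, w x * (zeroExt (f : cube d → ℝ) x * jac π x))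
          + ∫ x in cube d, w x * (zeroExt (g : cube d → ℝ) x * jac π x)
        rw [← integral_add (integrable_mul_jac hw ⟨f, f.2.1⟩ _)
          (integrable_mul_jac hw ⟨g, g.2.1⟩ _)]
        congr 1
        funext x
        rw [zeroExt_add, Pi.add_apply]
        ring
      map_smul' := fun c f => by
        ext π
        change ∫ x in cube d, w x * (zeroExt (c • (f : cube d → ℝ)) x * jac π x) =
          c * ∫ x in cube d, w x * (zeroExt (f : cube d → ℝ) x * jac π x)
        rw [← integral_const_mul]
        congr 1
        funext x
        rw [zeroExt_smul, Pi.smul_apply, smul_eq_mul]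
        ring }
  locality := by
    rintro f π l ⟨c, U, hU, hc⟩
    change ∫ x in cube d, w x * (zeroExt (f : cube d → ℝ) x * jac π x) = 0
    refine integral_eq_zero_of_ae ?_
    filter_upwards [ae_mem_interior_cube d] with x hx
    -- On the support of `f` the component `π l` is locally constant and the Jacobian vanishes; off
    -- it `f` vanishes.
    by_cases hxf : (⟨x, interior_subset hx⟩ : cube d) ∈ tsupport (f : cube d → ℝ)
    · have h1 : U ∈ 𝓝 (⟨x, interior_subset hx⟩ : cube d) := mem_nhdsSet_iff_forall.1 hU _ hxf
      rw [jac_eq_zero_of_eventuallyEq_const π l hx (by filter_upwards [h1] with y hy using hc y hy)]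
      simp
    · rw [zeroExt_of_mem _ (interior_subset hx), image_eq_zero_of_notMem_tsupport hxf]
      simp
  continuity := by
    rintro F f P π hF hP ⟨L, hL⟩ -
    exact tendsto_integral_mul_jac hd hw (F := fun i => ⟨F i, (F i).2.1⟩) (f := ⟨f, f.2.1⟩)
      hF hP ⟨L, hL⟩

theorem cubeCurrent_apply (hd : 0 < d) {w : Rd d → ℝ} (hw : Integrable w (cubeMeasure d))
    (f : Lipc (cube d)) (π : Fin d → Lip (cube d)) : (cubeCurrent hd w hw).toMap f π
      = ∫ x in cube d, w x * (zeroExt (f : cube d → ℝ) x * jac π x) := rfl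

end CubeCurrents

/-! ### Summable series of metric currents -/

section CurrentOperations

/-- The underlying Lipschitz function of a compactly supported one. -/
def Lipc.toLip {X : Type*} [MetricSpace X] (f : Lipc X) : Lip X := ⟨f, f.2.1⟩

variable {X : Type*} [MetricSpace X] [CompactSpace X] {k : ℕ}

theorem lipNorm_le_of_tendsto [Nonempty X] {F : ℕ → Lip X} {f : Lip X} {L : ℝ≥0}
    (hF : ∀ x, Tendsto (fun i => (F i : X → ℝ) x) atTop (𝓝 ((f : X → ℝ) x)))
    (hL : ∀ i, LipschitzWith L (F i : X → ℝ)) : ∃ A, ∀ i, lipNorm (F i) ≤ A := by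
  obtain ⟨x₀⟩ := ‹Nonempty X›
  obtain ⟨A, hA⟩ := (hF x₀).abs.bddAbove_range
  refine ⟨max (A + L * Metric.diam (univ : Set X)) L, fun i => max_le_max ?_ (lipConst_le (hL i))⟩
  refine ciSup_le fun x => ?_
  have h1 : |(F i : X → ℝ) x₀| ≤ A := hA ⟨i, rfl⟩
  have h2 := (hL i).dist_le_mul x x₀
  have h3 := Metric.dist_le_diam_of_mem (isCompact_univ (X := X)).isBounded
    (mem_univ x) (mem_univ x₀)
  have h4 : |(F i : X → ℝ) x| ≤ |(F i : X → ℝ) x₀| + |(F i : X → ℝ) x - (F i : X → ℝ) x₀| := by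
    have := abs_add_le ((F i : X → ℝ) x₀) ((F i : X → ℝ) x - (F i : X → ℝ) x₀)
    rwa [add_sub_cancel] at this
  rw [Real.dist_eq] at h2
  have h5 := mul_le_mul_of_nonneg_left h3 (NNReal.coe_nonneg L)
  linarith

/-- A sum of metric currents on a compact space whose norms are summable. -/
def tsumCurrent [Nonempty X] (T : ℕ → MetricCurrent X k) (c : ℕ → ℝ) (hc : Summable c)
    (hT : ∀ n (f : Lip X) (π : Fin k → Lip X),
      |(T n).toMap (Lip.toLipc f) π| ≤ c n * (lipNorm f * ∏ j, lipConst (π j))) :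
    MetricCurrent X k where
  toMap :=
    { toFun := fun f =>
        { toFun := fun π => ∑' n, (T n).toMap f π
          map_update_add' := by
            intro inst π l p q
            have hs : ∀ π, Summable fun n => (T n).toMap f π := fun π =>
              Summable.of_norm_bounded (hc.mul_right _) fun n => hT n (Lipc.toLip f) π
            simp only [MultilinearMap.map_update_add]
            exact (hs _).tsum_add (hs _)
          map_update_smul' := by
            intro inst π l r p
            simp only [MultilinearMap.map_update_smul, smul_eq_mul, tsum_mul_left] }
      map_add' := fun f g => by
        ext π
        have hs : ∀ f : Lipc X, Summable fun n => (T n).toMap f π := fun f =>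
          Summable.of_norm_bounded (hc.mul_right _) fun n => hT n (Lipc.toLip f) π
        change ∑' n, (T n).toMap (f + g) π = (∑' n, (T n).toMap f π) + ∑' n, (T n).toMap g π
        simp only [map_add, add_apply]
        exact (hs _).tsum_add (hs _)
      map_smul' := fun r f => by
        ext π
        change ∑' n, (T n).toMap (r • f) π = r * ∑' n, (T n).toMap f π
        simp only [map_smul, smul_apply, smul_eq_mul, tsum_mul_left] }
  locality := fun f π l h => by
    change ∑' n, (T n).toMap f π = 0
    simp only [fun n => (T n).locality f π l h, tsum_zero]
  continuity := by
    intro F f P π hF hP hL hK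
    obtain ⟨L, hL'⟩ := hL
    obtain ⟨A, hA⟩ := lipNorm_le_of_tendsto (F := fun i => Lipc.toLip (F i)) (f := Lipc.toLip f)
      hF fun i => (hL' i).1
    have hc0 : ∀ n, 0 ≤ |c n| := fun n => abs_nonneg _
    -- The uniform Lipschitz and norm bounds along the sequence give a majorant summable in `n`;
    -- absolute values enter because `c` is not assumed nonnegative.
    refine tendsto_tsum_of_dominated_convergence (bound := fun n => |c n| * (A * ∏ _j : Fin k, (L : ℝ)))
      (hc.abs.mul_right _) (fun n => (T n).continuity F f P π hF hP ⟨L, hL'⟩ hK) ?_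
    refine Eventually.of_forall fun i n => ?_
    refine (hT n (Lipc.toLip (F i)) (P i)).trans ?_
    have h1 : lipNorm (Lipc.toLip (F i)) * ∏ j, lipConst (P i j) ≤ A * ∏ _j : Fin k, (L : ℝ) :=
      mul_le_mul (hA i) (Finset.prod_le_prod (fun _ _ => lipConst_nonneg _)
        fun j _ => lipConst_le ((hL' i).2 j)) (Finset.prod_nonneg fun _ _ => lipConst_nonneg _)
        ((lipNorm_nonneg _).trans (hA i))
    have h2 : 0 ≤ lipNorm (Lipc.toLip (F i)) * ∏ j, lipConst (P i j) :=
      mul_nonneg (lipNorm_nonneg _) (Finset.prod_nonneg fun _ _ => lipConst_nonneg _)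
    exact (mul_le_mul_of_nonneg_right (le_abs_self _) h2).trans
      (mul_le_mul_of_nonneg_left h1 (hc0 n))

theorem tsumCurrent_apply [Nonempty X] (T : ℕ → MetricCurrent X k) {c : ℕ → ℝ} (hc : Summable c)
    (hT : ∀ n (f : Lip X) (π : Fin k → Lip X),
      |(T n).toMap (Lip.toLipc f) π| ≤ c n * (lipNorm f * ∏ j, lipConst (π j)))
    (f : Lipc X) (π : Fin k → Lip X) :
    (tsumCurrent T c hc hT).toMap f π = ∑' n, (T n).toMap f π := rfl

end CurrentOperations

/-! ### Push-forward from the cube to `ℝ^d` -/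

section Pushforward

variable {d k : ℕ}

/-- Restriction of Lipschitz functions to the cube. -/
def restrictLip (d : ℕ) : Lip (Rd d) →ₗ[ℝ] Lip (cube d) where
  toFun f := ⟨fun x => (f : Rd d → ℝ) x, by
    obtain ⟨K, hK⟩ := f.2
    exact ⟨K, LipschitzWith.of_dist_le_mul fun x y => hK.dist_le_mul x y⟩⟩
  map_add' _ _ := rfl
  map_smul' _ _ := rfl

/-- Restriction of compactly supported Lipschitz functions to the cube. -/
def restrictLipc (d : ℕ) : Lipc (Rd d) →ₗ[ℝ] Lipc (cube d) where
  toFun f := Lip.toLipc (restrictLip d (Lipc.toLip f))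
  map_add' _ _ := rfl
  map_smul' _ _ := rfl

theorem tsupport_restrictLipc_subset (f : Lipc (Rd d)) :
    tsupport (restrictLipc d f : cube d → ℝ) ⊆ Subtype.val ⁻¹' tsupport (f : Rd d → ℝ) := by
  refine closure_minimal (fun x hx => subset_closure ?_)
    ((isClosed_tsupport _).preimage continuous_subtype_val)
  exact hx

/-- The push-forward of a metric current under the inclusion of the cube. -/
def pushCube (T : MetricCurrent (cube d) k) : MetricCurrent (Rd d) k where
  toMap :=
    { toFun := fun f => (T.toMap (restrictLipc d f)).compLinearMap fun _ => restrictLip d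
      map_add' := fun f g => by
        ext π
        simp
      map_smul' := fun c f => by
        ext π
        simp }
  locality := by
    rintro f π l ⟨c, U, hU, hc⟩
    refine T.locality _ _ l ⟨c, Subtype.val ⁻¹' U, ?_, fun x hx => hc x hx⟩
    rw [mem_nhdsSet_iff_forall] at hU ⊢
    intro x hx
    exact continuous_subtype_val.continuousAt.preimage_mem_nhds
      (hU x (tsupport_restrictLipc_subset f hx))
  continuity := by
    rintro F f P π hF hP ⟨L, hL⟩ -
    refine T.continuity _ _ _ _ (fun x => hF x) (fun j x => hP j x) ⟨L, fun i => ⟨?_, fun j => ?_⟩⟩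
      ⟨univ, isCompact_univ, subset_univ _, fun _ => subset_univ _⟩
    · exact LipschitzWith.of_dist_le_mul fun x y => (hL i).1.dist_le_mul x y
    · exact LipschitzWith.of_dist_le_mul fun x y => ((hL i).2 j).dist_le_mul x y

theorem pushCube_apply (T : MetricCurrent (cube d) k) (f : Lipc (Rd d)) (π : Fin k → Lip (Rd d)) :
    (pushCube T).toMap f π = T.toMap (restrictLipc d f) fun j => restrictLip d (π j) := rfl

theorem supportedIn_pushCube (T : MetricCurrent (cube d) k) :
    (pushCube T).SupportedIn (cube d) := by
  intro f π h
  have : restrictLipc d f = 0 := by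
    ext x
    exact h x x.2
  rw [pushCube_apply, this, map_zero, zero_apply]

end Pushforward

end MetricCurrents

end

noncomputable section

namespace MetricCurrents

/-! ### Sums of rescaled lattice copies of a function -/

section LatticeCopies

variable {d : ℕ}

/-- Only some dimensional constant is needed, so `d` is used in place of its square root. -/
theorem norm_le_of_forall_abs_le {x : Rd d} {c : ℝ} (h : ∀ i, |x i| ≤ c) : ‖x‖ ≤ d * c := by
  rcases Nat.eq_zero_or_pos d with rfl | hd
  · simp [Subsingleton.elim x 0]
  have hc : 0 ≤ c := (abs_nonneg _).trans (h ⟨0, hd⟩)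
  rw [EuclideanSpace.norm_eq, Real.sqrt_le_left (by positivity)]
  have h1 : ∑ i, ‖x i‖ ^ 2 ≤ ∑ _i : Fin d, c ^ 2 :=
    Finset.sum_le_sum fun i _ => pow_le_pow_left₀ (norm_nonneg _) (h i) 2
  rw [Finset.sum_const, Finset.card_univ, Fintype.card_fin, nsmul_eq_mul] at h1
  have h2 : (1 : ℝ) ≤ d := by exact_mod_cast hd
  nlinarith [mul_nonneg (sub_nonneg.2 h2) (sq_nonneg c), sq_nonneg c]

theorem volume_real_cube (d : ℕ) : (volume : Measure (Rd d)).real (cube d) = 1 := by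
  have h2 : cube d = WithLp.ofLp ⁻¹' (Icc (0 : Fin d → ℝ) 1) := by
    ext x
    simp [cube, Pi.le_def, forall_and]
  rw [measureReal_def, h2, (PiLp.volume_preserving_ofLp (Fin d)).measure_preimage
    measurableSet_Icc.nullMeasurableSet, Real.volume_Icc_pi]
  simp

/-- The open unit cube. -/
def openCube (d : ℕ) : Set (Rd d) := {x | ∀ i, x i ∈ Ioo (0 : ℝ) 1}

theorem openCube_subset_cube (d : ℕ) : openCube d ⊆ cube d := fun _ hx i =>
  Ioo_subset_Icc_self (hx i)

theorem isOpen_openCube (d : ℕ) : IsOpen (openCube d) := by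
  have : openCube d = ⋂ i, {x : Rd d | x i ∈ Ioo (0 : ℝ) 1} := by
    ext x; simp [openCube]
  rw [this]
  exact isOpen_iInter_of_finite fun i => isOpen_Ioo.preimage (by fun_prop)

/-- Points with natural coordinates. -/
def latticePoint (k : Fin d → ℕ) : Rd d := WithLp.toLp 2 fun i => (k i : ℝ)

theorem latticePoint_apply (k : Fin d → ℕ) (i : Fin d) : latticePoint k i = k i := rfl

/-- Lattice translates of the open unit cube are disjoint. Hence at every point at most one copy in
a lattice sum is nonzero, and masses of copies add up whatever their signs. -/
theorem eq_of_mem_openCube {c : ℝ} {x : Rd d} {k k' : Fin d → ℕ}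
    (h : c • x - latticePoint k ∈ openCube d) (h' : c • x - latticePoint k' ∈ openCube d) :
    k = k' := by
  funext i
  have h1 := h i
  have h2 := h' i
  simp only [PiLp.sub_apply, latticePoint_apply, mem_Ioo] at h1 h2
  have h3 : (k i : ℝ) < k' i + 1 := by linarith
  have h4 : (k' i : ℝ) < k i + 1 := by linarith
  have h5 : k i < k' i + 1 := by exact_mod_cast h3
  have h6 : k' i < k i + 1 := by exact_mod_cast h4
  omega

theorem mem_openCube_of_smul_sub {c : ℝ} (hc : 0 < c) {x : Rd d} {k : Fin d → ℕ}
    (hk : ∀ i, (k i : ℝ) + 1 ≤ c) (h : c • x - latticePoint k ∈ openCube d) : x ∈ openCube d := by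
  intro i
  have h1 := h i
  simp only [PiLp.sub_apply, latticePoint_apply, mem_Ioo, PiLp.smul_apply, smul_eq_mul] at h1
  have h0 : (0 : ℝ) ≤ k i := Nat.cast_nonneg _
  constructor
  · by_contra hcon
    nlinarith
  · by_contra hcon
    nlinarith [hk i]

theorem volume_real_smul_sub_preimage {c : ℝ} (hc : 0 < c) (w : Rd d) (s : Set (Rd d)) :
    (volume : Measure (Rd d)).real {x | c • x - w ∈ s}
      = (c ^ d)⁻¹ * (volume : Measure (Rd d)).real s := by
  have h1 : {x : Rd d | c • x - w ∈ s} = (fun x => c • x) ⁻¹' ((fun y => y + -w) ⁻¹' s) := by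
    ext x; simp [sub_eq_add_neg]
  rw [h1, measureReal_def, Measure.addHaar_preimage_smul _ hc.ne', measure_preimage_add_right,
    ENNReal.toReal_mul, ENNReal.toReal_ofReal (abs_nonneg _), measureReal_def]
  simp [abs_of_pos hc]

/-- A signed sum of rescaled lattice translates of `φ`. -/
def latticeSum {ι : Type*} (I : Finset ι) (k : ι → Fin d → ℕ) (ε : ι → ℝ) (c : ℝ)
    (φ : Rd d → ℝ) (x : Rd d) : ℝ := ∑ i ∈ I, ε i * φ (c • x - latticePoint (k i))

variable {ι : Type*} {I : Finset ι} {k : ι → Fin d → ℕ} {ε : ι → ℝ} {c : ℝ} {φ : Rd d → ℝ}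

theorem lipschitzWith_comp_smul_sub (hc : 0 ≤ c) {C : ℝ≥0} (hφ : LipschitzWith C φ)
    (w : Rd d) : LipschitzWith (C * c.toNNReal) fun x => φ (c • x - w) := by
  refine LipschitzWith.of_dist_le_mul fun x y => ?_
  refine (hφ.dist_le_mul _ _).trans ?_
  rw [dist_sub_right, dist_smul₀, Real.norm_of_nonneg hc, NNReal.coe_mul, Real.coe_toNNReal c hc, mul_assoc]

theorem exists_lipschitzWith_latticeSum (hc : 0 ≤ c) (hφ : ∃ C, LipschitzWith C φ) :
    ∃ C, LipschitzWith C (latticeSum I k ε c φ) := by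
  classical
  obtain ⟨C, hC⟩ := hφ
  unfold latticeSum
  induction I using Finset.induction_on with
  | empty => exact ⟨0, LipschitzWith.const 0⟩
  | insert i s hi ih =>
    obtain ⟨D, hD⟩ := ih
    simp only [Finset.sum_insert hi]
    exact ⟨_, ((lipschitzWith_smul (ε i)).comp
      (lipschitzWith_comp_smul_sub hc hC _)).add hD⟩

theorem exists_mem_of_latticeSum_ne_zero (hφ : ∀ x, φ x ≠ 0 → x ∈ openCube d) {x : Rd d}
    (hx : latticeSum I k ε c φ x ≠ 0) :
    ∃ i ∈ I, φ (c • x - latticePoint (k i)) ≠ 0 ∧ c • x - latticePoint (k i) ∈ openCube d := by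
  obtain ⟨i, hi, h⟩ := Finset.exists_ne_zero_of_sum_ne_zero hx
  have := right_ne_zero_of_mul h
  exact ⟨i, hi, this, hφ _ this⟩

theorem mem_openCube_of_latticeSum_ne_zero (hφ : ∀ x, φ x ≠ 0 → x ∈ openCube d) (hc : 0 < c)
    (hk : ∀ i ∈ I, ∀ j, (k i j : ℝ) + 1 ≤ c) {x : Rd d}
    (hx : latticeSum I k ε c φ x ≠ 0) : x ∈ openCube d := by
  obtain ⟨i, hi, -, h⟩ := exists_mem_of_latticeSum_ne_zero hφ hx
  exact mem_openCube_of_smul_sub hc (hk i hi) h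

theorem abs_latticeSum (hφ : ∀ x, φ x ≠ 0 → x ∈ openCube d) (hk : Set.InjOn k I)
    (hε : ∀ i, |ε i| = 1) (x : Rd d) :
    |latticeSum I k ε c φ x| = latticeSum I k (fun _ => 1) c (fun y => |φ y|) x := by
  unfold latticeSum
  simp only [one_mul]
  by_cases h : ∃ i ∈ I, φ (c • x - latticePoint (k i)) ≠ 0
  · obtain ⟨i, hi, hne⟩ := h
    have hz : ∀ j ∈ I, j ≠ i → φ (c • x - latticePoint (k j)) = 0 := by
      intro j hj hji
      by_contra hcon
      exact hji (hk hj hi (eq_of_mem_openCube (hφ _ hcon) (hφ _ hne)))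
    rw [Finset.sum_eq_single_of_mem i hi fun j hj hji => by rw [hz j hj hji, mul_zero],
      Finset.sum_eq_single_of_mem i hi fun j hj hji => by rw [hz j hj hji, abs_zero],
      abs_mul, hε, one_mul]
  · push Not at h
    rw [Finset.sum_eq_zero fun i hi => by rw [h i hi, mul_zero],
      Finset.sum_eq_zero fun i hi => by rw [h i hi, abs_zero], abs_zero]

theorem abs_latticeSum_le_one (hφ : ∀ x, φ x ≠ 0 → x ∈ openCube d) (hk : Set.InjOn k I)
    (hε : ∀ i, |ε i| = 1) (h1 : ∀ x, |φ x| ≤ 1) (x : Rd d) :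
    |latticeSum I k ε c φ x| ≤ 1 := by
  by_cases h : latticeSum I k ε c φ x = 0
  · rw [h, abs_zero]; exact zero_le_one
  obtain ⟨i, hi, hne, hmem⟩ := exists_mem_of_latticeSum_ne_zero hφ h
  unfold latticeSum
  rw [Finset.sum_eq_single_of_mem i hi fun j hj hji => ?_, abs_mul, hε, one_mul]
  · exact h1 _
  · have : φ (c • x - latticePoint (k j)) = 0 := by
      by_contra hcon
      exact hji (hk hj hi (eq_of_mem_openCube (hφ _ hcon) hmem))
    rw [this, mul_zero]

theorem integrable_of_lipschitz_of_ne_zero (hL : ∃ C, LipschitzWith C φ)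
    (hφ : ∀ x, φ x ≠ 0 → x ∈ openCube d) : Integrable φ := by
  obtain ⟨C, hC⟩ := hL
  refine hC.continuous.integrable_of_hasCompactSupport
    (HasCompactSupport.intro (isCompact_cube d) fun x hx => ?_)
  by_contra hcon
  exact hx (openCube_subset_cube d (hφ x hcon))

theorem integral_latticeSum (hc : 0 < c) (hφ : Integrable φ) :
    ∫ x, latticeSum I k ε c φ x = (∑ i ∈ I, ε i) * ((c ^ d)⁻¹ * ∫ y, φ y) := by
  unfold latticeSum
  rw [integral_finsetSum, Finset.sum_mul]
  · simp only [integral_const_mul, integral_comp_smul_sub hc]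
  · intro i _
    exact (((integrable_comp_smul_iff volume (fun y => φ (y - latticePoint (k i))) hc.ne').2
      (hφ.comp_sub_right _))).const_mul _

/-- A change of variables on each small cube turns the copy of `φ` paired with `P` into `φ` itself
paired with a rescaled `P` of the same Lipschitz constant. This self-similarity drives the induction
over scales. -/
theorem integral_latticeSum_mul (hc : 0 < c) (hL : ∃ C, LipschitzWith C φ)
    (hφ : ∀ x, φ x ≠ 0 → x ∈ openCube d) {P : Fin d → Rd d → ℝ} {K : ℝ≥0}
    (hP : ∀ j, LipschitzWith K (P j)) :
    ∫ x, latticeSum I k ε c φ x * jacobian P x = (c ^ d)⁻¹ * ∑ i ∈ I,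
      ε i * ∫ y, φ y * jacobian (fun j => rescale c (latticePoint (k i)) (P j)) y := by
  unfold latticeSum
  obtain ⟨C, hC⟩ := hL
  simp only [Finset.sum_mul]
  rw [integral_finsetSum, Finset.mul_sum]
  · refine Finset.sum_congr rfl fun i _ => ?_
    simp only [mul_assoc, jacobian_rescale hc.ne']
    rw [integral_const_mul, integral_comp_smul_sub_mul hc]
    ring
  · intro i _
    simp only [mul_assoc]
    refine Integrable.const_mul ?_ _
    refine integrable_mul_jacobian
      (lipschitzWith_comp_smul_sub hc.le hC (latticePoint (k i))).continuous
      (S := (fun y => c⁻¹ • (y + latticePoint (k i))) '' cube d)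
      ((isCompact_cube d).image (by fun_prop)) (fun x hx => ?_) hP
    by_contra hcon
    refine hx ⟨_, openCube_subset_cube d (hφ _ hcon), ?_⟩
    simp [smul_smul, hc.ne']

theorem integral_abs_latticeSum (hc : 0 < c) (hL : ∃ C, LipschitzWith C φ)
    (hφ : ∀ x, φ x ≠ 0 → x ∈ openCube d) (hk : Set.InjOn k I) (hε : ∀ i, |ε i| = 1) :
    ∫ x, |latticeSum I k ε c φ x| = I.card * ((c ^ d)⁻¹ * ∫ y, |φ y|) := by
  simp only [abs_latticeSum hφ hk hε]
  rw [integral_latticeSum hc (integrable_of_lipschitz_of_ne_zero hL hφ).abs]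
  simp

theorem volume_real_ne_zero_le_one (hφ : ∀ x, φ x ≠ 0 → x ∈ openCube d) :
    (volume : Measure (Rd d)).real {x | φ x ≠ 0} ≤ 1 := by
  rw [← volume_real_cube d]
  exact measureReal_mono (fun x hx => openCube_subset_cube d (hφ x hx))
    (isCompact_cube d).measure_lt_top.ne

theorem volume_real_latticeSum_ne_zero_le (hc : 0 < c) (hφ : ∀ x, φ x ≠ 0 → x ∈ openCube d) :
    (volume : Measure (Rd d)).real {x | latticeSum I k ε c φ x ≠ 0}
      ≤ I.card * ((c ^ d)⁻¹ * (volume : Measure (Rd d)).real {x | φ x ≠ 0}) := by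
  have hfin : ∀ i, (volume : Measure (Rd d)) {x | c • x - latticePoint (k i) ∈ {x | φ x ≠ 0}}
      ≠ ∞ := fun i => by
    refine ne_top_of_le_ne_top (((isCompact_cube d).image (f := fun y => c⁻¹ • (y +
      latticePoint (k i))) (by fun_prop)).measure_lt_top.ne) (measure_mono fun x hx => ?_)
    refine ⟨_, openCube_subset_cube d (hφ _ hx), ?_⟩
    simp [smul_smul, hc.ne']
  have hsub : {x | latticeSum I k ε c φ x ≠ 0}
      ⊆ ⋃ i ∈ I, {x | c • x - latticePoint (k i) ∈ {x | φ x ≠ 0}} := fun x hx => by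
    obtain ⟨i, hi, h, -⟩ := exists_mem_of_latticeSum_ne_zero hφ hx
    exact mem_biUnion hi h
  refine (measureReal_mono hsub ?_).trans ((measureReal_biUnion_finset_le I _).trans ?_)
  · exact (measure_biUnion_lt_top I.finite_toSet fun i _ => (hfin i).lt_top).ne
  · simp only [volume_real_smul_sub_preimage hc]
    simp

end LatticeCopies

/-! ### The distance to the complement of the open cube as a bump -/

section Bump

variable {d : ℕ}

/-- A bump function on the unit cube. -/
def cubeBump (d : ℕ) (x : Rd d) : ℝ := Metric.infDist x (openCube d)ᶜ

theorem lipschitzWith_cubeBump (d : ℕ) : LipschitzWith 1 (cubeBump d) :=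
  Metric.lipschitz_infDist_pt _

theorem cubeBump_nonneg (x : Rd d) : 0 ≤ cubeBump d x := Metric.infDist_nonneg

theorem mem_openCube_of_cubeBump_ne_zero (x : Rd d) (h : cubeBump d x ≠ 0) : x ∈ openCube d := by
  by_contra hx
  exact h (Metric.infDist_zero_of_mem hx)

theorem abs_cubeBump_le_one (hd : 0 < d) (x : Rd d) : |cubeBump d x| ≤ 1 := by
  rw [abs_of_nonneg (cubeBump_nonneg x)]
  by_cases hx : x ∈ openCube d
  -- The projection of `x` to the face where the first coordinate vanishes is at distance less than
  -- one.
  · have h1 : x - EuclideanSpace.single ⟨0, hd⟩ (x ⟨0, hd⟩) ∈ (openCube d)ᶜ := fun h => by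
      have := (h ⟨0, hd⟩).1
      simp at this
    refine (Metric.infDist_le_dist_of_mem h1).trans ?_
    rw [dist_eq_norm, sub_sub_cancel, PiLp.norm_single, Real.norm_eq_abs,
      abs_of_pos (hx ⟨0, hd⟩).1]
    exact (hx ⟨0, hd⟩).2.le
  · have : cubeBump d x = 0 := Metric.infDist_zero_of_mem hx
    rw [this]
    exact zero_le_one

theorem integral_cubeBump_pos (hd : 0 < d) : 0 < ∫ x, |cubeBump d x| := by
  have hne : (openCube d)ᶜ.Nonempty := ⟨0, fun h => by simpa using (h ⟨0, hd⟩).1⟩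
  have hmem : (WithLp.toLp 2 fun _ => (1 / 2 : ℝ) : Rd d) ∈ openCube d := fun i => by
    constructor <;> norm_num
  refine (lipschitzWith_cubeBump d).continuous.abs.integral_pos_of_hasCompactSupport_nonneg_nonzero
    (HasCompactSupport.intro (isCompact_cube d) fun x hx => ?_) (fun x => abs_nonneg _)
    (x := WithLp.toLp 2 fun _ => (1 / 2 : ℝ)) ?_
  · by_contra hcon
    exact hx (openCube_subset_cube d (mem_openCube_of_cubeBump_ne_zero x (abs_ne_zero.1 hcon)))
  · have : 0 < cubeBump d (WithLp.toLp 2 fun _ => (1 / 2 : ℝ)) :=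
      ((isOpen_openCube d).isClosed_compl.notMem_iff_infDist_pos hne).1 (not_not.2 hmem)
    exact abs_ne_zero.2 this.ne'

end Bump

end MetricCurrents

end

noncomputable section

namespace MetricCurrents

/-! ### Riemann sums over the cube -/

section RiemannSums

variable {m : ℕ}

/-- The indices of the lattice points of a cross section. -/
def crossSection (m M : ℕ) : Finset (Fin m → ℕ) := Fintype.piFinset fun _ => Finset.range M

theorem card_crossSection (m M : ℕ) : (crossSection m M).card = M ^ m := by
  simp [crossSection]

theorem mem_crossSection {M : ℕ} {s : Fin m → ℕ} : s ∈ crossSection m M ↔ ∀ i, s i < M := by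
  simp [crossSection]

/-- The lattice point with first coordinate `t` and remaining coordinates `s`. -/
def gridPoint (t : ℕ) (s : Fin m → ℕ) : Rd (m + 1) := latticePoint (Fin.cons t s : Fin (m + 1) → ℕ)

theorem exists_gridPoint_sub_mem_cube {M : ℕ} (hM : 0 < M) {x : Rd (m + 1)}
    (hx : x ∈ cube (m + 1)) :
    ∃ a ∈ Finset.range M, ∃ s ∈ crossSection m M, (M : ℝ) • x - gridPoint a s ∈ cube (m + 1) := by
  -- Rounding up and subtracting one keeps the index below `M` even for `x i = 1`; truncated
  -- subtraction gives the index `0` for `x i = 0`.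
  set k : Fin (m + 1) → ℕ := fun i => ⌈(M : ℝ) * x i⌉₊ - 1 with hk
  have hM' : (0 : ℝ) < M := by exact_mod_cast hM
  have hkM : ∀ i, k i < M := fun i => by
    have h1 : ⌈(M : ℝ) * x i⌉₊ ≤ M := Nat.ceil_le.2 (mul_le_of_le_one_right hM'.le (hx i).2)
    simp only [hk]
    omega
  refine ⟨k 0, Finset.mem_range.2 (hkM 0), Fin.tail k, mem_crossSection.2 fun i => hkM _, ?_⟩
  intro i
  have h2 : gridPoint (k 0) (Fin.tail k) = latticePoint k := by
    rw [gridPoint, Fin.cons_self_tail]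
  rw [h2, PiLp.sub_apply, PiLp.smul_apply, latticePoint_apply, smul_eq_mul]
  have h0 : 0 ≤ (M : ℝ) * x i := mul_nonneg hM'.le (hx i).1
  rcases h0.eq_or_lt with h | h
  · simp [hk, ← h]
  · have h3 : 0 < ⌈(M : ℝ) * x i⌉₊ := Nat.ceil_pos.2 h
    have h4 : (k i : ℝ) = ⌈(M : ℝ) * x i⌉₊ - 1 := by
      simp only [hk]
      rw [Nat.cast_sub h3, Nat.cast_one]
    have h5 := Nat.ceil_lt_add_one h0
    have h6 := Nat.le_ceil ((M : ℝ) * x i)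
    rw [h4]
    constructor <;> linarith

theorem norm_le_of_mem_cube {d : ℕ} {x : Rd d} (hx : x ∈ cube d) : ‖x‖ ≤ d := by
  have := norm_le_of_forall_abs_le (x := x) (c := 1) fun i => by
    rw [abs_of_nonneg (hx i).1]; exact (hx i).2
  simpa using this

/-- An integral over the cube is bounded by Riemann sums. -/
theorem setIntegral_cube_le_sum {F : Rd (m + 1) → ℝ} {K : ℝ≥0} (hF : LipschitzWith K F)
    (h0 : ∀ x, 0 ≤ F x) {M : ℕ} (hM : 0 < M) :
    ∫ x in cube (m + 1), F x ≤ ((M : ℝ) ^ (m + 1))⁻¹ * ∑ a ∈ Finset.range M,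
      ∑ s ∈ crossSection m M, (F ((M : ℝ)⁻¹ • gridPoint a s) + K * ((m + 1) / M)) := by
  have hM' : (0 : ℝ) < M := by exact_mod_cast hM
  set C : ℕ → (Fin m → ℕ) → ℝ := fun a s => F ((M : ℝ)⁻¹ • gridPoint a s) + K * ((m + 1) / M)
    with hC
  set cell : ℕ → (Fin m → ℕ) → Set (Rd (m + 1)) :=
    fun a s => {x | (M : ℝ) • x - gridPoint a s ∈ cube (m + 1)} with hcell
  have hC0 : ∀ a s, 0 ≤ C a s := fun a s => add_nonneg (h0 _) (by positivity)
  have hclosed : ∀ a s, IsClosed (cell a s) := fun a s =>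
    (isClosed_cube (m + 1)).preimage (by fun_prop)
  have hvol : ∀ a s, (volume : Measure (Rd (m + 1))).real (cell a s) = ((M : ℝ) ^ (m + 1))⁻¹ :=
    fun a s => by
      simp only [hcell]
      rw [volume_real_smul_sub_preimage hM', volume_real_cube, mul_one]
  have hfin : ∀ a s, (volume : Measure (Rd (m + 1))) (cell a s) ≠ ∞ := fun a s h => by
    have := hvol a s
    rw [measureReal_def, h, ENNReal.toReal_top] at this
    exact absurd this.symm (by positivity)
  have hle : ∀ a s, ∀ x ∈ cell a s, F x ≤ C a s := by
    intro a s x hx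
    have h1 := hF.dist_le_mul x ((M : ℝ)⁻¹ • gridPoint a s)
    -- A cell has side `1 / M`, and the unit cube lies in the ball of radius `m + 1` around its
    -- corner.
    have h2 : dist x ((M : ℝ)⁻¹ • gridPoint a s) ≤ (m + 1) / M := by
      have h3 : x - (M : ℝ)⁻¹ • gridPoint a s = (M : ℝ)⁻¹ • ((M : ℝ) • x - gridPoint a s) := by
        rw [smul_sub, smul_smul, inv_mul_cancel₀ hM'.ne', one_smul]
      rw [dist_eq_norm, h3, norm_smul, norm_inv, Real.norm_natCast, inv_mul_eq_div]
      have := norm_le_of_mem_cube hx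
      push_cast at this
      gcongr
    have h4 := mul_le_mul_of_nonneg_left h2 (NNReal.coe_nonneg K)
    rw [Real.dist_eq] at h1
    have := le_abs_self (F x - F ((M : ℝ)⁻¹ • gridPoint a s))
    simp only [hC]
    linarith
  have hind : ∀ a s, Integrable ((cell a s).indicator fun _ => C a s) := fun a s =>
    (integrable_indicator_iff (hclosed a s).measurableSet).2 (integrableOn_const (hfin a s))
  rw [← integral_indicator (isClosed_cube _).measurableSet]
  have hI : ∫ x, ∑ a ∈ Finset.range M, ∑ s ∈ crossSection m M,
      (cell a s).indicator (fun _ => C a s) x = ((M : ℝ) ^ (m + 1))⁻¹ * ∑ a ∈ Finset.range M,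
      ∑ s ∈ crossSection m M, C a s := by
    rw [integral_finsetSum _ fun a _ => integrable_finsetSum _ fun s _ => hind a s,
      Finset.mul_sum]
    refine Finset.sum_congr rfl fun a _ => ?_
    rw [integral_finsetSum _ fun s _ => hind a s, Finset.mul_sum]
    refine Finset.sum_congr rfl fun s _ => ?_
    rw [integral_indicator (hclosed a s).measurableSet, setIntegral_const, hvol, smul_eq_mul]
  rw [← hI]
  refine integral_mono ?_ ?_ fun x => ?_
  · exact (integrable_indicator_iff (isClosed_cube _).measurableSet).2
      (hF.continuous.continuousOn.integrableOn_compact (isCompact_cube _))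
  · exact integrable_finsetSum _ fun a _ => integrable_finsetSum _ fun s _ => hind a s
  -- The closed cells overlap along their faces, which is harmless: every term is nonnegative and
  -- only an upper bound is sought.
  · have hnn : ∀ a s, 0 ≤ (cell a s).indicator (fun _ => C a s) x := fun a s =>
      indicator_nonneg (fun _ _ => hC0 a s) x
    by_cases hx : x ∈ cube (m + 1)
    · obtain ⟨a, ha, s, hs, h⟩ := exists_gridPoint_sub_mem_cube hM hx
      rw [indicator_of_mem hx]
      calc F x ≤ C a s := hle a s x h
        _ = (cell a s).indicator (fun _ => C a s) x := by rw [indicator_of_mem]; exact h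
        _ ≤ ∑ s ∈ crossSection m M, (cell a s).indicator (fun _ => C a s) x :=
          Finset.single_le_sum (f := fun s => (cell a s).indicator (fun _ => C a s) x)
            (fun s _ => hnn a s) hs
        _ ≤ _ := Finset.single_le_sum (f := fun a => ∑ s ∈ crossSection m M,
            (cell a s).indicator (fun _ => C a s) x)
            (fun a _ => Finset.sum_nonneg fun s _ => hnn a s) ha
    · rw [indicator_of_notMem hx]
      exact Finset.sum_nonneg fun a _ => Finset.sum_nonneg fun s _ => hnn a s

end RiemannSums

/-! ### Increments of a sequence: averaging and variance -/

section Sequences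

/-- For fixed `i` the indices `2 j M + a + i` are distinct: those of block `j` lie in a window of
length `2 M` starting at `2 j M`, since `a` and `i` are below `M`, and these windows are disjoint.
This is why coarse cells are used in pairs. -/
theorem sum_range_shift_le {f : ℕ → ℝ} (hf : ∀ t, 0 ≤ f t) (M H i : ℕ) (hi : i < M) :
    ∑ j ∈ Finset.range H, ∑ a ∈ Finset.range M, f (2 * j * M + a + i)
      ≤ ∑ t ∈ Finset.range (2 * H * M), f t := by
  induction H with
  | zero => simp
  | succ H ih =>
    have h1 : 2 * (H + 1) * M = 2 * H * M + 2 * M := by ring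
    rw [Finset.sum_range_succ, h1, Finset.sum_range_add]
    refine add_le_add ih ?_
    have h2 : ∑ a ∈ Finset.range M, f (2 * H * M + a + i)
        = ∑ b ∈ (Finset.range M).map (addRightEmbedding i), f (2 * H * M + b) := by
      rw [Finset.sum_map]
      exact Finset.sum_congr rfl fun a _ => by rw [addRightEmbedding_apply, add_assoc]
    rw [h2]
    refine Finset.sum_le_sum_of_subset_of_nonneg (fun b hb => ?_) fun b _ _ => hf _
    rw [Finset.mem_map] at hb
    obtain ⟨a, ha, rfl⟩ := hb
    rw [addRightEmbedding_apply]
    rw [Finset.mem_range] at ha ⊢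
    omega

/-- Long increments deviate from the mean not more than short increments do, on average. -/
theorem sum_abs_long_increment_le (p : ℕ → ℝ) (V : ℝ) {M N H : ℕ} (hM : 0 < M)
    (hN : N = 2 * H) :
    ∑ j ∈ Finset.range H, ∑ a ∈ Finset.range M,
      |(N : ℝ) * (p (2 * j * M + a + M) - p (2 * j * M + a)) - V|
      ≤ ∑ t ∈ Finset.range (N * M), |(N * M : ℝ) * (p (t + 1) - p t) - V| := by
  have hM' : (0 : ℝ) < M := by exact_mod_cast hM
  -- A difference quotient over `M` steps is the mean of the `M` quotients over single steps.
  have key : ∀ t, |(N : ℝ) * (p (t + M) - p t) - V|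
      ≤ (M : ℝ)⁻¹ * ∑ i ∈ Finset.range M, |(N * M : ℝ) * (p (t + i + 1) - p (t + i)) - V| := by
    intro t
    have h1 : ∑ i ∈ Finset.range M, ((N * M : ℝ) * (p (t + i + 1) - p (t + i)) - V)
        = M * ((N : ℝ) * (p (t + M) - p t) - V) := by
      have h0 := Finset.sum_range_sub (fun i => p (t + i)) M
      simp only [← add_assoc, add_zero] at h0
      rw [Finset.sum_sub_distrib, ← Finset.mul_sum, h0, Finset.sum_const, Finset.card_range,
        nsmul_eq_mul]
      ring
    have h2 : (N : ℝ) * (p (t + M) - p t) - V = (M : ℝ)⁻¹ *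
        ∑ i ∈ Finset.range M, ((N * M : ℝ) * (p (t + i + 1) - p (t + i)) - V) := by
      rw [h1, ← mul_assoc, inv_mul_cancel₀ hM'.ne', one_mul]
    rw [h2, abs_mul, abs_of_pos (inv_pos.2 hM')]
    exact mul_le_mul_of_nonneg_left (Finset.abs_sum_le_sum_abs _ _) (inv_pos.2 hM').le
  calc _ ≤ ∑ j ∈ Finset.range H, ∑ a ∈ Finset.range M, (M : ℝ)⁻¹ * ∑ i ∈ Finset.range M,
        |(N * M : ℝ) * (p (2 * j * M + a + i + 1) - p (2 * j * M + a + i)) - V| :=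
        Finset.sum_le_sum fun j _ => Finset.sum_le_sum fun a _ => key _
    _ = (M : ℝ)⁻¹ * ∑ i ∈ Finset.range M, ∑ j ∈ Finset.range H, ∑ a ∈ Finset.range M,
        |(N * M : ℝ) * (p (2 * j * M + a + i + 1) - p (2 * j * M + a + i)) - V| := by
        simp only [← Finset.mul_sum]
        congr 1
        rw [Finset.sum_comm]
        refine Eq.trans (Finset.sum_congr rfl fun a _ => Finset.sum_comm) ?_
        rw [Finset.sum_comm]
        exact Finset.sum_congr rfl fun i _ => Finset.sum_comm
    _ ≤ (M : ℝ)⁻¹ * ∑ i ∈ Finset.range M, ∑ t ∈ Finset.range (N * M),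
        |(N * M : ℝ) * (p (t + 1) - p t) - V| := by
        refine mul_le_mul_of_nonneg_left (Finset.sum_le_sum fun i hi => ?_) (inv_pos.2 hM').le
        subst hN
        exact sum_range_shift_le (f := fun t => |((2 * H : ℕ) * M : ℝ) * (p (t + 1) - p t) - V|)
          (fun t => abs_nonneg _) M H i (Finset.mem_range.1 hi)
    _ = _ := by
        rw [Finset.sum_const, Finset.card_range, nsmul_eq_mul, ← mul_assoc,
          inv_mul_cancel₀ hM'.ne', one_mul]

/-- The mean deviation of increments is controlled by the gain of energy. -/
theorem sum_abs_increment_sub_le (p : ℕ → ℝ) {V δ τ : ℝ} (hV : |V| ≤ 1) (hτ : 0 < τ) (n : ℕ)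
    (hp : |p n - p 0 - V| ≤ δ) :
    ∑ t ∈ Finset.range n, |(n : ℝ) * (p (t + 1) - p t) - V|
      ≤ n * τ + τ⁻¹ * ((∑ t ∈ Finset.range n, ((n : ℝ) * (p (t + 1) - p t)) ^ 2)
        - n * V ^ 2 + n * (2 * δ)) := by
  have h1 : ∀ a : ℝ, |a| ≤ τ + τ⁻¹ * a ^ 2 := by
    intro a
    rw [← sq_abs a, ← sub_nonneg]
    have : τ + τ⁻¹ * |a| ^ 2 - |a| = τ⁻¹ * ((|a| - τ / 2) ^ 2 + 3 / 4 * τ ^ 2) := by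
      field_simp
      ring
    rw [this]
    positivity
  set v : ℕ → ℝ := fun t => (n : ℝ) * (p (t + 1) - p t) with hv
  have hsum : ∑ t ∈ Finset.range n, v t = n * (p n - p 0) := by
    rw [← Finset.mul_sum, Finset.sum_range_sub]
  -- The variance identity. The last term would vanish if `V` were the exact mean of the slopes; it
  -- is controlled by the endpoint error `δ` and `|V| ≤ 1`.
  have hsq : ∑ t ∈ Finset.range n, (v t - V) ^ 2
      = (∑ t ∈ Finset.range n, v t ^ 2) - n * V ^ 2 - n * (2 * (V * (p n - p 0 - V))) := by
    have : ∀ t, (v t - V) ^ 2 = v t ^ 2 - 2 * V * v t + V ^ 2 := fun t => by ring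
    simp only [this, Finset.sum_add_distrib, Finset.sum_sub_distrib, ← Finset.mul_sum, hsum,
      Finset.sum_const, Finset.card_range, nsmul_eq_mul]
    ring
  have hcross : -(V * (p n - p 0 - V)) ≤ δ := by
    refine (neg_le_abs _).trans ?_
    rw [abs_mul]
    exact (mul_le_of_le_one_left (abs_nonneg _) hV).trans hp
  calc ∑ t ∈ Finset.range n, |v t - V|
      ≤ ∑ t ∈ Finset.range n, (τ + τ⁻¹ * (v t - V) ^ 2) := Finset.sum_le_sum fun t _ => h1 _
    _ = n * τ + τ⁻¹ * ∑ t ∈ Finset.range n, (v t - V) ^ 2 := by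
        rw [Finset.sum_add_distrib, Finset.sum_const, Finset.card_range, nsmul_eq_mul,
          Finset.mul_sum]
    _ ≤ _ := by
        rw [hsq]
        have h2 : (n : ℝ) * (2 * -(V * (p n - p 0 - V))) ≤ n * (2 * δ) := by gcongr
        refine add_le_add le_rfl (mul_le_mul_of_nonneg_left ?_ (inv_pos.2 hτ).le)
        linarith

theorem sum_range_two_mul_alternating (f : ℕ → ℝ) (H : ℕ) :
    ∑ j ∈ Finset.range (2 * H), (-1 : ℝ) ^ j * f j
      = ∑ j ∈ Finset.range H, (f (2 * j) - f (2 * j + 1)) := by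
  induction H with
  | zero => simp
  | succ H ih =>
    rw [mul_add_one, Finset.sum_range_succ, Finset.sum_range_succ, ih, Finset.sum_range_succ]
    simp [pow_succ, pow_mul]
    ring

end Sequences

end MetricCurrents

end

noncomputable section

namespace MetricCurrents

/-! ### The alternating pattern of bumps and the gain of energy -/

section Checkerboard

variable {m : ℕ}

theorem gridPoint_zero_apply (t : ℕ) (s : Fin m → ℕ) : gridPoint t s 0 = t := rfl

theorem gridPoint_succ_apply (t : ℕ) (s : Fin m → ℕ) (i : Fin m) : gridPoint t s i.succ = s i := rfl

/-- The first basis vector. -/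
def firstVec (m : ℕ) : Rd (m + 1) := EuclideanSpace.single 0 1

theorem firstVec_zero : firstVec m 0 = 1 := by simp [firstVec]

theorem firstVec_succ (i : Fin m) : firstVec m i.succ = 0 := by simp [firstVec]

theorem gridPoint_add (t r : ℕ) (s : Fin m → ℕ) :
    gridPoint (t + r) s = gridPoint t s + (r : ℝ) • firstVec m := by
  ext i
  refine Fin.cases ?_ (fun i => ?_) i
  · simp [gridPoint_zero_apply, firstVec_zero]
  · simp [gridPoint_succ_apply, firstVec_succ]

theorem smul_gridPoint_add {M N : ℕ} (hM : 0 < M) (hN : 0 < N) (a j : ℕ) (s : Fin m → ℕ) :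
    (N : ℝ)⁻¹ • ((M : ℝ)⁻¹ • gridPoint a s + gridPoint j (0 : Fin m → ℕ))
      = (N * M : ℝ)⁻¹ • gridPoint (j * M + a) s := by
  have hM' : (M : ℝ) ≠ 0 := by positivity
  have hN' : (N : ℝ) ≠ 0 := by positivity
  ext i
  refine Fin.cases ?_ (fun i => ?_) i
  · simp only [PiLp.smul_apply, PiLp.add_apply, gridPoint_zero_apply, smul_eq_mul]
    push_cast
    field_simp
    ring
  · simp only [PiLp.smul_apply, PiLp.add_apply, gridPoint_succ_apply, smul_eq_mul, Pi.zero_apply]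
    push_cast
    field_simp
    ring

theorem isCompact_smul_sub_preimage {d : ℕ} {c : ℝ} (hc : 0 < c) (w : Rd d) :
    IsCompact {x : Rd d | c • x - w ∈ cube d} := by
  have : {x : Rd d | c • x - w ∈ cube d} = (fun y => c⁻¹ • (y + w)) '' cube d := by
    ext x
    constructor
    · intro hx
      exact ⟨_, hx, by simp [smul_smul, hc.ne']⟩
    · rintro ⟨y, hy, rfl⟩
      simpa [smul_smul, hc.ne'] using hy
  rw [this]
  exact (isCompact_cube d).image (by fun_prop)

theorem setIntegral_smul_sub_preimage {d : ℕ} {c : ℝ} (hc : 0 < c) (w : Rd d) (G : Rd d → ℝ) :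
    ∫ x in {x : Rd d | c • x - w ∈ cube d}, G x
      = (c ^ d)⁻¹ * ∫ y in cube d, G (c⁻¹ • (y + w)) := by
  have h := integral_comp_smul_sub_mul hc w ((cube d).indicator fun _ => 1) G
  have h1 : (fun x => (cube d).indicator (fun _ => (1 : ℝ)) (c • x - w) * G x)
      = {x : Rd d | c • x - w ∈ cube d}.indicator G := by
    funext x
    by_cases hx : c • x - w ∈ cube d
    · rw [indicator_of_mem hx, indicator_of_mem (by exact hx), one_mul]
    · rw [indicator_of_notMem hx, indicator_of_notMem (by exact hx), zero_mul]
  have h2 : (fun y => (cube d).indicator (fun _ => (1 : ℝ)) y * G (c⁻¹ • (y + w)))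
      = (cube d).indicator fun y => G (c⁻¹ • (y + w)) := by
    funext y
    by_cases hy : y ∈ cube d
    · rw [indicator_of_mem hy, indicator_of_mem hy, one_mul]
    · rw [indicator_of_notMem hy, indicator_of_notMem hy, zero_mul]
  rw [h1, h2, integral_indicator (isCompact_smul_sub_preimage hc w).measurableSet,
    integral_indicator (isClosed_cube d).measurableSet] at h
  exact h

theorem jacobian_comp_add {d : ℕ} (P : Fin d → Rd d → ℝ) (w x : Rd d) :
    jacobian (fun l y => P l (y + w)) x = jacobian P (x + w) := by
  unfold jacobian
  simp only [partialDeriv_comp_add]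

/-- The integral of a Lipschitz function and its shift differ on neighbouring cells by little
if the increments are nearly constant. -/
theorem abs_integral_adjacent_cells_le {P : Fin (m + 1) → Rd (m + 1) → ℝ}
    (hP : ∀ l, LipschitzWith 1 (P l)) (V : Fin (m + 1) → ℝ) {M N : ℕ} (hM : 0 < M) (hN : 0 < N)
    (j : ℕ) :
    |(∫ x, cubeBump (m + 1) ((N : ℝ) • x - gridPoint j (0 : Fin m → ℕ)) * jacobian P x)
      - ∫ x, cubeBump (m + 1) ((N : ℝ) • x - gridPoint (j + 1) (0 : Fin m → ℕ)) * jacobian P x|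
      ≤ (m + 1).factorial * (((N : ℝ) * M) ^ (m + 1))⁻¹ * ∑ l, ∑ a ∈ Finset.range M,
        ∑ s ∈ crossSection m M, (|(N : ℝ) * (P l ((N * M : ℝ)⁻¹ • gridPoint (j * M + a + M) s)
          - P l ((N * M : ℝ)⁻¹ • gridPoint (j * M + a) s)) - V l| + 2 * ((m + 1) / M)) := by
  have hM' : (0 : ℝ) < M := by exact_mod_cast hM
  have hN' : (0 : ℝ) < N := by exact_mod_cast hN
  set w : Rd (m + 1) := gridPoint j (0 : Fin m → ℕ) with hw
  -- The shift from one coarse cell to the next. It moves the second bump onto the first at the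
  -- price of replacing `P` by its translate `P'`.
  set v : Rd (m + 1) := (N : ℝ)⁻¹ • firstVec m with hv
  set g : Rd (m + 1) → ℝ := fun x => cubeBump (m + 1) ((N : ℝ) • x - w) with hg
  set S : Set (Rd (m + 1)) := {x | (N : ℝ) • x - w ∈ cube (m + 1)} with hS
  set P' : Fin (m + 1) → Rd (m + 1) → ℝ := fun l y => P l (y + v) with hP'
  have hP'L : ∀ l, LipschitzWith 1 (P' l) := fun l => by
    refine LipschitzWith.of_dist_le_mul fun x y => ?_
    have := (hP l).dist_le_mul (x + v) (y + v)
    rwa [dist_add_right] at this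
  have hgL : LipschitzWith (1 * (N : ℝ).toNNReal) g :=
    lipschitzWith_comp_smul_sub hN'.le (lipschitzWith_cubeBump (m + 1)) w
  have hSc : IsCompact S := isCompact_smul_sub_preimage hN' w
  have hg0 : ∀ x, x ∉ S → g x = 0 := fun x hx => by
    by_contra hcon
    exact hx (openCube_subset_cube _ (mem_openCube_of_cubeBump_ne_zero _ hcon))
  have h2 : ∫ x, cubeBump (m + 1) ((N : ℝ) • x - gridPoint (j + 1) (0 : Fin m → ℕ)) * jacobian P x
      = ∫ x, g x * jacobian P' x := by
    rw [← integral_add_right_eq_self _ v]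
    congr 1
    funext x
    rw [hP', jacobian_comp_add, gridPoint_add]
    congr 2
    rw [hv, smul_add, smul_smul, mul_inv_cancel₀ hN'.ne', Nat.cast_one]
    abel
  have h3 : (∫ x, g x * jacobian P x) - ∫ x, g x * jacobian P' x
      = -∫ x, g x * (jacobian P' x - jacobian P x) := by
    rw [← integral_sub (integrable_mul_jacobian hgL.continuous hSc hg0 hP)
      (integrable_mul_jacobian hgL.continuous hSc hg0 hP'L), ← integral_neg]
    congr 1; funext x; ring
  rw [h2, h3, abs_neg]
  -- The free constant is the increment over a step of length `1 / N` of a function with constant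
  -- slope `V l`.
  refine (abs_integral_mul_jacobian_sub_le hgL hSc hg0 hP hP'L fun l => V l / N).trans ?_
  have hl : ∀ l, ∫ x in S, |P' l x - P l x - V l / N|
      ≤ (((N : ℝ) * M) ^ (m + 1))⁻¹ * (N : ℝ)⁻¹ * ∑ a ∈ Finset.range M,
        ∑ s ∈ crossSection m M, (|(N : ℝ) * (P l ((N * M : ℝ)⁻¹ • gridPoint (j * M + a + M) s)
          - P l ((N * M : ℝ)⁻¹ • gridPoint (j * M + a) s)) - V l| + 2 * ((m + 1) / M)) := by
    intro l
    rw [setIntegral_smul_sub_preimage hN' w fun x => |P' l x - P l x - V l / N|]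
    set E : Rd (m + 1) → ℝ := fun x => P' l x - P l x - V l / N with hE
    have hEL : LipschitzWith (1 + 1 + 0) E := ((hP'L l).sub (hP l)).sub (LipschitzWith.const _)
    -- The difference of `P' l` and `P l` is `2`-Lipschitz, and dilating the small cell to the unit
    -- cube divides the constant by `N`. This produces the error `2 (m + 1) / M` in the Riemann sum.
    have hFL : LipschitzWith (2 * (N : ℝ≥0)⁻¹) fun y => |E ((N : ℝ)⁻¹ • (y + w))| := by
      refine LipschitzWith.of_dist_le_mul fun x y => ?_
      have h4 := hEL.dist_le_mul ((N : ℝ)⁻¹ • (x + w)) ((N : ℝ)⁻¹ • (y + w))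
      rw [dist_smul₀, dist_add_right, norm_inv, Real.norm_natCast] at h4
      have h5 : dist |E ((N : ℝ)⁻¹ • (x + w))| |E ((N : ℝ)⁻¹ • (y + w))|
          ≤ dist (E ((N : ℝ)⁻¹ • (x + w))) (E ((N : ℝ)⁻¹ • (y + w))) :=
        abs_abs_sub_abs_le _ _
      refine h5.trans (h4.trans (le_of_eq ?_))
      push_cast
      ring
    have h6 := setIntegral_cube_le_sum hFL (fun _ => abs_nonneg _) hM
    have h7 : ∀ a (s : Fin m → ℕ), |E ((N : ℝ)⁻¹ • ((M : ℝ)⁻¹ • gridPoint a s + w))|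
        = (N : ℝ)⁻¹ * |(N : ℝ) * (P l ((N * M : ℝ)⁻¹ • gridPoint (j * M + a + M) s)
          - P l ((N * M : ℝ)⁻¹ • gridPoint (j * M + a) s)) - V l| := by
      intro a s
      have h8 : (N * M : ℝ)⁻¹ • gridPoint (j * M + a) s + v
          = (N * M : ℝ)⁻¹ • gridPoint (j * M + a + M) s := by
        rw [gridPoint_add (j * M + a) M, smul_add, smul_smul, hv]
        congr 2
        field_simp
      rw [hw, smul_gridPoint_add hM hN]
      simp only [hE, hP']
      have h9 : (N : ℝ)⁻¹ = |(N : ℝ)⁻¹| := (abs_of_pos (inv_pos.2 hN')).symm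
      rw [h8, h9, ← abs_mul]
      congr 1
      field_simp
    simp only [h7] at h6
    calc ((N : ℝ) ^ (m + 1))⁻¹ * ∫ y in cube (m + 1), |E ((N : ℝ)⁻¹ • (y + w))|
        ≤ _ := mul_le_mul_of_nonneg_left h6 (by positivity)
      _ = _ := by
        have h9 : (((N : ℝ) * M) ^ (m + 1))⁻¹ = ((N : ℝ) ^ (m + 1))⁻¹ * ((M : ℝ) ^ (m + 1))⁻¹ := by
          rw [mul_pow, mul_inv]
        rw [h9, mul_assoc, mul_assoc]
        congr 2
        simp only [Finset.mul_sum]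
        refine Finset.sum_congr rfl fun a _ => Finset.sum_congr rfl fun s _ => ?_
        push_cast
        ring
  calc _ ≤ ((m + 1).factorial : ℝ) * (((1 * (N : ℝ).toNNReal : ℝ≥0) : ℝ)
          * ((1 : ℝ≥0) : ℝ) ^ (m + 1 - 1)) * ∑ l, ((((N : ℝ) * M) ^ (m + 1))⁻¹ * (N : ℝ)⁻¹ *
          ∑ a ∈ Finset.range M, ∑ s ∈ crossSection m M,
          (|(N : ℝ) * (P l ((N * M : ℝ)⁻¹ • gridPoint (j * M + a + M) s)
          - P l ((N * M : ℝ)⁻¹ • gridPoint (j * M + a) s)) - V l| + 2 * ((m + 1) / M))) :=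
        mul_le_mul_of_nonneg_left (Finset.sum_le_sum fun l _ => hl l) (by positivity)
    _ = _ := by
        -- The Lipschitz constant `N` of the small bump cancels the factor `N⁻¹` that turns
        -- increments into slopes.
        rw [← Finset.mul_sum]
        simp only [NNReal.coe_one, Real.coe_toNNReal _ hN'.le, one_pow, one_mul,
          mul_one]
        field_simp

/-- The difference quotients of `p` along the grid. -/
def gridSlope (p : Rd (m + 1) → ℝ) (n : ℝ) (t : ℕ) (s : Fin m → ℕ) : ℝ :=
  n * (p (n⁻¹ • gridPoint (t + 1) s) - p (n⁻¹ • gridPoint t s))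

/-- The mean of the squares of the difference quotients along the grid. -/
def gridEnergy (p : Rd (m + 1) → ℝ) (N M : ℕ) : ℝ :=
  ((N : ℝ) * M ^ (m + 1))⁻¹ * ∑ s ∈ crossSection m M, ∑ t ∈ Finset.range (N * M),
    gridSlope p (N * M) t s ^ 2

/-- A checkerboard pattern of bumps along the first coordinate axis. -/
def checkerboard (m N : ℕ) : Rd (m + 1) → ℝ :=
  latticeSum (Finset.range N) (fun j => (Fin.cons j (0 : Fin m → ℕ) : Fin (m + 1) → ℕ))
    (fun j => (-1) ^ j) N (cubeBump (m + 1))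

/-- Every grid line in the tube runs parallel to the first axis at distance at most `(m + 1) / N`,
so each of its two end values is off by at most that much. Thus one slope `V` serves all lines of
the tube. -/
theorem abs_slope_grid_sub_le {p : Rd (m + 1) → ℝ} (hp : LipschitzWith 1 p) {M N : ℕ} (hM : 0 < M)
    (hN : 0 < N) {s : Fin m → ℕ} (hs : s ∈ crossSection m M) :
    |p ((N * M : ℝ)⁻¹ • gridPoint (N * M) s) - p ((N * M : ℝ)⁻¹ • gridPoint 0 s)
      - (p (firstVec m) - p 0)| ≤ 2 * ((m + 1) / N) := by
  have hM' : (0 : ℝ) < M := by exact_mod_cast hM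
  have hN' : (0 : ℝ) < N := by exact_mod_cast hN
  set z : Rd (m + 1) := (N * M : ℝ)⁻¹ • gridPoint 0 s with hz
  have h1 : (N * M : ℝ)⁻¹ • gridPoint (N * M) s = z + firstVec m := by
    have : gridPoint (N * M) s = gridPoint 0 s + ((N * M : ℕ) : ℝ) • firstVec m := by
      rw [← gridPoint_add, zero_add]
    rw [this, smul_add, smul_smul]
    push_cast
    rw [inv_mul_cancel₀ (by positivity), one_smul]
  have h2 : ‖z‖ ≤ (m + 1) / N := by
    have := norm_le_of_forall_abs_le (x := z) (c := (N : ℝ)⁻¹) fun i => by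
      refine Fin.cases ?_ (fun i => ?_) i
      · simp [hz, gridPoint_zero_apply]
      · rw [hz, PiLp.smul_apply, gridPoint_succ_apply, smul_eq_mul, abs_of_nonneg (by positivity)]
        have h3 : (s i : ℝ) ≤ M := by exact_mod_cast (mem_crossSection.1 hs i).le
        calc (N * M : ℝ)⁻¹ * s i ≤ (N * M : ℝ)⁻¹ * M := by gcongr
          _ = (N : ℝ)⁻¹ := by field_simp
    push_cast at this
    rwa [← div_eq_mul_inv] at this
  have h3 := hp.dist_le_mul (z + firstVec m) (firstVec m)
  have h4 := hp.dist_le_mul z 0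
  rw [Real.dist_eq, dist_eq_norm, add_sub_cancel_right, NNReal.coe_one, one_mul] at h3
  rw [Real.dist_eq, dist_zero_right, NNReal.coe_one, one_mul] at h4
  rw [h1]
  rw [abs_le] at h3 h4 ⊢
  constructor <;> linarith [h3.1, h3.2, h4.1, h4.2]

theorem abs_sub_le_one_of_lipschitz {p : Rd (m + 1) → ℝ} (hp : LipschitzWith 1 p) :
    |p (firstVec m) - p 0| ≤ 1 := by
  have := hp.dist_le_mul (firstVec m) 0
  rwa [Real.dist_eq, dist_zero_right, firstVec, PiLp.norm_single, norm_one, NNReal.coe_one,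
    mul_one] at this

/-- The checkerboard pattern detects the gain of energy from coarse to fine scales. -/
theorem abs_integral_checkerboard_le {P : Fin (m + 1) → Rd (m + 1) → ℝ}
    (hP : ∀ l, LipschitzWith 1 (P l)) {τ : ℝ} (hτ : 0 < τ) {M H : ℕ} (hM : 0 < M) (hH : 0 < H) :
    ((2 * H : ℕ) : ℝ) ^ m * |∫ x, checkerboard m (2 * H) x * jacobian P x|
      ≤ (m + 1).factorial * ∑ l, (τ + τ⁻¹ * (gridEnergy (P l) (2 * H) M
        - (P l (firstVec m) - P l 0) ^ 2 + 4 * ((m + 1) / (2 * H : ℕ))) + (m + 1) / M) := by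
  obtain ⟨N, hNdef⟩ : ∃ N, N = 2 * H := ⟨_, rfl⟩
  have hN : 0 < N := by omega
  have hM' : (0 : ℝ) < M := by exact_mod_cast hM
  have hN' : (0 : ℝ) < N := by exact_mod_cast hN
  have hNH : (N : ℝ) = 2 * H := by rw [hNdef]; push_cast; ring
  rw [← hNdef]
  set V : Fin (m + 1) → ℝ := fun l => P l (firstVec m) - P l 0 with hV
  set D : Fin (m + 1) → ℕ → (Fin m → ℕ) → ℝ := fun l t s =>
    |(N : ℝ) * (P l ((N * M : ℝ)⁻¹ • gridPoint (t + M) s)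
          - P l ((N * M : ℝ)⁻¹ • gridPoint t s)) - V l| with hD
  have hint : ∀ j : ℕ, Integrable fun x : Rd (m + 1) =>
      cubeBump (m + 1) ((N : ℝ) • x - gridPoint j (0 : Fin m → ℕ)) * jacobian P x := fun j =>
    integrable_mul_jacobian (lipschitzWith_comp_smul_sub hN'.le
      (lipschitzWith_cubeBump (m + 1)) (gridPoint j (0 : Fin m → ℕ))).continuous
      (isCompact_smul_sub_preimage hN' (gridPoint j (0 : Fin m → ℕ))) (fun x hx => by
        by_contra hcon
        exact hx (openCube_subset_cube _ (mem_openCube_of_cubeBump_ne_zero _ hcon))) hP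
  -- Since `N = 2 H` is even, the alternating signs pair each cell with its right neighbour.
  have h1 : ∫ x, checkerboard m N x * jacobian P x = ∑ j ∈ Finset.range H,
      ((∫ x, cubeBump (m + 1) ((N : ℝ) • x - gridPoint (2 * j) (0 : Fin m → ℕ)) * jacobian P x)
      - ∫ x, cubeBump (m + 1) ((N : ℝ) • x - gridPoint (2 * j + 1) (0 : Fin m → ℕ))
        * jacobian P x) := by
    rw [← sum_range_two_mul_alternating (fun j => ∫ x, cubeBump (m + 1)
      ((N : ℝ) • x - gridPoint j (0 : Fin m → ℕ)) * jacobian P x), ← hNdef]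
    simp only [← integral_const_mul]
    rw [← integral_finsetSum _ fun j _ => (hint j).const_mul _]
    congr 1
    funext x
    rw [checkerboard, latticeSum, Finset.sum_mul]
    exact Finset.sum_congr rfl fun j _ => by rw [mul_assoc, gridPoint]
  have h2 : |∫ x, checkerboard m N x * jacobian P x|
      ≤ ∑ j ∈ Finset.range H, (m + 1).factorial * (((N : ℝ) * M) ^ (m + 1))⁻¹ *
        ∑ l, ∑ a ∈ Finset.range M, ∑ s ∈ crossSection m M,
          (D l (2 * j * M + a) s + 2 * ((m + 1) / M)) := by
    rw [h1]
    exact (Finset.abs_sum_le_sum_abs _ _).trans (Finset.sum_le_sum fun j _ =>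
      abs_integral_adjacent_cells_le hP V hM hN (2 * j))
  have h3 : ∀ l, ∑ j ∈ Finset.range H, ∑ a ∈ Finset.range M, ∑ s ∈ crossSection m M,
      (D l (2 * j * M + a) s + 2 * ((m + 1) / M))
      ≤ (N * M ^ (m + 1)) * (τ + τ⁻¹ * (gridEnergy (P l) N M
        - V l ^ 2 + 4 * ((m + 1) / N)) + (m + 1) / M) := by
    intro l
    have h4 : ∑ j ∈ Finset.range H, ∑ a ∈ Finset.range M, ∑ s ∈ crossSection m M,
        (D l (2 * j * M + a) s + 2 * ((m + 1) / M))
        = (∑ s ∈ crossSection m M, ∑ j ∈ Finset.range H, ∑ a ∈ Finset.range M,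
          D l (2 * j * M + a) s) + H * (M * (M ^ m * (2 * ((m + 1) / M)))) := by
      simp only [Finset.sum_add_distrib, Finset.sum_const, Finset.card_range, card_crossSection,
        nsmul_eq_mul]
      congr 1
      · rw [Finset.sum_comm' (s := crossSection m M) (t := fun _ => Finset.range H)
          (t' := Finset.range H) (s' := fun _ => crossSection m M) (by simp [and_comm])]
        exact Finset.sum_congr rfl fun j _ => Finset.sum_comm
      · push_cast; ring
    -- On each grid line the long increments are replaced by short ones, whose deviation is bounded
    -- by the variance with endpoint error `δ = 2 (m + 1) / N`.
    have h5 : ∀ s ∈ crossSection m M, ∑ j ∈ Finset.range H, ∑ a ∈ Finset.range M,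
        D l (2 * j * M + a) s ≤ (N * M : ℝ) * τ + τ⁻¹ * ((∑ t ∈ Finset.range (N * M),
          gridSlope (P l) (N * M) t s ^ 2) - (N * M : ℝ) * V l ^ 2
          + (N * M : ℝ) * (2 * (2 * ((m + 1) / N)))) := by
      intro s hs
      have h6 := sum_abs_long_increment_le (fun t => P l ((N * M : ℝ)⁻¹ • gridPoint t s)) (V l)
        hM hNdef
      have h7 := sum_abs_increment_sub_le (fun t => P l ((N * M : ℝ)⁻¹ • gridPoint t s))
        (abs_sub_le_one_of_lipschitz (hP l)) hτ (N * M) (abs_slope_grid_sub_le (hP l) hM hN hs)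
      push_cast at h7
      exact h6.trans h7
    rw [h4]
    have h8 := Finset.sum_le_sum h5
    refine (add_le_add_left h8 _).trans (le_of_eq ?_)
    simp only [Finset.sum_add_distrib, ← Finset.mul_sum, Finset.sum_sub_distrib, Finset.sum_const,
      card_crossSection, nsmul_eq_mul, gridEnergy, hNH]
    have : (0 : ℝ) < H := by exact_mod_cast hH
    push_cast
    field_simp
    ring
  have h9 : ∑ j ∈ Finset.range H, ((m + 1).factorial : ℝ) * (((N : ℝ) * M) ^ (m + 1))⁻¹ *
        ∑ l, ∑ a ∈ Finset.range M, ∑ s ∈ crossSection m M,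
          (D l (2 * j * M + a) s + 2 * ((m + 1) / M))
      = ((m + 1).factorial : ℝ) * (((N : ℝ) * M) ^ (m + 1))⁻¹ * ∑ l, ∑ j ∈ Finset.range H,
        ∑ a ∈ Finset.range M, ∑ s ∈ crossSection m M,
          (D l (2 * j * M + a) s + 2 * ((m + 1) / M)) := by
    rw [← Finset.mul_sum, Finset.sum_comm]
  rw [h9] at h2
  calc (N : ℝ) ^ m * |∫ x, checkerboard m N x * jacobian P x|
      ≤ (N : ℝ) ^ m * (((m + 1).factorial : ℝ) * (((N : ℝ) * M) ^ (m + 1))⁻¹ * ∑ l,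
        ((N * M ^ (m + 1)) * (τ + τ⁻¹ * (gridEnergy (P l) N M
        - V l ^ 2 + 4 * ((m + 1) / N)) + (m + 1) / M))) := by
        refine mul_le_mul_of_nonneg_left (h2.trans ?_) (by positivity)
        exact mul_le_mul_of_nonneg_left (Finset.sum_le_sum fun l _ => h3 l) (by positivity)
    _ = _ := by
        -- The tube contains `N M ^ (m + 1)` fine cells of volume `(N M)^(-(m + 1))` each, hence has
        -- volume `N^(-m)`, which the factor `N ^ m` normalises.
        have aux : ∀ X : ℝ, (N : ℝ) ^ m * (((m + 1).factorial : ℝ) * (((N : ℝ) * M) ^ (m + 1))⁻¹ *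
            ((N * M ^ (m + 1)) * X)) = (m + 1).factorial * X := fun X => by
          rw [mul_pow, pow_succ (N : ℝ) m]
          field_simp
        rw [← Finset.mul_sum, aux]

end Checkerboard

end MetricCurrents

end

noncomputable section

namespace MetricCurrents

/-! ### The induction over scales -/

section MultiscaleConstruction

variable {m : ℕ}

/-- The mass of the standard bump. -/
def bumpMass (d : ℕ) : ℝ := ∫ x, |cubeBump d x|

/-- `u` has mass proportional to the number `K` of scales, but Jacobian determinants of `1`-Lipschitz
functions pair with it to something controlled by the energy which is not yet used. -/
structure IsMultiscale (m : ℕ) (τ : ℝ) (K : ℕ) (u : Rd (m + 1) → ℝ) : Prop where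
  lipschitz : ∃ C, LipschitzWith C u
  support : ∀ x, u x ≠ 0 → x ∈ openCube (m + 1)
  mass : K * (bumpMass (m + 1) / 2) ≤ ∫ x, |u x|
  volume_support : (volume : Measure (Rd (m + 1))).real {x | u x ≠ 0} ≤ bumpMass (m + 1) / 4
  pairing : ∀ P : Fin (m + 1) → Rd (m + 1) → ℝ, (∀ l, LipschitzWith 1 (P l)) →
    |∫ x, u x * jacobian P x| ≤ K * (3 * ((m + 1).factorial * ((m + 1) * τ)))
      + (m + 1).factorial * ∑ l, τ⁻¹ * (1 - (P l (firstVec m) - P l 0) ^ 2)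

/-- Rescaled copies of `u` in a thin neighbourhood of the first coordinate axis. -/
def fineCopies (N M : ℕ) (u : Rd (m + 1) → ℝ) : Rd (m + 1) → ℝ :=
  latticeSum (Finset.range (N * M) ×ˢ crossSection m M)
    (fun p => (Fin.cons p.1 p.2 : Fin (m + 1) → ℕ)) (fun _ => 1) (N * M) u

theorem card_fine (N M : ℕ) :
    ((Finset.range (N * M) ×ˢ crossSection m M).card : ℝ) = N * M ^ (m + 1) := by
  rw [Finset.card_product, Finset.card_range, card_crossSection]
  push_cast
  ring

theorem injOn_cons (s : Set (ℕ × (Fin m → ℕ))) :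
    Set.InjOn (fun p : ℕ × (Fin m → ℕ) => (Fin.cons p.1 p.2 : Fin (m + 1) → ℕ)) s := by
  rintro ⟨a, s⟩ - ⟨b, t⟩ - h
  have := Fin.cons_injective2 h
  exact Prod.ext this.1 this.2

/-- The slope entering the inductive bound on a fine cell is the grid slope there; its mean square
over all fine cells is therefore the grid energy of the next coarser estimate. -/
theorem rescale_slope {N M : ℕ} (p : Rd (m + 1) → ℝ) (t : ℕ) (s : Fin m → ℕ) :
    rescale (N * M : ℝ) (gridPoint t s) p (firstVec m) - rescale (N * M : ℝ) (gridPoint t s) p 0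
      = gridSlope p (N * M) t s := by
  have h : gridPoint (t + 1) s = firstVec m + gridPoint t s := by
    rw [gridPoint_add, Nat.cast_one, one_smul]
    exact add_comm _ _
  simp only [rescale, gridSlope, h, zero_add]
  ring

/-- The inductive bound is applied on every fine cell to the rescaled map, and averaged. The error
per scale is unchanged, while the available energy becomes what the fine grid has not yet used. -/
theorem abs_integral_fineCopies_le {τ : ℝ} {K : ℕ} {u : Rd (m + 1) → ℝ}
    (hu : IsMultiscale m τ K u) {N M : ℕ} (hN : 0 < N) (hM : 0 < M)
    {P : Fin (m + 1) → Rd (m + 1) → ℝ} (hP : ∀ l, LipschitzWith 1 (P l)) :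
    (N : ℝ) ^ m * |∫ x, fineCopies N M u x * jacobian P x|
      ≤ K * (3 * ((m + 1).factorial * ((m + 1) * τ)))
      + (m + 1).factorial * ∑ l, τ⁻¹ * (1 - gridEnergy (P l) N M) := by
  have hM' : (0 : ℝ) < M := by exact_mod_cast hM
  have hN' : (0 : ℝ) < N := by exact_mod_cast hN
  have hc : (0 : ℝ) < N * M := by positivity
  set A : ℝ := K * (3 * ((m + 1).factorial * ((m + 1) * τ))) with hA
  rw [fineCopies, integral_latticeSum_mul hc hu.lipschitz hu.support hP, abs_mul,
    abs_of_pos (inv_pos.2 (pow_pos hc _))]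
  have h1 : |∑ p ∈ Finset.range (N * M) ×ˢ crossSection m M, (1 : ℝ) * ∫ y, u y *
      jacobian (fun j => rescale (N * M : ℝ) (latticePoint (Fin.cons p.1 p.2)) (P j)) y|
      ≤ ∑ p ∈ Finset.range (N * M) ×ˢ crossSection m M, (A + (m + 1).factorial *
        ∑ l, τ⁻¹ * (1 - gridSlope (P l) (N * M) p.1 p.2 ^ 2)) := by
    refine (Finset.abs_sum_le_sum_abs _ _).trans (Finset.sum_le_sum fun p _ => ?_)
    rw [one_mul]
    have h2 := hu.pairing _ fun l => lipschitzWith_rescale hc.ne' (gridPoint p.1 p.2) (hP l)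
    simp only [rescale_slope] at h2
    exact h2
  have h3 : ∑ p ∈ Finset.range (N * M) ×ˢ crossSection m M, (A + (m + 1).factorial *
        ∑ l, τ⁻¹ * (1 - gridSlope (P l) (N * M) p.1 p.2 ^ 2))
      = (N * M ^ (m + 1)) * (A + (m + 1).factorial * ∑ l, τ⁻¹ * (1 - gridEnergy (P l) N M)) := by
    rw [Finset.sum_add_distrib, Finset.sum_const, nsmul_eq_mul, card_fine, mul_add,
      ← Finset.mul_sum, Finset.sum_comm]
    congr 1
    rw [mul_left_comm]
    congr 1
    rw [Finset.mul_sum]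
    refine Finset.sum_congr rfl fun l _ => ?_
    rw [← Finset.mul_sum, Finset.sum_sub_distrib, Finset.sum_const, nsmul_eq_mul, card_fine,
      Finset.sum_product_right, gridEnergy]
    field_simp
  rw [h3] at h1
  have aux : ∀ X : ℝ, (N : ℝ) ^ m * (((N * M : ℝ) ^ (m + 1))⁻¹ * ((N * M ^ (m + 1)) * X)) = X :=
    fun X => by
      rw [mul_pow, pow_succ (N : ℝ) m]
      field_simp
  rw [← aux (A + _)]
  gcongr

/-- Cancellation can occur only where `b` is nonzero, and then it costs at most `2 |a|`. Integrated,
the loss of mass is at most twice the volume of the support of the fine copies. -/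
theorem abs_add_ge_of_abs_le_one {a b : ℝ} (ha : |a| ≤ 1) :
    |a| + |b| - 2 * (if b ≠ 0 then 1 else 0) ≤ |a + b| := by
  by_cases hb : b = 0
  · simp [hb]
  · have h := abs_add_le (a + b) (-a)
    rw [abs_neg, add_neg_cancel_comm] at h
    simp only [ne_eq, hb, not_false_eq_true, if_true]
    linarith

/-- Adding one scale. -/
theorem IsMultiscale.step (hm : 0 < m) {τ : ℝ} (hτ : 0 < τ) {K : ℕ} {u : Rd (m + 1) → ℝ}
    (hu : IsMultiscale m τ K u) {H M : ℕ} (hH : 0 < H) (hM : 0 < M)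
    (hHγ : 1 / (H : ℝ) ≤ bumpMass (m + 1) / 4) (hHτ : 4 * ((m + 1) / ((2 * H : ℕ) : ℝ)) ≤ τ ^ 2)
    (hMτ : ((m : ℝ) + 1) / M ≤ τ) :
    IsMultiscale m τ (K + 1) fun x => ((2 * H : ℕ) : ℝ) ^ m *
      (checkerboard m (2 * H) x + fineCopies (2 * H) M u x) := by
  obtain ⟨N, hNdef⟩ : ∃ N, N = 2 * H := ⟨_, rfl⟩
  have hN : 0 < N := by omega
  have hM' : (0 : ℝ) < M := by exact_mod_cast hM
  have hN' : (0 : ℝ) < N := by exact_mod_cast hN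
  have hN1 : (1 : ℝ) ≤ N := by exact_mod_cast hN
  have hM1 : (1 : ℝ) ≤ M := by exact_mod_cast hM
  have hc : (0 : ℝ) < N * M := by positivity
  have hNm : (0 : ℝ) < (N : ℝ) ^ m := by positivity
  rw [← hNdef] at hHτ ⊢
  have hbL : ∃ C, LipschitzWith C (cubeBump (m + 1)) := ⟨1, lipschitzWith_cubeBump _⟩
  have hbs := mem_openCube_of_cubeBump_ne_zero (d := m + 1)
  have hcbL : ∃ C, LipschitzWith C (checkerboard m N) := exists_lipschitzWith_latticeSum hN'.le hbL
  have hfL : ∃ C, LipschitzWith C (fineCopies N M u) :=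
    exists_lipschitzWith_latticeSum hc.le hu.lipschitz
  have hinj1 : Set.InjOn (fun j => (Fin.cons j (0 : Fin m → ℕ) : Fin (m + 1) → ℕ))
      (Finset.range N : Finset ℕ) := by
    intro a _ b _ h
    exact (Fin.cons_injective2 h).1
  have hsign : ∀ i : ℕ, |(-1 : ℝ) ^ i| = 1 := fun i => by simp
  have hcbs : ∀ x, checkerboard m N x ≠ 0 → x ∈ openCube (m + 1) := fun x hx => by
    refine mem_openCube_of_latticeSum_ne_zero hbs hN' (fun i hi j => ?_) hx
    have hi' : (i : ℝ) + 1 ≤ N := by exact_mod_cast Finset.mem_range.1 hi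
    refine Fin.cases ?_ (fun j => ?_) j
    · simpa using hi'
    · simpa using hN1
  have hfs : ∀ x, fineCopies N M u x ≠ 0 → x ∈ openCube (m + 1) := fun x hx => by
    refine mem_openCube_of_latticeSum_ne_zero hu.support hc (fun i hi j => ?_) hx
    rw [Finset.mem_product] at hi
    refine Fin.cases ?_ (fun j => ?_) j
    · have : (i.1 : ℝ) + 1 ≤ ((N * M : ℕ) : ℝ) := by exact_mod_cast Finset.mem_range.1 hi.1
      simpa using this
    · have : (i.2 j : ℝ) + 1 ≤ M := by exact_mod_cast mem_crossSection.1 hi.2 j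
      simp only [Fin.cons_succ]
      nlinarith
  have hcb1 : ∀ x, |checkerboard m N x| ≤ 1 := fun x =>
    abs_latticeSum_le_one hbs hinj1 hsign (abs_cubeBump_le_one (Nat.succ_pos m)) x
  have hsupp : ∀ x, (N : ℝ) ^ m * (checkerboard m N x + fineCopies N M u x) ≠ 0 →
      checkerboard m N x ≠ 0 ∨ fineCopies N M u x ≠ 0 := fun x hx => by
    by_contra hcon
    push Not at hcon
    exact hx (by rw [hcon.1, hcon.2, add_zero, mul_zero])
  have hcbi := integrable_of_lipschitz_of_ne_zero hcbL hcbs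
  have hfi := integrable_of_lipschitz_of_ne_zero hfL hfs
  -- Inside the tube, the copies fill at most the same proportion of volume as `u` does in the unit
  -- cube.
  have hvolf : (N : ℝ) ^ m * (volume : Measure (Rd (m + 1))).real {x | fineCopies N M u x ≠ 0}
      ≤ (volume : Measure (Rd (m + 1))).real {x | u x ≠ 0} := by
    have h1 := volume_real_latticeSum_ne_zero_le (I := Finset.range (N * M) ×ˢ crossSection m M)
      (k := fun p => (Fin.cons p.1 p.2 : Fin (m + 1) → ℕ)) (ε := fun _ => 1) hc hu.support
    rw [card_fine] at h1
    calc _ ≤ (N : ℝ) ^ m * _ := mul_le_mul_of_nonneg_left h1 hNm.le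
      _ = _ := by
        rw [mul_pow, pow_succ (N : ℝ) m]
        field_simp
  have hvolcb : (N : ℝ) ^ m * (volume : Measure (Rd (m + 1))).real {x | checkerboard m N x ≠ 0}
      ≤ 1 := by
    have h1 := volume_real_latticeSum_ne_zero_le (I := Finset.range N)
      (k := fun j => (Fin.cons j (0 : Fin m → ℕ) : Fin (m + 1) → ℕ)) (ε := fun j => (-1) ^ j)
      hN' hbs
    rw [Finset.card_range] at h1
    calc _ ≤ (N : ℝ) ^ m * _ := mul_le_mul_of_nonneg_left h1 hNm.le
      _ = (volume : Measure (Rd (m + 1))).real {x | cubeBump (m + 1) x ≠ 0} := by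
        rw [pow_succ (N : ℝ) m]
        field_simp
      _ ≤ 1 := volume_real_ne_zero_le_one hbs
  have hmasscb : (N : ℝ) ^ m * ∫ x, |checkerboard m N x| = bumpMass (m + 1) := by
    have h1 := integral_abs_latticeSum (I := Finset.range N)
      (k := fun j => (Fin.cons j (0 : Fin m → ℕ) : Fin (m + 1) → ℕ)) (ε := fun j => (-1) ^ j)
      hN' hbL hbs hinj1 hsign
    rw [Finset.card_range] at h1
    rw [checkerboard, h1, bumpMass, pow_succ (N : ℝ) m]
    field_simp
  have hmassf : (N : ℝ) ^ m * ∫ x, |fineCopies N M u x| = ∫ x, |u x| := by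
    have h1 := integral_abs_latticeSum (I := Finset.range (N * M) ×ˢ crossSection m M)
      (k := fun p => (Fin.cons p.1 p.2 : Fin (m + 1) → ℕ)) (ε := fun _ => 1)
      hc hu.lipschitz hu.support (injOn_cons _) (fun _ => abs_one)
    rw [card_fine] at h1
    rw [fineCopies, h1, mul_pow, pow_succ (N : ℝ) m]
    field_simp
  have hfin : ∀ {g : Rd (m + 1) → ℝ}, (∀ x, g x ≠ 0 → x ∈ openCube (m + 1)) →
      (volume : Measure (Rd (m + 1))) {x | g x ≠ 0} ≠ ∞ := fun hg =>
    ne_top_of_le_ne_top (isCompact_cube (m + 1)).measure_lt_top.ne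
      (measure_mono fun x hx => openCube_subset_cube _ (hg x hx))
  refine ⟨?_, fun x hx => ?_, ?_, ?_, fun P hP => ?_⟩
  · obtain ⟨C1, hC1⟩ := hcbL
    obtain ⟨C2, hC2⟩ := hfL
    exact ⟨_, (lipschitzWith_smul ((N : ℝ) ^ m)).comp (hC1.add hC2)⟩
  · exact (hsupp x hx).elim (hcbs x) (hfs x)
  · have hmeas : MeasurableSet {x | fineCopies N M u x ≠ 0} := by
      obtain ⟨C2, hC2⟩ := hfL
      exact (isOpen_ne_fun hC2.continuous continuous_const).measurableSet
    set χ : Rd (m + 1) → ℝ := fun x => if fineCopies N M u x ≠ 0 then 1 else 0 with hχ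
    have hχind : χ = {x | fineCopies N M u x ≠ 0}.indicator fun _ => 1 := by
      funext x
      simp [hχ, indicator_apply]
    have hχi : Integrable χ := by
      rw [hχind, integrable_indicator_iff hmeas]
      exact integrableOn_const (hfin hfs)
    have hχint : ∫ x, χ x = (volume : Measure (Rd (m + 1))).real {x | fineCopies N M u x ≠ 0} := by
      rw [hχind, integral_indicator hmeas, setIntegral_const, smul_eq_mul, mul_one]
    -- After multiplication by `N ^ m` the new bumps contribute a full `bumpMass`, of which at most
    -- `2 · bumpMass / 4` is lost by overlap; half of it remains as the gain of this scale.
    have h1 : (∫ x, |checkerboard m N x|) + (∫ x, |fineCopies N M u x|) - 2 * ∫ x, χ x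
        ≤ ∫ x, |checkerboard m N x + fineCopies N M u x| := by
      have hab : Integrable fun x => |checkerboard m N x| + |fineCopies N M u x| :=
        hcbi.abs.add hfi.abs
      rw [← integral_const_mul, ← integral_add hcbi.abs hfi.abs,
        ← integral_sub hab (hχi.const_mul 2)]
      exact integral_mono (hab.sub (hχi.const_mul 2)) (hcbi.add hfi).abs
        fun x => abs_add_ge_of_abs_le_one (hcb1 x)
    simp only [abs_mul, abs_of_pos hNm]
    rw [integral_const_mul]
    have h2 := mul_le_mul_of_nonneg_left h1 hNm.le
    rw [hχint, mul_sub, mul_add, hmasscb, hmassf] at h2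
    have h3 := hu.mass
    have h4 := hu.volume_support
    push_cast
    linarith
  · have h1 : (volume : Measure (Rd (m + 1))).real
        {x | (N : ℝ) ^ m * (checkerboard m N x + fineCopies N M u x) ≠ 0}
        ≤ (volume : Measure (Rd (m + 1))).real {x | checkerboard m N x ≠ 0}
          + (volume : Measure (Rd (m + 1))).real {x | fineCopies N M u x ≠ 0} := by
      refine (measureReal_mono (fun x hx => hsupp x hx) ?_).trans (measureReal_union_le _ _)
      exact (measure_union_lt_top (hfin hcbs).lt_top (hfin hfs).lt_top).ne
    -- The only place where dimension at least two is essential: the tube has volume at most `1 /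
    -- N`, so bumps and copies together occupy at most `2 / N = 1 / H`.
    have h2 : (N : ℝ) ≤ (N : ℝ) ^ m := le_self_pow₀ hN1 hm.ne'
    have h3 := volume_real_ne_zero_le_one hu.support
    have h4 : (N : ℝ) * ((volume : Measure (Rd (m + 1))).real {x | checkerboard m N x ≠ 0}
          + (volume : Measure (Rd (m + 1))).real {x | fineCopies N M u x ≠ 0}) ≤ 2 := by
      refine (mul_le_mul_of_nonneg_right h2 (add_nonneg measureReal_nonneg measureReal_nonneg)).trans ?_
      rw [mul_add]
      linarith
    have h5 : (N : ℝ) = 2 * H := by rw [hNdef]; push_cast; ring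
    have hH' : (0 : ℝ) < H := by exact_mod_cast hH
    refine h1.trans (le_trans ?_ hHγ)
    rw [le_div_iff₀ hH']
    rw [h5] at h4
    linarith
  · have hi : ∀ {g : Rd (m + 1) → ℝ}, (∃ C, LipschitzWith C g) →
        (∀ x, g x ≠ 0 → x ∈ openCube (m + 1)) → Integrable fun x => g x * jacobian P x := by
      rintro g ⟨C, hC⟩ hg
      refine integrable_mul_jacobian hC.continuous (isCompact_cube (m + 1)) (fun x hx => ?_) hP
      by_contra hcon
      exact hx (openCube_subset_cube _ (hg x hcon))
    have h1 : ∫ x, (N : ℝ) ^ m * (checkerboard m N x + fineCopies N M u x) * jacobian P x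
        = (N : ℝ) ^ m * ((∫ x, checkerboard m N x * jacobian P x)
          + ∫ x, fineCopies N M u x * jacobian P x) := by
      rw [← integral_add (hi hcbL hcbs) (hi hfL hfs), ← integral_const_mul]
      congr 1; funext x; ring
    rw [h1, abs_mul, abs_of_pos hNm]
    have h2 := abs_integral_checkerboard_le hP hτ hM hH
    rw [← hNdef] at h2
    have h3 := abs_integral_fineCopies_le hu hN hM hP
    have h4 := mul_le_mul_of_nonneg_left (abs_add_le (∫ x, checkerboard m N x * jacobian P x)
      (∫ x, fineCopies N M u x * jacobian P x)) hNm.le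
    rw [mul_add] at h4
    -- The grid energy gained by the checkerboard cancels the one subtracted by the fine copies.
    -- Three errors of size `τ` remain: from `|a| ≤ τ + a² / τ`, from the endpoints of the grid
    -- lines, and from the Riemann sums.
    have h5 : ∀ l : Fin (m + 1), τ + τ⁻¹ * (gridEnergy (P l) N M
        - (P l (firstVec m) - P l 0) ^ 2 + 4 * ((m + 1) / (N : ℝ))) + (m + 1) / M
        + τ⁻¹ * (1 - gridEnergy (P l) N M)
        ≤ 3 * τ + τ⁻¹ * (1 - (P l (firstVec m) - P l 0) ^ 2) := by
      intro l
      have h6 : τ⁻¹ * (4 * ((m + 1) / (N : ℝ))) ≤ τ := by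
        rw [inv_mul_le_iff₀ hτ, ← sq]
        exact hHτ
      have h7 : τ⁻¹ * (gridEnergy (P l) N M
        - (P l (firstVec m) - P l 0) ^ 2 + 4 * ((m + 1) / (N : ℝ)))
        + τ⁻¹ * (1 - gridEnergy (P l) N M) = τ⁻¹ * (1 - (P l (firstVec m) - P l 0) ^ 2)
          + τ⁻¹ * (4 * ((m + 1) / (N : ℝ))) := by ring
      linarith
    have h8 := Finset.sum_le_sum fun l (_ : l ∈ Finset.univ) => h5 l
    rw [Finset.sum_add_distrib, Finset.sum_add_distrib (f := fun _ => 3 * τ), Finset.sum_const,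
      Finset.card_univ, Fintype.card_fin, nsmul_eq_mul] at h8
    have h9 := mul_le_mul_of_nonneg_left h8 (Nat.cast_nonneg (α := ℝ) (m + 1).factorial)
    push_cast at h9 ⊢
    nlinarith [h2, h3, h4, h9]

theorem bumpMass_pos (m : ℕ) : 0 < bumpMass (m + 1) := integral_cubeBump_pos (Nat.succ_pos m)

theorem exists_isMultiscale (hm : 0 < m) {τ : ℝ} (hτ : 0 < τ) (K : ℕ) :
    ∃ u, IsMultiscale m τ K u := by
  have hγ := bumpMass_pos m
  induction K with
  | zero =>
    refine ⟨fun _ => 0, ⟨0, LipschitzWith.const 0⟩, fun x hx => absurd rfl hx, by simp, ?_,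
      fun P hP => ?_⟩
    · simp only [ne_eq, not_true_eq_false, ofPred_false, measureReal_empty]
      positivity
    -- The zero function starts the induction: the energy budget is nonnegative because slopes of
    -- `1`-Lipschitz functions are at most one.
    · have : ∀ l, 0 ≤ 1 - (P l (firstVec m) - P l 0) ^ 2 := fun l => by
        have := abs_sub_le_one_of_lipschitz (hP l)
        rw [sub_nonneg, sq_le_one_iff_abs_le_one]
        exact this
      simp only [zero_mul, integral_zero, abs_zero, Nat.cast_zero, zero_add]
      exact mul_nonneg (Nat.cast_nonneg _) (Finset.sum_nonneg fun l _ =>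
        mul_nonneg (inv_pos.2 hτ).le (this l))
  | succ K ih =>
    obtain ⟨u, hu⟩ := ih
    -- The first bound on `H` keeps the support small, the second makes the endpoint error at most
    -- `τ ^ 2`; the bound on `M` makes the Riemann sum error at most `τ`.
    obtain ⟨H, hH⟩ := exists_nat_gt (max (4 / bumpMass (m + 1)) (2 * ((m : ℝ) + 1) / τ ^ 2))
    obtain ⟨M, hM⟩ := exists_nat_gt (((m : ℝ) + 1) / τ)
    have hH1 := (le_max_left _ _).trans_lt hH
    have hH2 := (le_max_right _ _).trans_lt hH
    have hH' : (0 : ℝ) < H := lt_trans (by positivity) hH1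
    have hM' : (0 : ℝ) < M := lt_trans (by positivity) hM
    refine ⟨_, hu.step hm hτ (H := H) (M := M) (by exact_mod_cast hH') (by exact_mod_cast hM')
      ?_ ?_ ?_⟩
    · rw [div_lt_iff₀ hγ] at hH1
      rw [div_le_div_iff₀ hH' (by norm_num)]
      linarith
    · rw [div_lt_iff₀ (by positivity)] at hH2
      push_cast
      rw [← mul_div_assoc, div_le_iff₀ (by positivity)]
      nlinarith
    · rw [div_lt_iff₀ hτ] at hM
      rw [div_le_iff₀ hM']
      linarith

/-- Functions of mass one which are almost orthogonal to all Jacobian determinants of `1`-Lipschitz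
functions. -/
theorem exists_abs_integral_mul_jacobian_le (hm : 0 < m) {ε : ℝ} (hε : 0 < ε) :
    ∃ u : Rd (m + 1) → ℝ, (∃ C, LipschitzWith C u) ∧ (∀ x, u x ≠ 0 → x ∈ openCube (m + 1)) ∧
      1 ≤ ∫ x, |u x| ∧ ∀ P : Fin (m + 1) → Rd (m + 1) → ℝ, (∀ l, LipschitzWith 1 (P l)) →
        |∫ x, u x * jacobian P x| ≤ ε := by
  have hγ := bumpMass_pos m
  set γ := bumpMass (m + 1) with hγdef
  set F : ℝ := (m + 1).factorial * ((m : ℝ) + 1) with hF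
  have hFpos : 0 < F := by positivity
  -- With this `τ` the errors of `K` scales add up to `K ε γ / 4`, and `K` is then so large that the
  -- whole energy budget `F / τ` is at most `K ε γ / 4` too. Division by the mass bound `K γ / 2`
  -- leaves `ε`.
  set τ : ℝ := ε * γ / (12 * F) with hτdef
  have hτ : 0 < τ := by positivity
  obtain ⟨K, hK⟩ := exists_nat_gt (F * τ⁻¹ / (ε * γ / 4))
  have hK' : (0 : ℝ) < K := lt_of_le_of_lt (by positivity) hK
  obtain ⟨u, hu⟩ := exists_isMultiscale hm hτ K
  set c : ℝ := (K * (γ / 2))⁻¹ with hc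
  have hcpos : 0 < c := by positivity
  obtain ⟨C, hC⟩ := hu.lipschitz
  refine ⟨fun x => c * u x, ⟨_, (lipschitzWith_smul c).comp hC⟩,
    fun x hx => hu.support x (right_ne_zero_of_mul hx), ?_, fun P hP => ?_⟩
  · simp only [abs_mul, abs_of_pos hcpos]
    rw [integral_const_mul, hc, ← div_eq_inv_mul, one_le_div (by positivity)]
    exact hu.mass
  · simp only [mul_assoc]
    rw [integral_const_mul, abs_mul, abs_of_pos hcpos, hc, inv_mul_le_iff₀ (by positivity)]
    refine (hu.pairing P hP).trans ?_
    have h1 : ∑ l, τ⁻¹ * (1 - (P l (firstVec m) - P l 0) ^ 2) ≤ ∑ _l : Fin (m + 1), τ⁻¹ :=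
      Finset.sum_le_sum fun l _ => by
        have := sq_nonneg (P l (firstVec m) - P l 0)
        exact mul_le_of_le_one_right (inv_pos.2 hτ).le (by linarith)
    rw [Finset.sum_const, Finset.card_univ, Fintype.card_fin, nsmul_eq_mul] at h1
    have h2 := mul_le_mul_of_nonneg_left h1 (Nat.cast_nonneg (α := ℝ) (m + 1).factorial)
    have h3 : F * τ⁻¹ < K * (ε * γ / 4) := (div_lt_iff₀ (by positivity)).1 hK
    have h4 : K * (3 * (((m + 1).factorial : ℝ) * (((m : ℝ) + 1) * τ))) = K * (ε * γ / 4) := by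
      rw [← mul_assoc ((m + 1).factorial : ℝ), ← hF, hτdef]
      field_simp
      ring
    push_cast at h2
    rw [h4]
    have h5 : ((m + 1).factorial : ℝ) * (((m : ℝ) + 1) * τ⁻¹) = F * τ⁻¹ := by rw [hF]; ring
    nlinarith

end MultiscaleConstruction

end MetricCurrents

end

noncomputable section

namespace MetricCurrents

/-! ### Shrinking the density to include the factor `f` -/

section Localization

variable {m : ℕ}

/-- A copy of the density shrunk by a factor `c` and normalised by `c ^ (m + 1)` keeps its mass and,
by scale invariance, its bound against Jacobians. On its support `f` differs from `f z` by `O(1 /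
c)`, so `f` acts as a constant of modulus at most one. -/
theorem exists_localized_abs_integral_le (hm : 0 < m) {ε : ℝ} (hε : 0 < ε) (z : Rd (m + 1))
    {r : ℝ} (hr : 0 < r) :
    ∃ u : Rd (m + 1) → ℝ, (∃ C, LipschitzWith C u) ∧
      (∀ x, u x ≠ 0 → ∀ i, x i ∈ Ioo (z i) (z i + r)) ∧ 1 ≤ ∫ x, |u x| ∧
      ∀ f : Rd (m + 1) → ℝ, LipschitzWith 1 f → |f z| ≤ 1 →
      ∀ P : Fin (m + 1) → Rd (m + 1) → ℝ, (∀ j, LipschitzWith 1 (P j)) →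
        |∫ x, u x * (f x * jacobian P x)| ≤ ε := by
  obtain ⟨φ, hφL, hφs, hφm, hφ⟩ := exists_abs_integral_mul_jacobian_le hm (half_pos hε)
  have hφi : Integrable φ := integrable_of_lipschitz_of_ne_zero hφL hφs
  set A : ℝ := ∫ x, |φ x| with hA
  -- The product of the bounds for `‖y‖` on the support, for the Jacobian, and the mass: replacing
  -- `f` by `f z` costs at most `D / c`. The two entries in `c` below put the support into the box
  -- and make this cost at most `ε / 2`.
  set D : ℝ := ((m + 1 : ℕ) : ℝ) * (m + 1).factorial * A with hD
  set c : ℝ := max (1 / r) (2 * D / ε) with hcdef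
  have hc : 0 < c := (one_div_pos.2 hr).trans_le (le_max_left _ _)
  have hcr : c⁻¹ ≤ r := by
    rw [inv_le_comm₀ hc hr, ← one_div]
    exact le_max_left _ _
  have hcD : c⁻¹ * D ≤ ε / 2 := by
    have : 2 * D / ε ≤ c := le_max_right _ _
    rw [div_le_iff₀ hε] at this
    rw [inv_mul_le_iff₀ hc]
    linarith
  have hcd : 0 < c ^ (m + 1) := pow_pos hc _
  obtain ⟨C, hC⟩ := hφL
  refine ⟨fun x => c ^ (m + 1) * φ (c • x - c • z), ?_, ?_, ?_, ?_⟩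
  · exact ⟨_, (lipschitzWith_smul (c ^ (m + 1))).comp
      (lipschitzWith_comp_smul_sub hc.le hC (c • z))⟩
  · intro x hx i
    have h := hφs _ (right_ne_zero_of_mul hx) i
    simp only [PiLp.sub_apply, PiLp.smul_apply, smul_eq_mul] at h
    rw [← mul_sub] at h
    have h1 : 0 < x i - z i := pos_of_mul_pos_right h.1 hc.le
    have h2 : x i - z i < c⁻¹ := by
      rw [← mul_lt_mul_iff_right₀ hc, mul_inv_cancel₀ hc.ne']
      exact h.2
    exact ⟨by linarith, by linarith⟩
  · simp only [abs_mul, abs_of_pos hcd]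
    rw [integral_const_mul, integral_comp_smul_sub hc (c • z) fun y => |φ y|, ← mul_assoc,
      mul_inv_cancel₀ hcd.ne', one_mul]
    exact hφm
  · intro f hf hfz P hP
    have hmap : Continuous fun y : Rd (m + 1) => c⁻¹ • (y + c • z) := by fun_prop
    have hφc : Continuous φ := hC.continuous
    have hφ0 : ∀ x, x ∉ cube (m + 1) → φ x = 0 := fun x hx => by
      by_contra h
      exact hx (openCube_subset_cube _ (hφs x h))
    set R : Fin (m + 1) → Rd (m + 1) → ℝ := fun j => rescale c (c • z) (P j) with hR
    have hRL : ∀ j, LipschitzWith 1 (R j) := fun j => lipschitzWith_rescale hc.ne' _ (hP j)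
    have h1 : ∫ x, c ^ (m + 1) * φ (c • x - c • z) * (f x * jacobian P x)
        = ∫ y, φ y * f (c⁻¹ • (y + c • z)) * jacobian R y := by
      simp only [mul_assoc]
      rw [integral_const_mul, integral_comp_smul_sub_mul hc (c • z) φ fun x => f x * jacobian P x,
        ← mul_assoc, mul_inv_cancel₀ hcd.ne', one_mul]
      simp only [hR, jacobian_rescale hc.ne']
    have hi1 : Integrable fun y => φ y * f (c⁻¹ • (y + c • z)) * jacobian R y :=
      integrable_mul_jacobian (hφc.mul (hf.continuous.comp hmap)) (isCompact_cube _)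
        (fun x hx => by rw [Pi.mul_apply, hφ0 x hx, zero_mul]) hRL
    have hi2 : Integrable fun y => φ y * jacobian R y :=
      integrable_mul_jacobian hφc (isCompact_cube _) hφ0 hRL
    have h2 : ∫ y, φ y * f (c⁻¹ • (y + c • z)) * jacobian R y
        = f z * (∫ y, φ y * jacobian R y)
          + ∫ y, (φ y * f (c⁻¹ • (y + c • z)) * jacobian R y - f z * (φ y * jacobian R y)) := by
      rw [integral_sub hi1 (hi2.const_mul _), integral_const_mul]
      ring
    have h3 : |∫ y, (φ y * f (c⁻¹ • (y + c • z)) * jacobian R y - f z * (φ y * jacobian R y))|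
        ≤ c⁻¹ * D := by
      have hb : ∫ y, |φ y| * (((m + 1 : ℕ) : ℝ) * c⁻¹ * (m + 1).factorial) = c⁻¹ * D := by
        rw [integral_mul_const, hD]
        ring
      rw [← hb, ← Real.norm_eq_abs]
      refine norm_integral_le_of_norm_le (hφi.abs.mul_const _) (ae_of_all _ fun y => ?_)
      have e : φ y * f (c⁻¹ • (y + c • z)) * jacobian R y - f z * (φ y * jacobian R y)
          = φ y * ((f (c⁻¹ • (y + c • z)) - f z) * jacobian R y) := by ring
      rw [e, Real.norm_eq_abs, abs_mul]
      by_cases hy : φ y = 0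
      · simp [hy]
      refine mul_le_mul_of_nonneg_left ?_ (abs_nonneg _)
      rw [abs_mul]
      have hyn : ‖y‖ ≤ (m + 1 : ℕ) := norm_le_of_mem_cube (openCube_subset_cube _ (hφs y hy))
      have hz : c⁻¹ • (y + c • z) - z = c⁻¹ • y := by
        rw [smul_add, smul_smul, inv_mul_cancel₀ hc.ne', one_smul, add_sub_cancel_right]
      have h4 : |f (c⁻¹ • (y + c • z)) - f z| ≤ (m + 1 : ℕ) * c⁻¹ := by
        have := hf.dist_le_mul (c⁻¹ • (y + c • z)) z
        rw [dist_eq_norm, dist_eq_norm, hz, norm_smul, Real.norm_eq_abs, Real.norm_eq_abs,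
          abs_of_pos (inv_pos.2 hc), NNReal.coe_one, one_mul] at this
        rw [mul_comm]
        exact this.trans (mul_le_mul_of_nonneg_left hyn (inv_pos.2 hc).le)
      have h5 : |jacobian R y| ≤ (m + 1).factorial := by
        simpa using abs_jacobian_le_pow hRL y
      exact mul_le_mul h4 h5 (abs_nonneg _) (by positivity)
    have h4 : |f z * ∫ y, φ y * jacobian R y| ≤ ε / 2 := by
      rw [abs_mul]
      exact (mul_le_of_le_one_left (abs_nonneg _) hfz).trans (hφ R hRL)
    rw [h1, h2]
    exact (abs_add_le _ _).trans (by linarith)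

end Localization

/-! ### Irregular densities on the cube -/

section CubeDensities

variable {d : ℕ}

/-- A bound for a metric current on the unit ball yields a bound by homogeneity. -/
theorem MetricCurrent.abs_le_of_unit {X : Type*} [MetricSpace X] [CompactSpace X] [Nonempty X]
    {k : ℕ} (T : MetricCurrent X k) {C : ℝ}
    (hC : ∀ (f : Lip X) (π : Fin k → Lip X), lipNorm f ≤ 1 → (∀ j, lipConst (π j) ≤ 1) →
      |T.toMap (Lip.toLipc f) π| ≤ C) (f : Lip X) (π : Fin k → Lip X) :
    |T.toMap (Lip.toLipc f) π| ≤ C * (lipNorm f * ∏ j, lipConst (π j)) := by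
  obtain ⟨C', hC'⟩ := T.exists_bound
  have hnn : 0 ≤ lipNorm f * ∏ j, lipConst (π j) :=
    mul_nonneg (lipNorm_nonneg _) (Finset.prod_nonneg fun _ _ => lipConst_nonneg _)
  -- If a norm vanishes one cannot normalise, but the a priori bound with some constant `C'` already
  -- forces the value to be zero.
  rcases hnn.eq_or_lt with h0 | hpos
  · have := hC' f π
    rwa [← h0, mul_zero] at this ⊢
  have hf : lipNorm f ≠ 0 := left_ne_zero_of_mul hpos.ne'
  have hp : ∏ j, lipConst (π j) ≠ 0 := right_ne_zero_of_mul hpos.ne'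
  have hj : ∀ j, lipConst (π j) ≠ 0 := fun j => Finset.prod_ne_zero_iff.1 hp j (Finset.mem_univ j)
  have hfp : 0 < lipNorm f := lt_of_le_of_ne (lipNorm_nonneg f) (Ne.symm hf)
  have hjp : ∀ j, 0 < lipConst (π j) := fun j =>
    lt_of_le_of_ne (lipConst_nonneg _) (Ne.symm (hj j))
  have h := hC ((lipNorm f)⁻¹ • f) (fun j => (lipConst (π j))⁻¹ • π j)
    (by rw [lipNorm_smul, abs_inv, abs_of_pos hfp, inv_mul_cancel₀ hf])
    (fun j => by rw [lipConst_smul, abs_inv, abs_of_pos (hjp j), inv_mul_cancel₀ (hj j)])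
  rw [map_smul, map_smul, smul_apply, MultilinearMap.map_smul_univ, smul_eq_mul,
    smul_eq_mul, abs_mul, abs_mul, abs_inv, abs_of_pos hfp, Finset.prod_inv_distrib, abs_inv,
    abs_of_pos (Finset.prod_pos fun j _ => hjp j)] at h
  rw [← div_le_iff₀ hpos]
  refine le_trans (le_of_eq ?_) h
  field_simp

/-- There are densities of mass at least one, concentrated in a small box, which have a small
pairing with all Jacobian determinants. -/
theorem exists_irregular_density (hd : 2 ≤ d) {ε : ℝ} (hε : 0 < ε) {z : Rd d}
    (hz : ∀ i, 0 ≤ z i) {r : ℝ} (hr : 0 < r) (hzr : ∀ i, z i + r ≤ 1) :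
    ∃ u : Rd d → ℝ, (∃ C, LipschitzWith C u) ∧
      (∀ x, u x ≠ 0 → ∀ i, x i ∈ Ioo (z i) (z i + r)) ∧ 1 ≤ ∫ x in cube d, |u x| ∧
      ∀ (f : Lip (cube d)) (π : Fin d → Lip (cube d)),
        |∫ x in cube d, u x * (zeroExt (f : cube d → ℝ) x * jac π x)|
          ≤ ε * (lipNorm f * ∏ j, lipConst (π j)) := by
  obtain ⟨m, rfl⟩ : ∃ m, d = m + 1 := ⟨d - 1, by omega⟩
  obtain ⟨u, hL, hs, hm, hu⟩ := exists_localized_abs_integral_le (by omega) hε z hr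
  have hs' : ∀ x, u x ≠ 0 → x ∈ openCube (m + 1) := fun x hx i =>
    ⟨(hz i).trans_lt (hs x hx i).1, (hs x hx i).2.trans_le (hzr i)⟩
  have h0 : ∀ x, x ∉ cube (m + 1) → u x = 0 := fun x hx => by
    by_contra h
    exact hx (openCube_subset_cube _ (hs' x h))
  have hi : Integrable u := integrable_of_lipschitz_of_ne_zero hL hs'
  have hzc : z ∈ cube (m + 1) := fun i => ⟨hz i, by linarith [hzr i]⟩
  refine ⟨u, hL, hs, ?_, fun f π => ?_⟩
  · rwa [setIntegral_eq_integral_of_forall_compl_eq_zero fun x hx => by rw [h0 x hx, abs_zero]]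
  -- By homogeneity all norms may be taken at most one; then the Lipschitz extensions to `ℝ^d` are
  -- `1`-Lipschitz, as the localized estimate requires.
  · refine (cubeCurrent (Nat.succ_pos m) u hi.restrict).abs_le_of_unit (fun f π hf hπ => ?_) f π
    rw [cubeCurrent_apply]
    have h1 : ∫ x in cube (m + 1), u x * (zeroExt (f : cube (m + 1) → ℝ) x * jac π x)
        = ∫ x, u x * (lipExt f x * jacobian (fun j => lipExt (π j)) x) := by
      refine Eq.trans ?_ (setIntegral_eq_integral_of_forall_compl_eq_zero (s := cube (m + 1))
        fun x hx => by rw [h0 x hx, zero_mul])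
      refine integral_congr_ae ?_
      filter_upwards [ae_mem_interior_cube (m + 1)] with x hx
      rw [zeroExt_eq_lipExt f (interior_subset hx), jac_eq_jacobian_lipExt π hx]
    have e : ((Lip.toLipc f : Lipc (cube (m + 1))) : cube (m + 1) → ℝ) = f := rfl
    rw [e, h1]
    refine hu _ ((lipschitzWith_lipExt f).weaken ?_) ?_ _
      fun j => (lipschitzWith_lipExt (π j)).weaken (hπ j)
    · have : lipConst f ≤ 1 := (le_max_right _ _).trans hf
      exact this
    · rw [← zeroExt_eq_lipExt f hzc]
      exact (abs_zeroExt_le f z).trans hf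

end CubeDensities

end MetricCurrents

end

noncomputable section

namespace MetricCurrents

variable {d : ℕ}

/-! ### The coordinate map has Jacobian one -/

section Coordinates

theorem partialDeriv_coord (i j : Fin d) (x : Rd d) :
    partialDeriv (coord d j : Rd d → ℝ) i x = if i = j then 1 else 0 := by
  have h : fderiv ℝ (coord d j : Rd d → ℝ) x = EuclideanSpace.proj j :=
    (EuclideanSpace.proj (𝕜 := ℝ) j : Rd d →L[ℝ] ℝ).fderiv
  rw [partialDeriv, h]
  simp [eq_comm]

theorem jacobian_coord (x : Rd d) : jacobian (fun j => (coord d j : Rd d → ℝ)) x = 1 := by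
  have : (Matrix.of fun i j : Fin d => partialDeriv (coord d j : Rd d → ℝ) i x) = 1 := by
    ext i j
    rw [Matrix.of_apply, partialDeriv_coord, Matrix.one_apply]
  rw [jacobian, this, Matrix.det_one]

theorem zeroExt_restrictLip (f : Lip (Rd d)) {x : Rd d} (hx : x ∈ cube d) :
    zeroExt (restrictLip d f : cube d → ℝ) x = (f : Rd d → ℝ) x := by
  rw [zeroExt_of_mem _ hx]
  rfl

theorem jac_restrictLip_coord {x : Rd d} (hx : x ∈ interior (cube d)) :
    jac (fun j => restrictLip d (coord d j)) x = 1 := by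
  rw [jac_eq_jacobian_of_eqOn _ (fun j y hy => zeroExt_restrictLip (coord d j) hy) hx,
    jacobian_coord]

theorem setIntegral_mul_restrictLip_coord (w : Rd d → ℝ) (f : Lip (Rd d)) :
    ∫ x in cube d, w x * (zeroExt (restrictLip d f : cube d → ℝ) x *
      jac (fun j => restrictLip d (coord d j)) x) = ∫ x in cube d, w x * (f : Rd d → ℝ) x := by
  refine integral_congr_ae ?_
  filter_upwards [ae_mem_interior_cube d] with x hx
  rw [zeroExt_restrictLip f (interior_subset hx), jac_restrictLip_coord hx, mul_one]

end Coordinates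

/-! ### A Lipschitz substitute for the sign -/

section Clamp

/-- The truncation of `2 t` to `[-1, 1]`. -/
def clampTwice (t : ℝ) : ℝ := max (-1) (min 1 (2 * t))

theorem abs_clampTwice_le_one (t : ℝ) : |clampTwice t| ≤ 1 :=
  abs_le.2 ⟨le_max_left _ _, max_le (by norm_num) (min_le_left _ _)⟩

theorem clampTwice_zero : clampTwice 0 = 0 := by norm_num [clampTwice]

/-- Compared with the sign, clamping loses something only for `|t| < 1 / 2`, and less than `1 / 2`
there. As the cube has volume one, a density of mass at least one still pairs with its clamped
version to at least `1 / 2`. -/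
theorem abs_sub_half_le_mul_clampTwice (t : ℝ) : |t| - 1 / 2 ≤ t * clampTwice t := by
  rcases le_total (2 * t) 1 with h | h
  · rcases le_total (-1) (2 * t) with h' | h'
    · have : clampTwice t = 2 * t := by rw [clampTwice, min_eq_right h, max_eq_right h']
      have h2 : |t| ≤ 1 / 2 := abs_le.2 ⟨by linarith, by linarith⟩
      rw [this]
      nlinarith [sq_nonneg t]
    · have : clampTwice t = -1 := by rw [clampTwice, min_eq_right h, max_eq_left h']
      rw [this, abs_of_nonpos (by linarith)]
      linarith
  · have : clampTwice t = 1 := by rw [clampTwice, min_eq_left h, max_eq_right (by norm_num)]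
    rw [this, abs_of_nonneg (by linarith)]
    linarith

theorem exists_lipschitzWith_clampTwice {u : Rd d → ℝ} {C : ℝ≥0} (hu : LipschitzWith C u) :
    ∃ K, LipschitzWith K fun x => clampTwice (u x) :=
  ⟨_, (((lipschitzWith_smul (2 : ℝ)).comp hu).const_min 1).const_max (-1)⟩

theorem half_le_setIntegral_mul_clampTwice {u : Rd d → ℝ} {C : ℝ≥0} (hu : LipschitzWith C u)
    (h : 1 ≤ ∫ x in cube d, |u x|) : 1 / 2 ≤ ∫ x in cube d, u x * clampTwice (u x) := by
  obtain ⟨K, hK⟩ := exists_lipschitzWith_clampTwice hu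
  have h1 : Integrable (fun x => |u x|) (cubeMeasure d) :=
    hu.continuous.abs.continuousOn.integrableOn_compact (isCompact_cube d)
  have h2 : Integrable (fun x => u x * clampTwice (u x)) (cubeMeasure d) :=
    (hu.continuous.mul hK.continuous).continuousOn.integrableOn_compact (isCompact_cube d)
  have h3 : ∫ _x in cube d, (1 / 2 : ℝ) = 1 / 2 := by
    rw [setIntegral_const, volume_real_cube, one_smul]
  have h4 : ∫ x in cube d, (|u x| - 1 / 2) ≤ ∫ x in cube d, u x * clampTwice (u x) :=
    integral_mono (h1.sub (integrable_const _)) h2 fun x => abs_sub_half_le_mul_clampTwice (u x)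
  rw [integral_sub h1 (integrable_const _), h3] at h4
  linarith

end Clamp

/-! ### Strong Lipschitz non-regularity -/

section IrregularDensities

theorem exists_irregular_toL1 (hd : 2 ≤ d) {ε : ℝ} (hε : 0 < ε) :
    ∃ (u : Rd d → ℝ) (U : Lp ℝ 1 (cubeMeasure d)), (∃ C, LipschitzWith C u) ∧
      U =ᵐ[cubeMeasure d] u ∧ 1 ≤ ∫ x in cube d, |u x| ∧
      ∀ (f : Lip (cube d)) (π : Fin d → Lip (cube d)),
        |∫ x in cube d, U x * (zeroExt (f : cube d → ℝ) x * jac π x)|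
          ≤ ε * (lipNorm f * ∏ j, lipConst (π j)) := by
  obtain ⟨u, ⟨C, hC⟩, -, hm, hu⟩ := exists_irregular_density hd hε (z := 0) (r := 1)
    (fun _ => le_rfl) one_pos (fun _ => by simp)
  have hi : Integrable u (cubeMeasure d) :=
    hC.continuous.continuousOn.integrableOn_compact (isCompact_cube d)
  refine ⟨u, hi.toL1 u, ⟨C, hC⟩, hi.coeFn_toL1, hm, fun f π => ?_⟩
  refine (le_of_eq (congrArg _ (integral_congr_ae ?_))).trans (hu f π)
  filter_upwards [hi.coeFn_toL1] with x hx
  rw [hx]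

/-- The prescribed Jacobian equation has strong Lipschitz non-regularity. -/
theorem strongLipschitzNonRegularity (hd : 2 ≤ d) : StrongLipschitzNonRegularity d := by
  choose u U _ hU hm hb using fun n : ℕ =>
    exists_irregular_toL1 hd (ε := 1 / ((n : ℝ) + 1)) (by positivity)
  refine ⟨U, fun n hn => ⟨?_, fun f π h => ?_⟩⟩
  · rw [L1.norm_eq_integral_norm]
    refine (hm n).trans (le_of_eq (integral_congr_ae ?_))
    filter_upwards [hU n] with x hx
    rw [hx, Real.norm_eq_abs]
  · have hn' : (0 : ℝ) < n := by exact_mod_cast hn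
    refine (hb n f π).trans ?_
    refine (mul_le_of_le_one_right (by positivity) h).trans ?_
    exact one_div_le_one_div_of_le hn' (by linarith)

end IrregularDensities

/-! ### The embedding into `L^∞` and its strong non-surjectivity -/

section Embedding

theorem norm_jacTerm_le (f : Lip (cube d)) (π : Fin d → Lip (cube d)) :
    ‖jacTerm f π‖ ≤ d.factorial * (lipNorm f * ∏ j, lipConst (π j)) := by
  have hnn : 0 ≤ (d.factorial : ℝ) * (lipNorm f * ∏ j, lipConst (π j)) :=
    mul_nonneg (Nat.cast_nonneg _) (FormalSum.term_nonneg f π)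
  have h := Lp.norm_le_of_ae_bound (f := jacTerm f π) hnn ?_
  · simpa using h
  · filter_upwards [(memLp_jac f π).coeFn_toLp, ae_mem_interior_cube d] with x hx hxQ
    rw [jacTerm, hx, Real.norm_eq_abs, abs_mul, mul_left_comm]
    exact mul_le_mul (abs_zeroExt_le f x) (abs_jac_le π hxQ) (abs_nonneg _) (lipNorm_nonneg f)

theorem linftyToDual_apply (ρ : Lp ℝ ∞ (cubeMeasure d)) (u : Lp ℝ 1 (cubeMeasure d)) :
    linftyToDual d ρ u = ∫ x in cube d, ρ x * u x :=
  ContinuousLinearMap.lpPairing_eq_integral _ _ _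

theorem linftyToDual_injective (d : ℕ) : Function.Injective (linftyToDual d) := by
  refine (injective_iff_map_eq_zero _).2 fun ρ hρ => ?_
  have hi : Integrable ρ (cubeMeasure d) := (Lp.memLp ρ).integrable le_top
  rw [Lp.eq_zero_iff_ae_eq_zero]
  refine hi.ae_eq_zero_of_forall_setIntegral_eq_zero fun s hs hμ => ?_
  have h := linftyToDual_apply ρ (indicatorConstLp 1 hs hμ.ne 1)
  rw [hρ, zero_apply] at h
  rw [h, ← integral_indicator hs]
  refine integral_congr_ae ?_
  filter_upwards [indicatorConstLp_coeFn (p := 1) (hs := hs) (hμs := hμ.ne) (c := (1 : ℝ))]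
    with x hx
  rw [hx]
  by_cases hxs : x ∈ s <;> simp [hxs]

/-- The current on the cube with density `u`. -/
def densityCurrent (hd : 0 < d) (u : Lp ℝ 1 (cubeMeasure d)) : MetricCurrent (cube d) d :=
  cubeCurrent hd u (L1.integrable_coeFn u)

theorem linftyToDual_jacTerm (hd : 0 < d) (f : Lip (cube d)) (π : Fin d → Lip (cube d))
    (u : Lp ℝ 1 (cubeMeasure d)) :
    linftyToDual d (jacTerm f π) u = (densityCurrent hd u).toMap (Lip.toLipc f) π := by
  rw [linftyToDual_apply, densityCurrent, cubeCurrent_apply]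
  refine integral_congr_ae ?_
  filter_upwards [(memLp_jac f π).coeFn_toLp] with x hx
  rw [jacTerm, hx, mul_comm]
  rfl

theorem summable_norm_jacTerm (σ : FormalSum d) :
    Summable fun i => ‖jacTerm (σ.f i) (σ.π i)‖ :=
  Summable.of_nonneg_of_le (fun _ => norm_nonneg _) (fun _ => norm_jacTerm_le _ _)
    (σ.summable.mul_left _)

/-- The sum of the Jacobian series of a formal Lipschitz sum. -/
def jacSum (σ : FormalSum d) : Lp ℝ ∞ (cubeMeasure d) := ∑' i, jacTerm (σ.f i) (σ.π i)

theorem norm_jacSum_le (σ : FormalSum d) : ‖jacSum σ‖ ≤ d.factorial * σ.size := by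
  refine (norm_tsum_le_tsum_norm (summable_norm_jacTerm σ)).trans ?_
  rw [FormalSum.size, ← tsum_mul_left]
  exact (summable_norm_jacTerm σ).tsum_le_tsum (fun _ => norm_jacTerm_le _ _)
    (σ.summable.mul_left _)

theorem linftyToDual_jacSum (hd : 0 < d) (σ : FormalSum d) (u : Lp ℝ 1 (cubeMeasure d)) :
    linftyToDual d (jacSum σ) u = (PotentialForm.mk σ).pairing (densityCurrent hd u) := by
  have h := ((linftyToDual d).flip u).map_tsum (summable_norm_jacTerm σ).of_norm
  simp only [ContinuousLinearMap.flip_apply, linftyToDual_jacTerm hd] at h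
  exact h

/-- Pairing the Jacobian series with `u` in `L¹` is evaluating the formal sum on the metric current
with density `u`. Equivalent sums agree on all metric currents, and `L¹` separates the points of
`L^∞`. -/
theorem jacSum_eq_of_equiv (hd : 0 < d) {σ τ : FormalSum d} (h : σ ≈ τ) :
    jacSum σ = jacSum τ := by
  refine linftyToDual_injective d (ContinuousLinearMap.ext fun u => ?_)
  rw [linftyToDual_jacSum hd, linftyToDual_jacSum hd]
  exact h _

/-- The canonical embedding as a function. -/
def embeddingFun (hd : 0 < d) (ω : PotentialForm d) : Lp ℝ ∞ (cubeMeasure d) :=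
  Quotient.liftOn ω jacSum fun _ _ => jacSum_eq_of_equiv hd

theorem linftyToDual_embeddingFun (hd : 0 < d) (ω : PotentialForm d)
    (u : Lp ℝ 1 (cubeMeasure d)) :
    linftyToDual d (embeddingFun hd ω) u = ω.pairing (densityCurrent hd u) := by
  induction ω using Quotient.inductionOn with | _ σ
  exact linftyToDual_jacSum hd σ u

theorem norm_embeddingFun_le (hd : 0 < d) (ω : PotentialForm d) :
    ‖embeddingFun hd ω‖ ≤ d.factorial * ‖ω‖ := by
  have hf : (0 : ℝ) < d.factorial := by positivity
  rw [← div_le_iff₀' hf]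
  refine PotentialForm.le_norm ω fun σ hσ => ?_
  rw [div_le_iff₀' hf, ← hσ]
  exact norm_jacSum_le σ

/-- The canonical embedding of potential forms into `L^∞`. -/
def embedding (hd : 0 < d) : PotentialForm d →L[ℝ] Lp ℝ ∞ (cubeMeasure d) :=
  LinearMap.mkContinuous
    { toFun := embeddingFun hd
      map_add' := fun ω η => by
        refine linftyToDual_injective d (ContinuousLinearMap.ext fun u => ?_)
        rw [map_add, add_apply]
        simp only [linftyToDual_embeddingFun, PotentialForm.pairing_add, Pi.add_apply]
      map_smul' := fun c ω => by
        refine linftyToDual_injective d (ContinuousLinearMap.ext fun u => ?_)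
        rw [map_smul, smul_apply]
        simp only [linftyToDual_embeddingFun, PotentialForm.pairing_smul, Pi.smul_apply,
          RingHom.id_apply] }
    d.factorial (norm_embeddingFun_le hd)

theorem linftyToDual_embedding (hd : 0 < d) (ω : PotentialForm d) (u : Lp ℝ 1 (cubeMeasure d)) :
    linftyToDual d (embedding hd ω) u = ω.pairing (densityCurrent hd u) :=
  linftyToDual_embeddingFun hd ω u

theorem isCanonicalEmbedding_embedding (hd : 0 < d) : IsCanonicalEmbedding (embedding hd) :=
  fun σ => ⟨summable_norm_jacTerm σ, rfl⟩

/-- The formal Lipschitz sum with a single term. -/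
def FormalSum.single (f : Lip (cube d)) (π : Fin d → Lip (cube d)) : FormalSum d where
  f i := if i = 0 then f else 0
  π _ := π
  summable := by
    refine summable_of_ne_finset_zero (s := {0}) fun i hi => ?_
    have h : lipNorm (0 : Lip (cube d)) = 0 := by simpa using lipNorm_smul 0 (0 : Lip (cube d))
    rw [if_neg (by simpa using hi), h, zero_mul]

theorem FormalSum.eval_single (T : MetricCurrent (cube d) d) (f : Lip (cube d))
    (π : Fin d → Lip (cube d)) :
    (FormalSum.single f π).eval T = T.toMap (Lip.toLipc f) π := by
  rw [FormalSum.eval, tsum_eq_single 0]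
  · rfl
  · intro i hi
    change T.toMap (Lip.toLipc (if i = 0 then f else 0)) π = 0
    rw [if_neg hi, map_zero, map_zero, zero_apply]

/-- The bound on single terms sums over any representative, and the infimum over representatives is
the potential norm. -/
theorem PotentialForm.abs_pairing_le {T : MetricCurrent (cube d) d} {ε : ℝ} (hε : 0 < ε)
    (hT : ∀ (f : Lip (cube d)) (π : Fin d → Lip (cube d)),
      |T.toMap (Lip.toLipc f) π| ≤ ε * (lipNorm f * ∏ j, lipConst (π j)))
    (ω : PotentialForm d) : |ω.pairing T| ≤ ε * ‖ω‖ := by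
  rw [← div_le_iff₀' hε]
  refine PotentialForm.le_norm ω fun σ hσ => ?_
  have h1 := norm_tsum_le_tsum_norm (f := fun i => T.toMap (Lip.toLipc (σ.f i)) (σ.π i))
    (FormalSum.summable_abs_eval T σ)
  have h2 := (FormalSum.summable_abs_eval T σ).tsum_le_tsum (fun i => hT (σ.f i) (σ.π i))
    (σ.summable.mul_left ε)
  rw [tsum_mul_left] at h2
  rw [div_le_iff₀' hε, ← hσ]
  exact h1.trans h2

/-- An irregular density `u` defines a weak-`*` open half-space at height `1 / (4 n)`. The image of
the unit ball stays outside since its pairings with `u` are at most `1 / (4 n)`, while the clamped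
`u` divided by `n` is small in norm and pairs with `u` to at least `1 / (2 n)`. -/
theorem stronglyNonSurjective_embedding (hd : 2 ≤ d) :
    StronglyNonSurjective ((linftyToDual d).comp (embedding (by omega : 0 < d))) := by
  intro n hn
  have hd0 : 0 < d := by omega
  have hn' : (0 : ℝ) < n := by exact_mod_cast hn
  have hε : (0 : ℝ) < 1 / (4 * n) := by positivity
  obtain ⟨u, U, ⟨C, hC⟩, hU, hm, hb⟩ := exists_irregular_toL1 hd hε
  obtain ⟨K, hK⟩ := exists_lipschitzWith_clampTwice hC
  set F : Lip (Rd d) := (1 / (n : ℝ)) • ⟨fun x => clampTwice (u x), K, hK⟩ with hF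
  have hFx : ∀ x, (F : Rd d → ℝ) x = 1 / n * clampTwice (u x) := fun x => rfl
  -- Any Lipschitz function on the cube is in the range: its coefficient form with respect to the
  -- coordinates has Jacobian one.
  set ω : PotentialForm d := PotentialForm.mk (FormalSum.single (restrictLip d F)
    fun j => restrictLip d (coord d j)) with hω
  have hval : ∀ v : Lp ℝ 1 (cubeMeasure d), linftyToDual d (embedding hd0 ω) v
      = ∫ x in cube d, v x * (F : Rd d → ℝ) x := by
    intro v
    rw [linftyToDual_embedding, hω]
    refine (FormalSum.eval_single _ _ _).trans ?_
    exact setIntegral_mul_restrictLip_coord v F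
  refine ⟨linftyToDual d (embedding hd0 ω), ?_, ⟨ω, rfl⟩,
    {ψ | 1 / (4 * (n : ℝ)) < ψ U}, ?_, ?_, fun η hη => ?_⟩
  · refine ContinuousLinearMap.opNorm_le_bound _ (by positivity) fun v => ?_
    rw [hval, L1.norm_eq_integral_norm, ← integral_const_mul]
    refine norm_integral_le_of_norm_le ((L1.integrable_coeFn v).norm.const_mul _)
      (ae_of_all _ fun x => ?_)
    rw [norm_mul, mul_comm, hFx, norm_mul, Real.norm_of_nonneg (by positivity : 0 ≤ 1 / (n : ℝ))]
    exact mul_le_mul_of_nonneg_right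
      (mul_le_of_le_one_right (by positivity) (abs_clampTwice_le_one _)) (norm_nonneg _)
  · exact isOpen_lt continuous_const (WeakDual.eval_continuous U)
  · have h1 : linftyToDual d (embedding hd0 ω) U
        = 1 / n * ∫ x in cube d, u x * clampTwice (u x) := by
      rw [hval, ← integral_const_mul]
      refine integral_congr_ae ?_
      filter_upwards [hU] with x hx
      rw [hx, hFx]
      ring
    have h2 := half_le_setIntegral_mul_clampTwice hC hm
    have h3 : 1 / (n : ℝ) * (1 / 2) ≤ 1 / n * ∫ x in cube d, u x * clampTwice (u x) :=
      mul_le_mul_of_nonneg_left h2 (by positivity)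
    have h4 : 1 / (4 * (n : ℝ)) < 1 / n * (1 / 2) := by
      rw [div_mul_div_comm, one_mul]
      exact one_div_lt_one_div_of_lt (by positivity) (by linarith)
    change 1 / (4 * (n : ℝ)) < linftyToDual d (embedding hd0 ω) U
    rw [h1]
    exact h4.trans_le h3
  · have h1 : |linftyToDual d (embedding hd0 η) U| ≤ 1 / (4 * n) * ‖η‖ := by
      rw [linftyToDual_embedding]
      exact PotentialForm.abs_pairing_le hε (fun f π => hb f π) η
    have h2 : ¬ 1 / (4 * (n : ℝ)) < linftyToDual d (embedding hd0 η) U := by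
      refine not_lt.2 ((le_abs_self _).trans (h1.trans ?_))
      exact mul_le_of_le_one_right hε.le hη
    exact h2

end Embedding

end MetricCurrents

end

noncomputable section

namespace MetricCurrents

variable {d : ℕ}

/-! ### A current that is unbounded on bounded test functions -/

section UnboundedCurrent

/-- A smooth compactly supported Lipschitz function. -/
def SmoothTest (φ : Lipc (Rd d)) : Prop := ContDiff ℝ ((⊤ : ℕ∞) : WithTop ℕ∞) (φ : Rd d → ℝ)

theorem tsupport_subset_closedBall_of_norm {f : Rd d → ℝ} {R : ℝ} (h : ∀ x, R < ‖x‖ → f x = 0) :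
    tsupport f ⊆ Metric.closedBall 0 R := by
  refine closure_minimal (fun x hx => ?_) Metric.isClosed_closedBall
  rw [mem_closedBall_zero_iff]
  by_contra hcon
  exact hx (h x (not_le.1 hcon))

/-- Mollification does not affect lower bounds for the values of a metric current. -/
theorem MetricCurrent.exists_smooth_lt (T : MetricCurrent (Rd d) d) {f : Lipc (Rd d)}
    (hf : ∀ x, |(f : Rd d → ℝ) x| ≤ 1) {C : ℝ} (hC : C < T.toMap f (coord d)) :
    ∃ φ : Lipc (Rd d), SmoothTest φ ∧ (∀ x, |(φ : Rd d → ℝ) x| ≤ 1) ∧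
      C < T.toMap φ (coord d) := by
  obtain ⟨K, hK⟩ := f.2.1
  obtain ⟨R, hR⟩ := f.2.2.isCompact.isBounded.exists_norm_le
  have h0 : ∀ x, R < ‖x‖ → (f : Rd d → ℝ) x = 0 := fun x hx => by
    by_contra h
    exact absurd (hR x (subset_tsupport _ h)) (not_le.2 hx)
  have hsupp : ∀ k, tsupport (mollify k (f : Rd d → ℝ)) ⊆ Metric.closedBall 0 (R + 2) := fun k =>
    tsupport_subset_closedBall_of_norm fun x hx => mollify_eq_zero k h0 hx
  have hcs : ∀ k, HasCompactSupport (mollify k (f : Rd d → ℝ)) := fun k =>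
    (isCompact_closedBall _ _).of_isClosed_subset (isClosed_tsupport _) (hsupp k)
  set F : ℕ → Lipc (Rd d) := fun k =>
    ⟨mollify k (f : Rd d → ℝ), ⟨K, lipschitzWith_mollify k hK⟩, hcs k⟩ with hF
  -- Joint continuity applies: the mollifications keep the Lipschitz constant and their supports lie
  -- in one ball.
  have hlim : Tendsto (fun k => T.toMap (F k) (coord d)) atTop (𝓝 (T.toMap f (coord d))) := by
    refine T.continuity F f (fun _ => coord d) (coord d)
      (fun x => tendsto_mollify hK.continuous x) (fun j x => tendsto_const_nhds)
      ⟨max K 1, fun i => ⟨(lipschitzWith_mollify i hK).weaken (le_max_left _ _), fun j => ?_⟩⟩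
      ⟨Metric.closedBall 0 (R + 2), isCompact_closedBall _ _,
        tsupport_subset_closedBall_of_norm fun x hx => h0 x (by linarith), hsupp⟩
    refine LipschitzWith.weaken (K := 1) ?_ (le_max_right _ _)
    refine LipschitzWith.of_dist_le_mul fun x y => ?_
    rw [NNReal.coe_one, one_mul, dist_eq_norm, dist_eq_norm]
    exact PiLp.norm_apply_le (x - y) j
  obtain ⟨k, hk⟩ := (hlim.eventually (lt_mem_nhds hC)).exists
  exact ⟨F k, contDiff_mollify k hK.continuous, abs_mollify_le k hf, hk⟩

/-- There is a current in the cube which is unbounded on the test functions bounded by one. -/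
theorem exists_unbounded_current (hd : 2 ≤ d) : ∃ T : MetricCurrent (Rd d) d,
    T.SupportedIn (cube d) ∧ ∀ C : ℝ, ∃ φ : Lipc (Rd d), SmoothTest φ ∧
      (∀ x, |(φ : Rd d → ℝ) x| ≤ 1) ∧ C < T.toMap φ (coord d) := by
  have hd0 : 0 < d := by omega
  have hpow : ∀ k : ℕ, (1 / 2 : ℝ) ^ (k + 1) + (1 / 2) ^ (k + 1) = (1 / 2) ^ k := fun k => by
    rw [pow_succ]
    ring
  -- The `k`-th density lives in the box with all coordinates between `2^(-(k+1))` and `2^(-k)`.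
  -- These boxes are disjoint, and the norms `2^(-k)` as currents are summable although every mass
  -- is at least one.
  choose u hL hs hm hb using fun k : ℕ => exists_irregular_density hd
    (ε := (1 / 2) ^ k) (by positivity) (z := WithLp.toLp 2 fun _ => (1 / 2 : ℝ) ^ (k + 1))
    (fun i => by positivity) (r := (1 / 2) ^ (k + 1)) (by positivity)
    (fun i => (hpow k).trans_le (pow_le_one₀ (by norm_num) (by norm_num)))
  choose C hC using hL
  have hdisj : ∀ {k l : ℕ} {x : Rd d}, u k x ≠ 0 → u l x ≠ 0 → k = l := by
    have key : ∀ {k l : ℕ} {x : Rd d}, k < l → u k x ≠ 0 → u l x ≠ 0 → False := by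
      intro k l x hkl hk hl
      have h1 := (hs k x hk ⟨0, hd0⟩).1
      have h2 := (hs l x hl ⟨0, hd0⟩).2
      change (1 / 2 : ℝ) ^ (k + 1) < _ at h1
      change _ < (1 / 2 : ℝ) ^ (l + 1) + (1 / 2) ^ (l + 1) at h2
      rw [hpow] at h2
      have h3 : (1 / 2 : ℝ) ^ l ≤ (1 / 2) ^ (k + 1) :=
        pow_le_pow_of_le_one (by norm_num) (by norm_num) hkl
      linarith
    intro k l x hk hl
    rcases lt_trichotomy k l with h | h | h
    · exact (key h hk hl).elim
    · exact h
    · exact (key h hl hk).elim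
  have hi : ∀ k, Integrable (u k) (cubeMeasure d) := fun k =>
    (hC k).continuous.continuousOn.integrableOn_compact (isCompact_cube d)
  have hcube : ∀ k x, x ∉ cube d → u k x = 0 := by
    intro k x hx
    by_contra h
    refine hx fun i => ?_
    have h1 := hs k x h i
    have h2 : (0 : ℝ) < (1 / 2) ^ (k + 1) := by positivity
    have h3 : (1 / 2 : ℝ) ^ (k + 1) + (1 / 2) ^ (k + 1) ≤ 1 :=
      (hpow k).trans_le (pow_le_one₀ (by norm_num) (by norm_num))
    exact ⟨h2.le.trans h1.1.le, h1.2.le.trans h3⟩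
  have hb' : ∀ (k : ℕ) (f : Lip (cube d)) (π : Fin d → Lip (cube d)),
      |(cubeCurrent hd0 (u k) (hi k)).toMap (Lip.toLipc f) π|
        ≤ (1 / 2) ^ k * (lipNorm f * ∏ j, lipConst (π j)) := fun k f π => hb k f π
  set T₀ : MetricCurrent (cube d) d := tsumCurrent (fun k => cubeCurrent hd0 (u k) (hi k))
    (fun k => (1 / 2) ^ k) (summable_geometric_of_lt_one (by norm_num) (by norm_num)) hb' with hT₀
  refine ⟨pushCube T₀, supportedIn_pushCube T₀, fun c => ?_⟩
  -- Each of the first `n` densities will contribute at least `1 / 2`.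
  obtain ⟨n, hn⟩ := exists_nat_gt (2 * c)
  have hsumL : ∃ K, LipschitzWith K fun x => ∑ k ∈ Finset.range n, u k x :=
    (Lip (Rd d)).sum_mem (t := Finset.range n) (f := u) (fun k _ => ⟨C k, hC k⟩) |>.imp
      fun K hK => by simpa only [Finset.sum_fn] using hK
  obtain ⟨K, hK⟩ := hsumL
  obtain ⟨K', hK'⟩ := exists_lipschitzWith_clampTwice hK
  set g : Rd d → ℝ := fun x => clampTwice (∑ k ∈ Finset.range n, u k x) with hg
  have hg0 : ∀ x, x ∉ cube d → g x = 0 := fun x hx => by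
    rw [hg]
    simp only [hcube _ x hx, Finset.sum_const_zero, clampTwice_zero]
  have hgc : HasCompactSupport g := HasCompactSupport.intro (isCompact_cube d) hg0
  -- By disjointness of the supports, clamping the partial sum clamps each density separately, so
  -- `g` stays bounded by one while all `n` contributions add up.
  have hterm : ∀ l x, u l x * g x = if l < n then u l x * clampTwice (u l x) else 0 := by
    intro l x
    by_cases hx : u l x = 0
    · simp [hx]
    have h1 : ∀ k, k ≠ l → u k x = 0 := fun k hk => by
      by_contra h
      exact hk (hdisj h hx)
    rw [hg]
    split_ifs with hl
    · change u l x * clampTwice (∑ k ∈ Finset.range n, u k x) = _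
      rw [Finset.sum_eq_single_of_mem l (Finset.mem_range.2 hl) fun k _ hk => h1 k hk]
    · change u l x * clampTwice (∑ k ∈ Finset.range n, u k x) = _
      rw [Finset.sum_eq_zero fun k hk => h1 k ?_, clampTwice_zero, mul_zero]
      rintro rfl
      exact hl (Finset.mem_range.1 hk)
  refine MetricCurrent.exists_smooth_lt (pushCube T₀) (f := ⟨g, ⟨K', hK'⟩, hgc⟩)
    (fun x => abs_clampTwice_le_one _) ?_
  have hval : (pushCube T₀).toMap ⟨g, ⟨K', hK'⟩, hgc⟩ (coord d)
      = ∑' l, ∫ x in cube d, u l x * g x := by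
    rw [pushCube_apply, hT₀, tsumCurrent_apply]
    exact tsum_congr fun l => setIntegral_mul_restrictLip_coord (u l) ⟨g, K', hK'⟩
  have hout : ∀ l ∉ Finset.range n, ∫ x in cube d, u l x * g x = 0 := fun l hl => by
    simp only [hterm, if_neg (fun h => hl (Finset.mem_range.2 h)), integral_zero]
  rw [hval, tsum_eq_sum hout]
  have hin : ∀ l ∈ Finset.range n, (1 / 2 : ℝ) ≤ ∫ x in cube d, u l x * g x := fun l hl => by
    simp only [hterm, if_pos (Finset.mem_range.1 hl)]
    exact half_le_setIntegral_mul_clampTwice (hC l) (hm l)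
  have := Finset.card_nsmul_le_sum _ _ _ hin
  rw [Finset.card_range, nsmul_eq_mul] at this
  linarith

theorem not_isGivenByL1_of_unbounded {T : MetricCurrent (Rd d) d}
    (hT : ∀ C : ℝ, ∃ φ : Lipc (Rd d), SmoothTest φ ∧
      (∀ x, |(φ : Rd d → ℝ) x| ≤ 1) ∧ C < T.toMap φ (coord d)) : ¬ T.IsGivenByL1 := by
  rintro ⟨u, hu⟩
  obtain ⟨φ, hφ, h1, h2⟩ := hT (∫ x in cube d, ‖u x‖)
  rw [hu φ hφ] at h2
  have h3 : ‖∫ x in cube d, u x * (φ : Rd d → ℝ) x‖ ≤ ∫ x in cube d, ‖u x‖ := ?_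
  · exact absurd ((le_abs_self _).trans h3) (not_le.2 h2)
  refine norm_integral_le_of_norm_le (L1.integrable_coeFn u).norm (ae_of_all _ fun x => ?_)
  rw [norm_mul]
  exact mul_le_of_le_one_right (norm_nonneg _) (h1 x)

end UnboundedCurrent

/-! ### Flat chains of top dimension -/

section FlatChains

/-- The determinant as an alternating map on Euclidean space. -/
def euclideanDet (d : ℕ) : Rd d [⋀^Fin d]→ₗ[ℝ] ℝ :=
  Matrix.detRowAlternating.compLinearMap (WithLp.linearEquiv 2 ℝ (Fin d → ℝ)).toLinearMap

theorem euclideanDet_apply (v : Fin d → Rd d) :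
    euclideanDet d v = (Matrix.of fun i j : Fin d => v j i).det :=
  (Matrix.det_transpose _).symm

/-- The standard volume form. -/
def volumeForm (d : ℕ) : Covector d d where
  toMultilinearMap := (euclideanDet d).toMultilinearMap
  cont := by
    have h : Continuous fun v : Fin d → Rd d => (Matrix.of fun i j : Fin d => v j i).det :=
      Continuous.matrix_det (by fun_prop)
    exact h.congr fun v => (euclideanDet_apply v).symm
  map_eq_zero_of_eq' := (euclideanDet d).map_eq_zero_of_eq'

theorem volumeForm_apply (v : Fin d → Rd d) :
    volumeForm d v = (Matrix.of fun i j : Fin d => v j i).det := euclideanDet_apply v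

/-- More than `d` vectors in `ℝ^d` are dependent. Hence exterior derivatives of top-degree forms
vanish and their flat norm is just the supremum of the comass over `K`. -/
theorem covector_succ_eq_zero (η : Covector d (d + 1)) : η = 0 := by
  ext v
  refine η.toAlternatingMap.map_linearDependent v fun h => ?_
  have := h.fintype_card_le_finrank
  simp at this

/-- The test form `φ dx¹ ∧ … ∧ dxᵈ`. -/
def volumeTestForm (φ : Lipc (Rd d)) (hφ : SmoothTest φ) : TestForm d d where
  toFun x := (φ : Rd d → ℝ) x • volumeForm d
  contDiff' := ContDiff.smul hφ contDiff_const
  hasCompactSupport' := φ.2.2.smul_right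
  tsupport_subset' := fun _ _ => trivial

theorem volumeTestForm_apply (φ : Lipc (Rd d)) (hφ : SmoothTest φ) (x : Rd d) :
    volumeTestForm φ hφ x = (φ : Rd d → ℝ) x • volumeForm d := rfl

theorem IsComparison.apply_volumeTestForm {T : MetricCurrent (Rd d) d} {S : ClassicalCurrent d d}
    (h : IsComparison T S) (φ : Lipc (Rd d)) (hφ : SmoothTest φ) :
    S (volumeTestForm φ hφ) = T.toMap φ (coord d) := by
  have hc : ∀ j : Fin d, (coord d j : Rd d → ℝ) = EuclideanSpace.proj (𝕜 := ℝ) j := fun j => rfl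
  refine h φ (coord d) hφ (fun j => ?_) _ fun x v => ?_
  · rw [hc]
    exact (EuclideanSpace.proj (𝕜 := ℝ) j).contDiff
  · rw [volumeTestForm_apply]
    simp only [hc, ContinuousLinearMap.fderiv]
    exact congrArg ((φ : Rd d → ℝ) x * ·) (volumeForm_apply v)

/-- The `+ 1` in the normalisation keeps the divisor positive without any knowledge of the comass of
the volume form. -/
theorem formFlatNorm_smul_volumeTestForm_le (K : Set (Rd d)) {φ : Lipc (Rd d)}
    (hφ : SmoothTest φ) (h1 : ∀ x, |(φ : Rd d → ℝ) x| ≤ 1) :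
    ClassicalCurrent.formFlatNorm K ((‖volumeForm d‖ + 1)⁻¹ • volumeTestForm φ hφ) ≤ 1 := by
  refine max_le (iSup₂_le fun x _ => ?_) (iSup₂_le fun x _ => ?_)
  · change ‖(‖volumeForm d‖ + 1)⁻¹ • ((φ : Rd d → ℝ) x • volumeForm d)‖ₑ ≤ 1
    rw [← ofReal_norm, ENNReal.ofReal_le_one]
    have hpos : 0 < ‖volumeForm d‖ + 1 := by positivity
    rw [norm_smul, norm_smul, norm_inv, Real.norm_of_nonneg hpos.le, inv_mul_le_iff₀ hpos, mul_one]
    refine (mul_le_of_le_one_left (norm_nonneg _) (h1 x)).trans (by linarith)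
  · rw [covector_succ_eq_zero (extDeriv _ x)]
    simp

/-- A flat chain of top dimension is bounded on the test forms bounded by one. -/
theorem exists_bound_of_mem_flatChains (hd : 0 < d) {S : ClassicalCurrent d d} {K : Set (Rd d)}
    (hS : S ∈ ClassicalCurrent.flatChains d K) :
    ∃ C : ℝ, ∀ (φ : Lipc (Rd d)) (hφ : SmoothTest φ), (∀ x, |(φ : Rd d → ℝ) x| ≤ 1) →
      |S (volumeTestForm φ hφ)| ≤ C := by
  -- A single normal current at flat distance less than one suffices, and only its finite mass is
  -- used: it bounds `N`, and the flat distance bounds `S - N`, on forms `φ dx¹ ∧ … ∧ dxᵈ` with `|φ|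
  -- ≤ 1`.
  obtain ⟨N, hN, -, hSN⟩ := hS 1 one_pos
  have hfm : N.FiniteMass := by
    -- Normality is defined by cases on the degree, so the degree is exhibited as a successor.
    obtain ⟨m, rfl⟩ : ∃ m, d = m + 1 := ⟨d - 1, by omega⟩
    exact hN.1
  obtain ⟨μ, τ, _, hint, hμ⟩ := hfm
  refine ⟨(∫ x, ‖τ x (volumeForm d)‖ ∂μ) + (‖volumeForm d‖ + 1), fun φ hφ h1 => ?_⟩
  have hpos : 0 < ‖volumeForm d‖ + 1 := by positivity
  have hNb : |N (volumeTestForm φ hφ)| ≤ ∫ x, ‖τ x (volumeForm d)‖ ∂μ := by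
    rw [hμ, ← Real.norm_eq_abs]
    refine norm_integral_le_of_norm_le (hint _).norm (ae_of_all _ fun x => ?_)
    rw [volumeTestForm_apply, map_smul, norm_smul]
    exact mul_le_of_le_one_left (norm_nonneg _) (h1 x)
  have hD : |(S - N) (volumeTestForm φ hφ)| ≤ ‖volumeForm d‖ + 1 := by
    have h2 : ‖(S - N) ((‖volumeForm d‖ + 1)⁻¹ • volumeTestForm φ hφ)‖ₑ ≤ 1 := by
      refine le_trans ?_ hSN.le
      exact le_iSup₂ (f := fun (ω : TestForm d d)
        (_ : ClassicalCurrent.formFlatNorm K ω ≤ 1) => ‖(S - N) ω‖ₑ) _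
        (formFlatNorm_smul_volumeTestForm_le K hφ h1)
    rw [map_smul, ← ofReal_norm, ENNReal.ofReal_le_one, norm_smul, norm_inv,
      Real.norm_of_nonneg hpos.le, inv_mul_le_iff₀ hpos, mul_one] at h2
    exact h2
  have e : S (volumeTestForm φ hφ) = N (volumeTestForm φ hφ) + (S - N) (volumeTestForm φ hφ) := by
    rw [sub_apply]
    ring
  rw [e]
  exact (abs_add_le _ _).trans (add_le_add hNb hD)

theorem not_isFlat_of_unbounded (hd : 0 < d) {T : MetricCurrent (Rd d) d}
    (hT : ∀ C : ℝ, ∃ φ : Lipc (Rd d), SmoothTest φ ∧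
      (∀ x, |(φ : Rd d → ℝ) x| ≤ 1) ∧ C < T.toMap φ (coord d)) : ¬ T.IsFlat := by
  rintro ⟨S, hTS, K, -, hS⟩
  obtain ⟨C, hC⟩ := exists_bound_of_mem_flatChains hd hS
  obtain ⟨φ, hφ, h1, h2⟩ := hT C
  have := hC φ hφ h1
  rw [hTS.apply_volumeTestForm] at this
  exact absurd ((le_abs_self _).trans this) (not_le.2 h2)

end FlatChains

end MetricCurrents

end

theorem corollary5 (d : ℕ) (hd : 2 ≤ d) :
    (∃ Em : PotentialForm d →L[ℝ] MeasureTheory.Lp ℝ ⊤ (cubeMeasure d),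
      IsCanonicalEmbedding Em ∧ StronglyNonSurjective ((linftyToDual d).comp Em)) ∧
    StrongLipschitzNonRegularity d ∧
    (∃ T : MetricCurrent (EuclideanSpace ℝ (Fin d)) d,
      T.SupportedIn (cube d) ∧ ¬ T.IsGivenByL1 ∧ ¬ T.IsFlat) := by
  have hd0 : 0 < d := by omega
  obtain ⟨T, hT, hT'⟩ := exists_unbounded_current hd
  exact ⟨⟨embedding hd0, isCanonicalEmbedding_embedding hd0, stronglyNonSurjective_embedding hd⟩,
    strongLipschitzNonRegularity hd, T, hT, not_isGivenByL1_of_unbounded hT',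
    not_isFlat_of_unbounded hd0 hT'⟩
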